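/- Let $G=(V,E)$ be a finite simple undirected graph with $n=|V|$ and $m=|E|\ge 1$, and let $k\ge 3$ be an integer. For a graph $H$ and a set $S$ of vertices let $N(S,H)$ be the set of common neighbours in $H$ of all vertices of $S$. A *truss-based edge ordering* of $G$ is an enumeration $e_1,\dots,e_m$ of $E$ such that, for every $i$, the number $|N(V(e_i),\overline G_i)|$ is the minimum of $|N(V(e),\overline G_i)|$ over $e\in\{e_i,\dots,e_m\}$, where $V(e)$ is the set of the two ends of $e$ and $\overline G_i$ is the graph with edge set $\{e_i,\dots,e_m\}$; ties are broken arbitrarily. Let $\tau=\max_i|N(V(e_i),\overline G_i)|$, and let $\delta$ be the degeneracy of $G$, the largest $d$ such that $G$ has a non-empty subgraph of minimum degree at least $d$. The algorithm EBBkC-T computes a truss-based edge ordering $e_1,\dots,e_m$ of $G$ by repeatedly removing an edge whose ends have the fewest common neighbours in the remaining graph. Let $g_i$ be the graph with vertex set $N(V(e_i),\overline G_i)$ whose edges are the edges of $\overline G_i$ between these vertices. For $i=1,\dots,m$ the algorithm calls $\mathrm{List}(V(e_i),g_i,k-2)$. The call $\mathrm{List}(S,g,l)$ returns at once if $|V(g)|<l$;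 otherwise, if $l=1$, it prints $S\cup\{v\}$ for every vertex $v$ of $g$; if $l=2$, it prints $S\cup V(e)$ for every edge $e$ of $g$; and if $l\ge 3$, it calls, for every edge $e=e_i$ of $g$, $\mathrm{List}(S\cup V(e),g',l-2)$ with $g'=(V(g)\cap V(g_i),\,E(g)\cap E(g_i))$. **Theorem.** EBBkC-T can be implemented on a unit-cost random access machine with zero-initialised sparse tables (look-up in constant time, space equal to the number of cells written, including the input, plus the recursion stack; the graph is given as a list of its edges in any order, and the write-only output is not counted as space) in such a way that, with an absolute constant $C$, for every $G$ with $m\ge1$ and every $k\ge3$ it halts, prints every $k$-clique of $G$ exactly once and nothing else, and uses at most $C\bigl(\delta m+km(\tau/2)^{k-2}\bigr)$ steps and at most $C(m+n)$ words of memory. Moreover $\tau<\delta$, and the time bound and this inequality hold with the $\tau$ of every truss-based edge ordering of $G$. -/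

import Mathlib

/-! ### Graph-theoretic notions -/

/-- `N(S, H)`: the common neighbours in `H` of all the vertices of `S`. -/
def commonNbrs {V : Type*} (H : SimpleGraph V) (S : Set V) : Set V :=
  {w | ∀ u ∈ S, H.Adj w u}

/-- The degeneracy: the largest `d` such that the `d`-core is non-empty, that is, such that some
non-empty set of vertices induces a subgraph in which all degrees are at least `d`. -/
noncomputable def degeneracy {V : Type*} (G : SimpleGraph V) : ℕ :=
  sSup {d | ∃ s : Finset V, s.Nonempty ∧ ∀ v ∈ s, d ≤ {w | w ∈ s ∧ G.Adj v w}.ncard}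

/-- The number of common neighbours of the two ends of `e` in the graph whose edges are those of
the list `l`. -/
noncomputable def support {V : Type*} (l : List (Sym2 V)) (e : Sym2 V) : ℕ :=
  (commonNbrs (SimpleGraph.fromEdgeSet {f | f ∈ l}) {u | u ∈ e}).ncard

/-- Each edge of the list has, among itself and the edges behind it, the smallest number of common
neighbours in the graph formed by itself and the edges behind it. -/
def IsGreedy {V : Type*} : List (Sym2 V) → Prop
  | [] => True
  | e :: l => (∀ f ∈ e :: l, support (e :: l) e ≤ support (e :: l) f) ∧ IsGreedy l

/-- `p` is a truss-based edge ordering of `G` (ties are broken arbitrarily). -/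
def IsTrussOrdering {V : Type*} (G : SimpleGraph V) (p : List (Sym2 V)) : Prop :=
  p.Nodup ∧ (∀ e, e ∈ p ↔ e ∈ G.edgeSet) ∧ IsGreedy p

/-- `τ`: the largest size `|V(gᵢ)| = |N(V(eᵢ), G[eᵢ, …, eₘ])|` of a graph instance produced by
branching along the edge ordering `e₁, …, eₘ`. -/
noncomputable def tau {V : Type*} : List (Sym2 V) → ℕ
  | [] => 0
  | e :: l => max (support (e :: l) e) (tau l)

/-! ### The machine

A unit-cost random access machine.  Its memory consists of zero-initialised tables of natural
numbers; a cell is given by the name of a table and two indices (the second one is `0` in tables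
used as plain arrays).  The tables are sparse: as in a hash table, only the cells in which
something is stored take space.  There is one recursive procedure; each activation has its own
finite set of registers, and the tables are global.  There is a write-only output tape. -/

namespace RAM

inductive Expr (R A : Type) : Type
  | num (c : ℕ)
  | var (x : R)
  | get (a : A) (i j : Expr R A)
  | add (e f : Expr R A)
  | sub (e f : Expr R A)

inductive Test (R A : Type) : Type
  | lt (e f : Expr R A)
  | eq (e f : Expr R A)
  | and (b c : Test R A)

inductive Cmd (R A : Type) : Type
  | skip
  | set (x : R) (e : Expr R A)
  | store (a : A) (i j e : Expr R A)
  | out (e : Expr R A)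
  | seq (c d : Cmd R A)
  | ite (b : Test R A) (c d : Cmd R A)
  | while (b : Test R A) (c : Cmd R A)
  | call (args : List (R × Expr R A))

structure State (R A : Type) : Type where
  /-- registers of the current activation -/
  reg : R → ℕ
  mem : A → ℕ → ℕ → ℕ
  /-- the cells holding the input and all cells written so far -/
  used : Finset (A × ℕ × ℕ)
  /-- the numbers printed so far, in this order -/
  output : List ℕ
  /-- number of elementary steps executed so far -/
  time : ℕ
  /-- number of activations that are open now -/
  depth : ℕ
  /-- largest number of activations that have been open at the same time -/
  maxDepth : ℕ

variable {R A : Type}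

/-- Number of memory words used: written cells, and all registers of the call stack. -/
def State.space [Fintype R] (s : State R A) : ℕ :=
  s.used.card + s.maxDepth * (Fintype.card R + 1)

def State.tick (s : State R A) (t : ℕ) : State R A := { s with time := s.time + t }

def Expr.eval (s : State R A) : Expr R A → ℕ
  | num c => c
  | var x => s.reg x
  | get a i j => s.mem a (i.eval s) (j.eval s)
  | add e f => e.eval s + f.eval s
  | sub e f => e.eval s - f.eval s

def Expr.cost : Expr R A → ℕ
  | num _ => 1
  | var _ => 1
  | get _ i j => i.cost + j.cost + 1
  | add e f => e.cost + f.cost + 1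
  | sub e f => e.cost + f.cost + 1

def Test.eval (s : State R A) : Test R A → Bool
  | lt e f => decide (e.eval s < f.eval s)
  | eq e f => decide (e.eval s = f.eval s)
  | and b c => b.eval s && c.eval s

def Test.cost : Test R A → ℕ
  | lt e f => e.cost + f.cost + 1
  | eq e f => e.cost + f.cost + 1
  | and b c => b.cost + c.cost + 1

section
variable [DecidableEq R] [DecidableEq A]

def State.setReg (s : State R A) (x : R) (c : ℕ) : State R A :=
  { s with reg := Function.update s.reg x c }

def State.setMem (s : State R A) (a : A) (i j c : ℕ) : State R A :=
  { s with
    mem := Function.update s.mem a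
      (Function.update (s.mem a) i (Function.update (s.mem a i) j c))
    used := insert (a, i, j) s.used }

def State.print (s : State R A) (c : ℕ) : State R A := { s with output := s.output ++ [c] }

/-- The registers of a new activation: the arguments, and `0` elsewhere. -/
def frame (s : State R A) : List (R × Expr R A) → R → ℕ
  | [] => fun _ => 0
  | (x, e) :: l => Function.update (frame s l) x (e.eval s)

def State.enter (s : State R A) (args : List (R × Expr R A)) : State R A :=
  { s with
    reg := frame s args
    depth := s.depth + 1
    maxDepth := max s.maxDepth (s.depth + 1) }

def State.leave (s caller : State R A) : State R A :=
  { s with reg := caller.reg, depth := caller.depth }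

def argsCost : List (R × Expr R A) → ℕ
  | [] => 0
  | (_, e) :: l => e.cost + 1 + argsCost l

/-- `Exec P c s s'`: started in state `s`, the command `c` halts, in state `s'`; `P` is the body of
the recursive procedure. -/
inductive Exec (P : Cmd R A) : Cmd R A → State R A → State R A → Prop
  | skip (s) : Exec P .skip s (s.tick 1)
  | set (x e s) : Exec P (.set x e) s ((s.setReg x (e.eval s)).tick (e.cost + 1))
  | store (a i j e s) : Exec P (.store a i j e) s
      ((s.setMem a (i.eval s) (j.eval s) (e.eval s)).tick (i.cost + j.cost + e.cost + 1))
  | out (e s) : Exec P (.out e) s ((s.print (e.eval s)).tick (e.cost + 1))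
  | seq {c d s₁ s₂ s₃} : Exec P c s₁ s₂ → Exec P d s₂ s₃ → Exec P (.seq c d) s₁ s₃
  | ite_true {b c d s s'} : b.eval s = true → Exec P c (s.tick (b.cost + 1)) s' →
      Exec P (.ite b c d) s s'
  | ite_false {b c d s s'} : b.eval s = false → Exec P d (s.tick (b.cost + 1)) s' →
      Exec P (.ite b c d) s s'
  | while_true {b c s₁ s₂ s₃} : b.eval s₁ = true → Exec P c (s₁.tick (b.cost + 1)) s₂ →
      Exec P (.while b c) s₂ s₃ → Exec P (.while b c) s₁ s₃
  | while_false {b c s} : b.eval s = false → Exec P (.while b c) s (s.tick (b.cost + 1))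
  | call {args s s'} : Exec P P ((s.enter args).tick (argsCost args + 1)) s' →
      Exec P (.call args) s (s'.leave s)

end

/-! Abbreviations for writing programs -/

instance : Coe R (Expr R A) := ⟨Expr.var⟩
instance (c : ℕ) : OfNat (Expr R A) c := ⟨Expr.num c⟩
instance : Add (Expr R A) := ⟨Expr.add⟩
instance : Sub (Expr R A) := ⟨Expr.sub⟩

def block : List (Cmd R A) → Cmd R A
  | [] => .skip
  | c :: l => .seq c (block l)

/-- Conditional without alternative. -/
def when (b : Test R A) (l : List (Cmd R A)) : Cmd R A := .ite b (block l) .skip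

/-- `for x = lo, …, hi - 1 do l`; the bound `hi` is evaluated before every round. -/
def loop (x : R) (lo hi : Expr R A) (l : List (Cmd R A)) : Cmd R A :=
  .seq (.set x lo) (.while (.lt x hi) (.seq (block l) (.set x (.add x 1))))

end RAM

/-! ### The algorithm EBBkC-T

The edges are numbered `1, …, m`, and `0` stands for "no edge". -/

namespace EBBkCT

open RAM

/-- Registers. -/
inductive Reg : Type
  | n | m | k | l | d | i | j | x | y | c | t | q | r | e | f | u | v | w | nv | ne
  deriving DecidableEq

instance : Fintype Reg where
  elems := {.n, .m, .k, .l, .d, .i, .j, .x, .y, .c, .t, .q, .r, .e, .f, .u, .v, .w, .nv, .ne}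
  complete a := by cases a <;> decide

/-- Tables.
* `src`, `dst`: the ends of an edge (the input);
* `edge`: the number of the edge between two vertices; `adj`, `deg`: adjacency lists, degrees;
* `sup`: number of common neighbours of the ends of an edge in the remaining graph;
* `ord`: the truss-based ordering; `pos`: its inverse while it is being computed;
  `start`, `fill`: bucket boundaries; `rank`: the final position of an edge, `0` while unknown;
* `vs`, `es`: the vertices and edges of the instance of the current top-level branch;
  `vlev`, `elev`: the level of the deepest open branch whose instance contains them;
* `clique`: the set `S`. -/
inductive Tab : Type
  | src | dst | edge | adj | deg | sup | ord | pos | start | fill | rank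
  | vs | vlev | es | elev | clique
  deriving DecidableEq

/-- Read and write a table used as a plain array. -/
def rd (a : Tab) (i : Expr Reg Tab) : Expr Reg Tab := .get a i 0
def wr (a : Tab) (i e : Expr Reg Tab) : Cmd Reg Tab := .store a i 0 e

section
open Reg Tab

/-- Adjacency lists and the edge look-up table. -/
def buildGraph : Cmd Reg Tab :=
  loop e 1 (m + 1) [
    .set u (rd src e), .set v (rd dst e),
    .store edge u v e, .store edge v u e,
    .store adj u (rd deg u) v, wr deg u (rd deg u + 1),
    .store adj v (rd deg v) u, wr deg v (rd deg v + 1)]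

/-- `u` and `v` become the ends of `e`, where `u` is one of smaller degree. -/
def loadEnds : Cmd Reg Tab :=
  block [
    .set u (rd src e), .set v (rd dst e),
    when (.lt (rd deg v) (rd deg u)) [.set u (rd dst e), .set v (rd src e)]]

/-- Numbers of common neighbours of the ends of all edges, and counting sort by these numbers:
`start[c]` becomes the first position of an edge with at least `c` common neighbours. -/
def sortBySupport : Cmd Reg Tab :=
  block [
    loop e 1 (m + 1) [
      loadEnds, .set c 0,
      loop j 0 (rd deg u) [
        .set w (.get adj u j),
        when (.lt 0 (.get edge v w)) [.set c (c + 1)]],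
      wr sup e c, wr start (c + 1) (rd start (c + 1) + 1)],
    wr start 0 1,
    loop c 1 (m + 1) [wr start c (rd start (c - 1) + rd start c)],
    loop e 1 (m + 1) [
      .set c (rd sup e), .set t (rd start c + rd fill c), wr fill c (rd fill c + 1),
      wr ord t e, wr pos e t]]

/-- The edge `g` loses one common neighbour: it is swapped to the front of its bucket, and the
boundary of the bucket is moved past it (positions up to `i` hold the edges removed so far). -/
def decrease (g : Reg) : Cmd Reg Tab :=
  block [
    .set c (rd sup g), .set t (rd start c), when (.lt t (i + 1)) [.set t (i + 1)],
    .set r (rd ord t), .set q (rd pos g),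
    wr ord t g, wr pos g t, wr ord q r, wr pos r q,
    wr start c (t + 1), wr sup g (c - 1)]

/-- Repeated removal of an edge whose ends have the smallest number of common neighbours. -/
def peel : Cmd Reg Tab :=
  loop i 1 (m + 1) [
    .set e (rd ord i), wr rank e i, loadEnds,
    loop j 0 (rd deg u) [
      .set w (.get adj u j), .set f (.get edge u w), .set x (.get edge v w),
      when (.and (.lt 0 x) (.and (.eq (rd rank f) 0) (.eq (rd rank x) 0))) [
        decrease f, decrease x]]]

/-- Print the vertices `clique[0], …, clique[hi - 1]`. -/
def printPart (hi : Expr Reg Tab) : Cmd Reg Tab := loop j 0 hi [.out (rd clique j)]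

/-- The recursive procedure for a branch `(S, g, l)`.  Here `S` consists of the first `k - l`
entries of `clique`; `g` has the `c` vertices among `vs[0], …, vs[nv - 1]` with `vlev` equal to `d`
and the edges among `es[0], …, es[ne - 1]` with `elev` equal to `d`.  Membership in
`VSet(e)` and `ESet(e)` is tested by means of `rank`; note that `rank[0] = 0`. -/
def listRec : Cmd Reg Tab :=
  .ite (.lt c l) .skip <|
  .ite (.eq l 1)
    (loop x 0 nv [
      when (.eq (rd vlev (rd vs x)) d) [printPart (k - 1), .out (rd vs x)]]) <|
  .ite (.eq l 2)
    (loop x 0 ne [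
      .set f (rd es x),
      when (.eq (rd elev f) d) [printPart (k - 2), .out (rd src f), .out (rd dst f)]]) <|
  loop x 0 ne [
    .set e (rd es x),
    when (.eq (rd elev e) d) [
      .set u (rd src e), .set v (rd dst e),
      wr clique (k - l) u, wr clique (k - l + 1) v,
      .set c 0,
      loop y 0 nv [
        .set w (rd vs y),
        when (.and (.eq (rd vlev w) d)
            (.and (.lt (rd rank e) (rd rank (.get edge u w)))
              (.lt (rd rank e) (rd rank (.get edge v w))))) [
          wr vlev w (d + 1), .set c (c + 1)]],
      -- the edges are not needed in an instance with `l = 1`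
      when (.lt 3 l) [
        loop y 0 ne [
          .set f (rd es y),
          when (.and (.and (.eq (rd elev f) d) (.lt (rd rank e) (rd rank f)))
              (.and (.eq (rd vlev (rd src f)) (d + 1)) (.eq (rd vlev (rd dst f)) (d + 1)))) [
            wr elev f (d + 1)]]],
      .call [(k, k), (l, l - 2), (d, d + 1), (c, c), (nv, nv), (ne, ne)],
      loop y 0 nv [
        .set w (rd vs y),
        when (.eq (rd vlev w) (d + 1)) [wr vlev w d]],
      when (.lt 3 l) [
        loop y 0 ne [
          .set f (rd es y),
          when (.eq (rd elev f) (d + 1)) [wr elev f d]]]]]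

/-- Branching at `(∅, G, k)` along the truss-based edge ordering. -/
def branchTop : Cmd Reg Tab :=
  loop i 1 (m + 1) [
    .set e (rd ord i), loadEnds,
    .set nv 0,
    loop j 0 (rd deg u) [
      .set w (.get adj u j),
      when (.and (.lt i (rd rank (.get edge u w))) (.lt i (rd rank (.get edge v w)))) [
        wr vs nv w, wr vlev w 1, .set nv (nv + 1)]],
    .set ne 0,
    when (.lt 3 k) [
      loop x 0 nv [
        loop y (x + 1) nv [
          .set f (.get edge (rd vs x) (rd vs y)),
          when (.lt i (rd rank f)) [
            wr es ne f, wr elev f 1, .set ne (ne + 1)]]]],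
    wr clique 0 u, wr clique 1 v,
    .call [(k, k), (l, k - 2), (d, 1), (c, nv), (nv, nv), (ne, ne)]]

/-- The whole algorithm. -/
def program : Cmd Reg Tab := block [buildGraph, sortBySupport, peel, branchTop]

end

/-- `L` lists every edge of `G` exactly once, as a pair of vertices in one of the two orders. -/
def IsEdgeList {n : ℕ} (G : SimpleGraph (Fin n)) (L : List (Fin n × Fin n)) : Prop :=
  (L.map fun p => s(p.1, p.2)).Nodup ∧
    ∀ e, e ∈ (L.map fun p => s(p.1, p.2)) ↔ e ∈ G.edgeSet

/-- The initial state: the registers `n`, `m`, `k` and the tables `src`, `dst` hold the input. -/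
def input {n : ℕ} (k : ℕ) (L : List (Fin n × Fin n)) : State Reg Tab where
  reg
    | .n => n
    | .m => L.length
    | .k => k
    | _ => 0
  mem a i j :=
    match a, i, j with
    | .src, i + 1, 0 => (L.map fun p => (p.1 : ℕ)).getD i 0
    | .dst, i + 1, 0 => (L.map fun p => (p.2 : ℕ)).getD i 0
    | _, _, _ => 0
  used := {Tab.src, Tab.dst} ×ˢ (Finset.Icc 1 L.length ×ˢ {0})
  output := []
  time := 0
  depth := 1
  maxDepth := 1

/-- EBBkC-T, run on the graph with edge list `L` and on the clique size `k`, halts in state `s`. -/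
def RunsTo {n : ℕ} (k : ℕ) (L : List (Fin n × Fin n)) (s : State Reg Tab) : Prop :=
  Exec listRec program (input k L) s

/-- The edge ordering left in the table `ord`. -/
def finalOrdering (s : State Reg Tab) (m : ℕ) : List (Sym2 ℕ) :=
  (List.range m).map fun i =>
    s(s.mem .src (s.mem .ord (i + 1) 0) 0, s.mem .dst (s.mem .ord (i + 1) 0) 0)

/-- The output consists of blocks of `k` vertices, which are all the `k`-cliques of `G`, each of
them printed exactly once. -/
def ListsCliques {n : ℕ} (G : SimpleGraph (Fin n)) (k : ℕ) (output : List ℕ) : Prop :=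
  ∃ Q : List (List (Fin n)), output = Q.flatten.map (fun v => (v : ℕ)) ∧
    (∀ q ∈ Q, q.length = k) ∧ (Q.map List.toFinset).Nodup ∧
    ∀ s : Finset (Fin n), s ∈ Q.map List.toFinset ↔ G.IsNClique k s

end EBBkCT

/-! The time splits into two parts: removing the edges one by one, and listing the cliques.

Removal. For each edge only the adjacency list of the end of smaller degree is scanned, and the
bucket-sorted array lets a support drop by one in constant time (`Buckets.decrease`). So the work is
of the order of `m` plus the sum over the edges of the smaller degrees of their ends. This sum is at
most `2δm` (`NumGraph.sum_minDeg_le`): split off a vertex with at most `δ` neighbours in the current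
vertex set, charge its degree to each of the at most `δ` edges lost, and use that the degrees sum to
`2m`.

Listing. A clique has exactly one edge of smallest rank, because ranks are distinct. That edge fixes
the branch in which the clique is found, and the same holds again inside the branch; so every clique
is printed exactly once (`NumGraph.cliqueLists_spec`, `Lists.succ`). The same uniqueness bounds the
work. In a top-level branch with `v` vertices and `l = k - 2`, the calls at depth `j` correspond to
distinct cliques with `2j` vertices (`IsInstance.sum_cliques_le`), so there are at most `v.choose
(2j) ≤ 2(v/2)^(2j)` of them. A call scans the `v` vertices of the top-level instance and, only while
at least two more vertices are wanted, its at most `v²` edges. For `v ≥ 2` this is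
`O((v/2)^(l-2j))`, so each depth costs `O((v/2)^l)`; there are at most `k` depths, and printing
costs `O(k)` per clique. For `v ≤ 1` a branch costs a constant, which over all edges is absorbed by
`δm` (`IsInstance.listCost_le`).

Memory. Subinstances are never copied. Each vertex and edge of the top-level instance carries the
level of the deepest open branch containing it, and the marks are undone after the call. Each nested
call loses at least two vertices, so the stack has at most `n + 1` activations.

The parameter `τ`. The edges from a position where the maximum `τ` is attained onwards form a graph
in which every edge has support at least `τ`. Any other ordering, when it first removes an edge of
that graph, sees support at least `τ`; hence all orderings have the same `τ`
(`IsTrussOrdering.tau_le`). In that graph an end `v` of an edge `vx` has `x` and at least `τ` common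
neighbours of `v` and `x` as neighbours, so all degrees are at least `τ + 1`, whence `τ < δ`
(`IsTrussOrdering.tau_lt_degeneracy`).

The programs are verified with `Runs`, a total-correctness triple with a time bound, over graphs on
natural numbers with numbered edges (`NumGraph`). The number `0` stands for a missing edge and has
rank `0`, so one comparison of ranks tests both for existence and for order. -/

set_option linter.unusedSectionVars false
set_option linter.constructorNameAsVariable false
set_option linter.unusedSimpArgs false

/-! ### Running a program, up to time -/

namespace RAM

variable {R A : Type}

/-- The state with the clock set to `t`. -/
def State.withTime (s : State R A) (t : ℕ) : State R A := { s with time := t }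

section eval

variable (s : State R A)

@[simp] theorem eval_var (x : R) : (Expr.var x : Expr R A).eval s = s.reg x := rfl
@[simp] theorem eval_get (a : A) (i j : Expr R A) :
    (Expr.get a i j).eval s = s.mem a (i.eval s) (j.eval s) := rfl
@[simp] theorem eval_add (e f : Expr R A) : (e + f).eval s = e.eval s + f.eval s := rfl
@[simp] theorem eval_add' (e f : Expr R A) : (e.add f).eval s = e.eval s + f.eval s := rfl
@[simp] theorem eval_zero : (0 : Expr R A).eval s = 0 := rfl
@[simp] theorem eval_one : (1 : Expr R A).eval s = 1 := rfl
@[simp] theorem eval_two : (2 : Expr R A).eval s = 2 := rfl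
@[simp] theorem eval_three : (3 : Expr R A).eval s = 3 := rfl
@[simp] theorem eval_lt (e f : Expr R A) :
    ((Test.lt e f).eval s = true) = (e.eval s < f.eval s) := by simp [Test.eval]
@[simp] theorem eval_eq (e f : Expr R A) :
    ((Test.eq e f).eval s = true) = (e.eval s = f.eval s) := by simp [Test.eval]
@[simp] theorem eval_and (b c : Test R A) :
    ((Test.and b c).eval s = true) = (b.eval s = true ∧ c.eval s = true) := by simp [Test.eval]

theorem eval_withTime (t : ℕ) (e : Expr R A) : e.eval (s.withTime t) = e.eval s := by
  induction e with
  | num => rfl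
  | var => rfl
  | get a i j hi hj => simp only [eval_get, hi, hj]; rfl
  | add e f he hf => simp only [Expr.eval, he, hf]
  | sub e f he hf => simp only [Expr.eval, he, hf]

theorem test_withTime (t : ℕ) (b : Test R A) : b.eval (s.withTime t) = b.eval s := by
  induction b with
  | lt => simp only [Test.eval, eval_withTime]
  | eq => simp only [Test.eval, eval_withTime]
  | and b c hb hc => simp only [Test.eval, hb, hc]

end eval

variable [DecidableEq R] [DecidableEq A]

section fields

variable (s : State R A) (x : R) (c : ℕ) (a : A) (i j : ℕ)

@[simp] theorem setReg_reg (y : R) :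
    (s.setReg x c).reg y = if y = x then c else s.reg y := by
  simp [State.setReg, Function.update_apply]
@[simp] theorem setReg_mem : (s.setReg x c).mem = s.mem := rfl
@[simp] theorem setReg_used : (s.setReg x c).used = s.used := rfl
@[simp] theorem setReg_output : (s.setReg x c).output = s.output := rfl
@[simp] theorem setReg_depth : (s.setReg x c).depth = s.depth := rfl
@[simp] theorem setReg_maxDepth : (s.setReg x c).maxDepth = s.maxDepth := rfl

@[simp] theorem setMem_reg : (s.setMem a i j c).reg = s.reg := rfl
theorem setMem_mem (a' : A) (i' j' : ℕ) : (s.setMem a i j c).mem a' i' j' =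
    if a' = a ∧ i' = i ∧ j' = j then c else s.mem a' i' j' := by
  simp only [State.setMem, Function.update_apply]
  by_cases h : a' = a <;> by_cases h' : i' = i <;> by_cases h'' : j' = j <;>
    simp [h, h', h'']
@[simp] theorem setMem_mem_self (i' j' : ℕ) : (s.setMem a i j c).mem a i' j' =
    if i' = i ∧ j' = j then c else s.mem a i' j' := by
  simp [setMem_mem]
@[simp] theorem setMem_mem_ne {a' : A} (h : a' ≠ a) : (s.setMem a i j c).mem a' = s.mem a' := by
  funext i' j'; simp [setMem_mem, h]
@[simp] theorem setMem_used : (s.setMem a i j c).used = insert (a, i, j) s.used := rfl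
@[simp] theorem setMem_output : (s.setMem a i j c).output = s.output := rfl
@[simp] theorem setMem_depth : (s.setMem a i j c).depth = s.depth := rfl
@[simp] theorem setMem_maxDepth : (s.setMem a i j c).maxDepth = s.maxDepth := rfl

@[simp] theorem print_reg : (s.print c).reg = s.reg := rfl
@[simp] theorem print_mem : (s.print c).mem = s.mem := rfl
@[simp] theorem print_used : (s.print c).used = s.used := rfl
@[simp] theorem print_output : (s.print c).output = s.output ++ [c] := rfl
@[simp] theorem print_depth : (s.print c).depth = s.depth := rfl
@[simp] theorem print_maxDepth : (s.print c).maxDepth = s.maxDepth := rfl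

end fields

/-- Started in `s`, the command `c` halts within `t` steps in a state that satisfies `Φ`. The
clocks of `s` and of the states in `Φ` play no role. -/
def Runs (P c : Cmd R A) (s : State R A) (t : ℕ) (Φ : State R A → Prop) : Prop :=
  ∀ t₀, ∃ s' t₁, Exec P c (s.withTime t₀) (s'.withTime t₁) ∧ t₁ ≤ t₀ + t ∧ Φ s'

/-- The effect of a command without loops and calls. -/
def Cmd.step : Cmd R A → State R A → State R A
  | .set x e, s => s.setReg x (e.eval s)
  | .store a i j e, s => s.setMem a (i.eval s) (j.eval s) (e.eval s)
  | .out e, s => s.print (e.eval s)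
  | .seq c d, s => d.step (c.step s)
  | .ite b c d, s => if b.eval s = true then c.step s else d.step s
  | _, s => s

/-- Absence of loops and calls. -/
def Cmd.straight : Cmd R A → Bool
  | .while _ _ => false
  | .call _ => false
  | .seq c d => c.straight && d.straight
  | .ite _ c d => c.straight && d.straight
  | _ => true

/-- A bound on the time that a command without loops and calls takes. -/
def Cmd.bound : Cmd R A → ℕ
  | .set _ e => e.cost + 1
  | .store _ i j e => i.cost + j.cost + e.cost + 1
  | .out e => e.cost + 1
  | .seq c d => c.bound + d.bound
  | .ite b c d => b.cost + 1 + max c.bound d.bound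
  | _ => 1

/-! ### Total-correctness rules with time bounds -/

section rules

variable {P c d : Cmd R A} {s : State R A} {t t' : ℕ} {Φ Ψ : State R A → Prop}

theorem Runs.mono (h : Runs P c s t Φ) (ht : t ≤ t') (hΦ : ∀ s', Φ s' → Ψ s') :
    Runs P c s t' Ψ := fun t₀ => by
  obtain ⟨s', t₁, h₁, h₂, h₃⟩ := h t₀
  exact ⟨s', t₁, h₁, by omega, hΦ _ h₃⟩

theorem Runs.seq {t₁ t₂ : ℕ} (h : Runs P c s t₁ fun s' => Runs P d s' t₂ Φ)
    (ht : t₁ + t₂ ≤ t) : Runs P (.seq c d) s t Φ := fun t₀ => by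
  obtain ⟨s', t', h₁, h₂, h₃⟩ := h t₀
  obtain ⟨s'', t'', h₁', h₂', h₃'⟩ := h₃ t'
  exact ⟨s'', t'', .seq h₁ h₁', by omega, h₃'⟩

theorem Runs.skip (h : Φ s) (ht : 1 ≤ t) : Runs P .skip s t Φ := fun t₀ =>
  ⟨s, t₀ + 1, .skip _, by omega, h⟩

theorem Runs.ite {b : Test R A} {t₁ : ℕ} (h₁ : b.eval s = true → Runs P c s t₁ Φ)
    (h₂ : ¬ b.eval s = true → Runs P d s t₁ Φ) (ht : b.cost + 1 + t₁ ≤ t) :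
    Runs P (.ite b c d) s t Φ := fun t₀ => by
  by_cases hb : b.eval s = true
  · obtain ⟨s', t', h₁, h₂, h₃⟩ := h₁ hb (t₀ + (b.cost + 1))
    exact ⟨s', t', .ite_true ((test_withTime ..).trans hb) h₁, by omega, h₃⟩
  · obtain ⟨s', t', h₁, h₂, h₃⟩ := h₂ hb (t₀ + (b.cost + 1))
    exact ⟨s', t', .ite_false ((test_withTime ..).trans (by simpa using hb)) h₁, by omega, h₃⟩

/-- Without loops and calls the final state is a function of the initial one, and charging the
dearer branch of each conditional bounds the time independently of the state. Time and effect can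
then be checked separately. -/
theorem Runs.of_straight (hc : c.straight = true) (ht : c.bound ≤ t) (h : Φ (c.step s)) :
    Runs P c s t Φ := by
  induction c generalizing s t Φ with
  | skip => exact .skip h ht
  | set x e =>
    intro t₀
    refine ⟨s.setReg x (e.eval s), t₀ + (e.cost + 1), ?_, by simpa [Cmd.bound] using ht, h⟩
    have := Exec.set (P := P) x e (s.withTime t₀)
    rw [eval_withTime] at this
    exact this
  | store a i j e =>
    intro t₀
    refine ⟨_, t₀ + (i.cost + j.cost + e.cost + 1), ?_, by simpa [Cmd.bound] using ht, h⟩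
    have := Exec.store (P := P) a i j e (s.withTime t₀)
    simp only [eval_withTime] at this
    exact this
  | out e =>
    intro t₀
    refine ⟨_, t₀ + (e.cost + 1), ?_, by simpa [Cmd.bound] using ht, h⟩
    have := Exec.out (P := P) e (s.withTime t₀)
    rw [eval_withTime] at this
    exact this
  | seq c d hc' hd' =>
    simp only [Cmd.straight, Bool.and_eq_true] at hc
    exact .seq (hc' hc.1 le_rfl (hd' hc.2 le_rfl h)) ht
  | ite b c d hc' hd' =>
    simp only [Cmd.straight, Bool.and_eq_true] at hc
    simp only [Cmd.step] at h
    refine .ite (fun hb => hc' hc.1 (le_max_left _ d.bound) ?_)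
      (fun hb => hd' hc.2 (le_max_right _ _) ?_) ht
    · rwa [if_pos hb] at h
    · rwa [if_neg hb] at h
  | _ => simp [Cmd.straight] at hc

/-- `Φ` holds after the loop-free command `c`. -/
def Eff (c : Cmd R A) (s : State R A) (Φ : State R A → Prop) : Prop := Φ (c.step s)

theorem Eff.nil (h : Φ s) : Eff (block []) s Φ := h

/-- The stored value `v` is supplied explicitly, so that the next state mentions a mathematical
quantity and not an expression evaluated in a nest of earlier states. -/
theorem Eff.set {x : R} {e : Expr R A} {l : List (Cmd R A)} (v : ℕ) (he : e.eval s = v)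
    (h : Eff (block l) (s.setReg x v) Φ) : Eff (block (.set x e :: l)) s Φ := by
  subst he; exact h

theorem Eff.store {a : A} {i j e : Expr R A} {l : List (Cmd R A)} (iv jv v : ℕ)
    (hi : i.eval s = iv) (hj : j.eval s = jv) (he : e.eval s = v)
    (h : Eff (block l) (s.setMem a iv jv v) Φ) : Eff (block (.store a i j e :: l)) s Φ := by
  subst hi hj he; exact h

theorem Eff.cons {l : List (Cmd R A)} (h : Eff c s fun s' => Eff (block l) s' Φ) :
    Eff (block (c :: l)) s Φ := h

theorem Eff.ite {b : Test R A} (h₁ : b.eval s = true → Eff c s Φ)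
    (h₂ : ¬ b.eval s = true → Eff d s Φ) : Eff (.ite b c d) s Φ := by
  simp only [Eff, Cmd.step]
  split_ifs with h
  · exact h₁ h
  · exact h₂ h

theorem Eff.when {b : Test R A} {l' l : List (Cmd R A)}
    (h₁ : b.eval s = true → Eff (block l') s fun s' => Eff (block l) s' Φ)
    (h₂ : ¬ b.eval s = true → Eff (block l) s Φ) : Eff (block (when b l' :: l)) s Φ :=
  .cons (.ite h₁ h₂)

theorem Runs.straight (hc : c.straight = true) (ht : c.bound ≤ t) (h : Eff c s Φ) :
    Runs P c s t Φ := .of_straight hc ht h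

theorem Runs.cons {t₁ t₂ : ℕ} {l : List (Cmd R A)}
    (h : Runs P c s t₁ fun s' => Runs P (block l) s' t₂ Φ)
    (ht : t₁ + t₂ ≤ t) : Runs P (block (c :: l)) s t Φ := .seq h ht

theorem Runs.then {t₁ t₂ : ℕ} {l : List (Cmd R A)} (h : Runs P c s t₁ Ψ)
    (h' : ∀ s', Ψ s' → Runs P (block l) s' t₂ Φ) (ht : t₁ + t₂ ≤ t) :
    Runs P (block (c :: l)) s t Φ := .cons (h.mono le_rfl h') ht

theorem Runs.nil (h : Φ s) (ht : 1 ≤ t) : Runs P (block []) s t Φ := .skip h ht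

/-- Execute the first `n` commands of a block, which have to be loop-free. -/
theorem Runs.take (n : ℕ) {l : List (Cmd R A)} {t₁ : ℕ}
    (h : Eff (block (l.take n)) s fun s' => Runs P (block (l.drop n)) s' t₁ Φ)
    (hc : (block (l.take n)).straight = true) (ht : (block (l.take n)).bound + t₁ ≤ t) :
    Runs P (block l) s t Φ := by
  induction n generalizing l s t with
  | zero => exact Runs.mono h (by omega) fun _ h => h
  | succ n ih =>
    cases l with
    | nil => exact Runs.mono h (by omega) fun _ h => h
    | cons c l =>
      simp only [List.take_succ_cons, block, Cmd.straight, Cmd.bound, Bool.and_eq_true] at hc ht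
      exact .cons (.straight hc.1 le_rfl (ih h hc.2 le_rfl)) (by omega)

theorem frame_withTime (s : State R A) (t : ℕ) (args : List (R × Expr R A)) :
    frame (s.withTime t) args = frame s args := by
  induction args with
  | nil => rfl
  | cons p l ih => simp only [frame, eval_withTime, ih]

/-- The behaviour of the procedure body is a hypothesis here. Recursion is resolved outside, by
induction on the clique size still wanted. -/
theorem Runs.call {args : List (R × Expr R A)} {t₁ : ℕ}
    (h : Runs P P (s.enter args) t₁ fun s' => Φ (s'.leave s)) (ht : argsCost args + 1 + t₁ ≤ t) :
    Runs P (.call args) s t Φ := fun t₀ => by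
  obtain ⟨s', t', h₁, h₂, h₃⟩ := h (t₀ + (argsCost args + 1))
  refine ⟨s'.leave s, t', .call (s' := s'.withTime t') ?_, by omega, h₃⟩
  have : ((s.withTime t₀).enter args).tick (argsCost args + 1) =
      (s.enter args).withTime (t₀ + (argsCost args + 1)) := by
    simp only [State.enter, frame_withTime]; rfl
  rwa [this]

/-- The rule for counting loops. The second argument of the invariant bounds the elapsed time. -/
theorem Runs.loop_elapsed {x : R} {lo hi : Expr R A} {l : List (Cmd R A)} {lov hiv T : ℕ}
    (Inv : ℕ → ℕ → State R A → Prop) (hlo : lo.eval s = lov) (hle : lov ≤ hiv)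
    (h0 : Inv lov (lo.cost + 1) (s.setReg x lov))
    (hreg : ∀ i g s, Inv i g s → s.reg x = i ∧ hi.eval s = hiv)
    (hstep : ∀ i g s, lov ≤ i → i < hiv → Inv i g s → ∃ t, Runs P (block l) s t fun s' =>
      s'.reg x = i ∧ Inv (i + 1) (g + t + hi.cost + 7) (s'.setReg x (i + 1)))
    (hend : ∀ g s, Inv hiv g s → g + hi.cost + 3 ≤ T ∧ Φ s) :
    Runs P (loop x lo hi l) s T Φ := by
  -- Induction on the number `n` of rounds left; the time `g` already spent counts against the
  -- budget `T`. A test costs `hi.cost + 3` and the increment of the counter `4`, which together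
  -- give the `hi.cost + 7` of a round.
  have key : ∀ n i g s, lov ≤ i → i + n = hiv → Inv i g s → ∀ t₀, ∃ s' t₁,
      Exec P (.while (.lt (.var x) hi) (.seq (block l) (.set x (.add (.var x) 1))))
        (s.withTime t₀) (s'.withTime t₁) ∧ t₁ + g ≤ t₀ + T ∧ Φ s' := by
    intro n
    induction n with
    | zero =>
      intro i g s hi₁ hi₂ hInv t₀
      obtain rfl : i = hiv := by omega
      obtain ⟨h₁, h₂⟩ := hreg _ _ _ hInv
      obtain ⟨h₃, h₄⟩ := hend _ _ hInv
      refine ⟨s, t₀ + (hi.cost + 3), ?_, by omega, h₄⟩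
      have := Exec.while_false (P := P) (b := .lt (.var x) hi)
        (c := .seq (block l) (.set x (.add (.var x) 1))) (s := s.withTime t₀)
        (by rw [test_withTime]; simp [Test.eval, h₁, h₂])
      convert this using 1
      simp only [State.withTime, State.tick, Test.cost, Expr.cost]
      congr 1; omega
    | succ n ih =>
      intro i g s hi₁ hi₂ hInv t₀
      obtain ⟨h₁, h₂⟩ := hreg _ _ _ hInv
      obtain ⟨t, ht⟩ := hstep i g s hi₁ (by omega) hInv
      obtain ⟨s', t', h₃, h₄, h₅, h₆⟩ := ht (t₀ + (hi.cost + 3))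
      obtain ⟨s'', t'', h₇, h₈, h₉⟩ := ih _ _ _ (by omega) (by omega) h₆ (t' + 4)
      refine ⟨s'', t'', .while_true ?_ ?_ h₇, by omega, h₉⟩
      · rw [test_withTime]
        simp only [Test.eval, eval_var, h₁, h₂, decide_eq_true_eq]
        omega
      · have e₁ : (s.withTime t₀).tick ((Test.lt (.var x) hi).cost + 1) =
            s.withTime (t₀ + (hi.cost + 3)) := by
          simp only [State.withTime, State.tick, Test.cost, Expr.cost]
          congr 1; omega
        rw [e₁]
        refine .seq h₃ ?_
        have := Exec.set (P := P) x (.add (.var x) 1) (s'.withTime t')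
        rw [eval_withTime] at this
        rwa [show (Expr.add (.var x) 1).eval s' = i + 1 by rw [← h₅]; rfl] at this
  intro t₀
  obtain ⟨s', t', h₁, h₂, h₃⟩ := key (hiv - lov) lov _ _ le_rfl (by omega) h0 (t₀ + (lo.cost + 1))
  refine ⟨s', t', .seq ?_ h₁, by omega, h₃⟩
  have := Exec.set (P := P) x lo (s.withTime t₀)
  rw [eval_withTime, hlo] at this
  exact this

/-- The rule for counting loops in which the `i`-th round takes at most `f i` steps. -/
theorem Runs.loop {x : R} {lo hi : Expr R A} {l : List (Cmd R A)} {lov hiv T : ℕ}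
    (Inv : ℕ → State R A → Prop) (f : ℕ → ℕ) (hlo : lo.eval s = lov) (hle : lov ≤ hiv)
    (hc : lo.cost ≤ 3 ∧ hi.cost ≤ 3)
    (h0 : Inv lov (s.setReg x lov))
    (hreg : ∀ i s, Inv i s → s.reg x = i ∧ hi.eval s = hiv)
    (hstep : ∀ i s, lov ≤ i → i < hiv → Inv i s → Runs P (block l) s (f i) fun s' =>
      s'.reg x = i ∧ Inv (i + 1) (s'.setReg x (i + 1)))
    (hT : 10 + ∑ i ∈ Finset.Ico lov hiv, (f i + 10) ≤ T)
    (hend : ∀ s, Inv hiv s → Φ s) :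
    Runs P (loop x lo hi l) s T Φ := by
  -- Since both bounds cost at most `3`, the first assignment takes at most `4` steps, and test and
  -- increment at most `10` per round.
  refine .loop_elapsed
    (fun i g s => g ≤ 4 + ∑ j ∈ Finset.Ico lov i, (f j + 10) ∧ Inv i s)
    hlo hle ⟨by simp; omega, h0⟩ (fun i g s h => hreg i s h.2) ?_ ?_
  · intro i g s h₁ h₂ h
    refine ⟨f i, (hstep i s h₁ h₂ h.2).mono le_rfl fun s' h' => ⟨h'.1, ?_, h'.2⟩⟩
    rw [Finset.sum_Ico_succ_top h₁]
    omega
  · exact fun g s h => ⟨by omega, hend s h.2⟩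

/-- The rule for counting loops in which every round takes at most `f` steps. -/
theorem Runs.loop_const {x : R} {lo hi : Expr R A} {l : List (Cmd R A)} {lov hiv T : ℕ}
    (Inv : ℕ → State R A → Prop) (f : ℕ) (hlo : lo.eval s = lov) (hle : lov ≤ hiv)
    (hc : lo.cost ≤ 3 ∧ hi.cost ≤ 3)
    (h0 : Inv lov (s.setReg x lov))
    (hreg : ∀ i s, Inv i s → s.reg x = i ∧ hi.eval s = hiv)
    (hstep : ∀ i s, lov ≤ i → i < hiv → Inv i s → Runs P (block l) s f fun s' =>
      s'.reg x = i ∧ Inv (i + 1) (s'.setReg x (i + 1)))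
    (hT : 10 + (hiv - lov) * (f + 10) ≤ T)
    (hend : ∀ s, Inv hiv s → Φ s) :
    Runs P (RAM.loop x lo hi l) s T Φ :=
  .loop Inv (fun _ => f) hlo hle hc h0 hreg hstep (by simpa using hT) hend

end rules

end RAM

/-! ### Graphs with numbered edges -/

namespace EBBkCT

/-- A graph with the vertices `0, …, n - 1` and the edges `1, …, m`. The ends of the edge `e` are
`a e` and `b e`, and `E u v` is the number of the edge between `u` and `v`, `0` if there is none. -/
structure NumGraph where
  n : ℕ
  m : ℕ
  a : ℕ → ℕ
  b : ℕ → ℕ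
  E : ℕ → ℕ → ℕ
  a_lt : ∀ e, 1 ≤ e → e ≤ m → a e < n
  b_lt : ∀ e, 1 ≤ e → e ≤ m → b e < n
  a_ne_b : ∀ e, 1 ≤ e → e ≤ m → a e ≠ b e
  E_eq_iff : ∀ u v e, e ≠ 0 → (E u v = e ↔ e ≤ m ∧ (a e = u ∧ b e = v ∨ a e = v ∧ b e = u))

namespace NumGraph

variable (Γ : NumGraph) {u v w e f : ℕ}

theorem E_ab (h₁ : 1 ≤ e) (h₂ : e ≤ Γ.m) : Γ.E (Γ.a e) (Γ.b e) = e := by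
  rw [Γ.E_eq_iff _ _ _ (by omega)]; simp [h₂]

theorem E_comm (u v : ℕ) : Γ.E u v = Γ.E v u := by
  by_cases h : Γ.E v u = 0
  · by_contra h'
    have h₁ := (Γ.E_eq_iff u v _ (fun h'' => h' (h''.trans h.symm))).1 rfl
    rw [or_comm, ← Γ.E_eq_iff _ _ _ (fun h'' => h' (h''.trans h.symm))] at h₁
    exact h' h₁.symm
  · have h₁ := (Γ.E_eq_iff v u _ h).1 rfl
    rw [or_comm, ← Γ.E_eq_iff _ _ _ h] at h₁
    exact h₁

theorem E_le (u v : ℕ) : Γ.E u v ≤ Γ.m := by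
  by_cases h : Γ.E u v = 0
  · omega
  · exact ((Γ.E_eq_iff u v _ h).1 rfl).1

theorem ends_of_E_ne_zero (h : Γ.E u v ≠ 0) :
    Γ.a (Γ.E u v) = u ∧ Γ.b (Γ.E u v) = v ∨ Γ.a (Γ.E u v) = v ∧ Γ.b (Γ.E u v) = u :=
  ((Γ.E_eq_iff u v _ h).1 rfl).2

theorem lt_of_E_ne_zero (h : Γ.E u v ≠ 0) : u < Γ.n ∧ v < Γ.n := by
  have h₁ := Γ.a_lt _ (by omega) (Γ.E_le u v)
  have h₂ := Γ.b_lt _ (by omega) (Γ.E_le u v)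
  rcases Γ.ends_of_E_ne_zero h with ⟨h₃, h₄⟩ | ⟨h₃, h₄⟩ <;> rw [h₃] at h₁ <;> rw [h₄] at h₂ <;>
    exact ⟨by assumption, by assumption⟩

theorem ne_of_E_ne_zero (h : Γ.E u v ≠ 0) : u ≠ v := by
  have := Γ.a_ne_b _ (by omega) (Γ.E_le u v)
  rcases Γ.ends_of_E_ne_zero h with ⟨h₃, h₄⟩ | ⟨h₃, h₄⟩ <;> rw [h₃, h₄] at this
  · exact this
  · exact this.symm

theorem E_self (u : ℕ) : Γ.E u u = 0 := by
  by_contra h; exact Γ.ne_of_E_ne_zero h rfl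

theorem E_inj (h : Γ.E u v ≠ 0) (h' : Γ.E u v = Γ.E u w) : v = w := by
  have h₀ := Γ.ne_of_E_ne_zero h
  have h₁ := Γ.ends_of_E_ne_zero h
  have h₂ := Γ.ends_of_E_ne_zero (h' ▸ h)
  rw [← h'] at h₂
  omega

/-- The neighbours of `u` along the edges `1, …, e`. -/
def adjList (u : ℕ) : ℕ → List ℕ
  | 0 => []
  | e + 1 => adjList u e ++
      if Γ.a (e + 1) = u then [Γ.b (e + 1)] else if Γ.b (e + 1) = u then [Γ.a (e + 1)] else []

/-- The adjacency list of `u`. -/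
def nbrs (u : ℕ) : List ℕ := Γ.adjList u Γ.m

def deg (u : ℕ) : ℕ := (Γ.nbrs u).length

theorem mem_adjList (he : e ≤ Γ.m) : w ∈ Γ.adjList u e ↔ Γ.E u w ≠ 0 ∧ Γ.E u w ≤ e := by
  induction e with
  | zero => simp only [adjList, List.not_mem_nil, false_iff]; omega
  | succ e ih =>
    have h₁ : w ∈ (if Γ.a (e + 1) = u then [Γ.b (e + 1)] else
        if Γ.b (e + 1) = u then [Γ.a (e + 1)] else []) ↔ Γ.E u w = e + 1 := by
      rw [Γ.E_eq_iff _ _ _ (by omega)]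
      have := Γ.a_ne_b (e + 1) (by omega) he
      split_ifs <;> simp <;> omega
    rw [adjList, List.mem_append, h₁, ih (by omega)]
    omega

theorem mem_nbrs : w ∈ Γ.nbrs u ↔ Γ.E u w ≠ 0 := by
  simp [nbrs, Γ.mem_adjList le_rfl, Γ.E_le]

theorem nodup_adjList (he : e ≤ Γ.m) : (Γ.adjList u e).Nodup := by
  induction e with
  | zero => simp [adjList]
  | succ e ih =>
    rw [adjList, List.nodup_append]
    refine ⟨ih (by omega), by split_ifs <;> simp, ?_⟩
    intro w hw w' hw' h
    subst h
    have h₁ := (Γ.mem_adjList (by omega)).1 hw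
    have h₂ : Γ.E u w = e + 1 := by
      rw [Γ.E_eq_iff _ _ _ (by omega)]
      split_ifs at hw' <;> simp at hw' <;> omega
    omega

theorem nodup_nbrs : (Γ.nbrs u).Nodup := Γ.nodup_adjList le_rfl

theorem length_adjList_le (he : e ≤ Γ.m) : (Γ.adjList u e).length ≤ Γ.deg u := by
  have : ∀ d, (Γ.adjList u e).length ≤ (Γ.adjList u (e + d)).length := by
    intro d
    induction d with
    | zero => rfl
    | succ d ih => rw [← add_assoc, adjList, List.length_append]; omega
  simpa [deg, nbrs, Nat.add_sub_cancel' he] using this (Γ.m - e)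

theorem card_filter_nbrs (p : ℕ → Prop) [DecidablePred p] :
    ((Γ.nbrs u).filter (fun w => decide (p w))).length =
      ((Finset.range Γ.n).filter fun w => Γ.E u w ≠ 0 ∧ p w).card := by
  rw [← List.toFinset_card_of_nodup (Γ.nodup_nbrs.filter _)]
  congr 1
  ext w
  simp only [List.mem_toFinset, List.mem_filter, Γ.mem_nbrs, Finset.mem_filter, Finset.mem_range,
    decide_eq_true_eq]
  exact ⟨fun h => ⟨(Γ.lt_of_E_ne_zero h.1).2, h⟩, fun h => h.2⟩

theorem sum_deg : ∑ u ∈ Finset.range Γ.n, Γ.deg u = 2 * Γ.m := by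
  have key : ∀ e ≤ Γ.m, ∑ u ∈ Finset.range Γ.n, (Γ.adjList u e).length = 2 * e := by
    intro e he
    induction e with
    | zero => simp [adjList]
    | succ e ih =>
      have h₁ : ∀ u, (if Γ.a (e + 1) = u then [Γ.b (e + 1)] else
          if Γ.b (e + 1) = u then [Γ.a (e + 1)] else []).length =
          (if Γ.a (e + 1) = u then 1 else 0) + (if Γ.b (e + 1) = u then 1 else 0) := by
        intro u
        have := Γ.a_ne_b (e + 1) (by omega) he
        split_ifs <;> simp; omega
      simp only [adjList, List.length_append, h₁, Finset.sum_add_distrib, ih (by omega)]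
      have h₂ := Γ.a_lt (e + 1) (by omega) he
      have h₃ := Γ.b_lt (e + 1) (by omega) he
      simp only [Finset.sum_ite_eq, Finset.mem_range, h₂, h₃, if_true]
      omega
  exact key Γ.m le_rfl

/-- The smaller one of the degrees of the ends of `e`. -/
def minDeg (e : ℕ) : ℕ := min (Γ.deg (Γ.a e)) (Γ.deg (Γ.b e))

/-- If every non-empty set of vertices contains one with at most `δ` neighbours in this set, then
the smaller degrees of the ends of the edges sum up to at most `2δm`. -/
theorem sum_minDeg_le {δ : ℕ} (hδ : ∀ s ⊆ Finset.range Γ.n, s.Nonempty →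
    ∃ v ∈ s, (s.filter fun w => Γ.E v w ≠ 0).card ≤ δ) :
    ∑ e ∈ Finset.Icc 1 Γ.m, Γ.minDeg e ≤ 2 * δ * Γ.m := by
  -- Induction over vertex sets `s`, counting the edges inside `s` but charging degrees in the whole
  -- graph. Taking out `v` loses at most `δ` edges inside `s`, and `minDeg` of each is at most the
  -- full degree of `v`.
  have key : ∀ s ⊆ Finset.range Γ.n,
      ∑ e ∈ (Finset.Icc 1 Γ.m).filter (fun e => Γ.a e ∈ s ∧ Γ.b e ∈ s), Γ.minDeg e ≤
        δ * ∑ v ∈ s, Γ.deg v := by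
    intro s
    induction s using Finset.strongInduction with
    | H s ih =>
      intro hs
      rcases s.eq_empty_or_nonempty with rfl | hne
      · simp
      obtain ⟨v, hv, hvδ⟩ := hδ s hs hne
      have h₁ : (Finset.Icc 1 Γ.m).filter (fun e => Γ.a e ∈ s ∧ Γ.b e ∈ s) ⊆
          (Finset.Icc 1 Γ.m).filter (fun e => Γ.a e ∈ s.erase v ∧ Γ.b e ∈ s.erase v) ∪
          (s.filter fun w => Γ.E v w ≠ 0).image (fun w => Γ.E v w) := by
        intro e he
        simp only [Finset.mem_filter, Finset.mem_Icc, Finset.mem_union, Finset.mem_erase,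
          Finset.mem_image] at he ⊢
        obtain ⟨⟨he₁, he₂⟩, ha, hb⟩ := he
        have hE := Γ.E_ab he₁ he₂
        by_cases hav : Γ.a e = v
        · rw [hav] at hE
          exact .inr ⟨Γ.b e, ⟨hb, by omega⟩, hE⟩
        by_cases hbv : Γ.b e = v
        · rw [hbv, Γ.E_comm] at hE
          exact .inr ⟨Γ.a e, ⟨ha, by omega⟩, hE⟩
        exact .inl ⟨⟨he₁, he₂⟩, ⟨hav, ha⟩, hbv, hb⟩
      have h₂ := ih (s.erase v) (Finset.erase_ssubset hv) ((Finset.erase_subset _ _).trans hs)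
      have h₃ : ∑ e ∈ (s.filter fun w => Γ.E v w ≠ 0).image (fun w => Γ.E v w), Γ.minDeg e ≤
          δ * Γ.deg v := by
        refine (Finset.sum_le_card_nsmul _ _ (Γ.deg v) ?_).trans ?_
        · intro e he
          simp only [Finset.mem_image, Finset.mem_filter] at he
          obtain ⟨w, ⟨-, hw⟩, rfl⟩ := he
          rw [minDeg]
          rcases Γ.ends_of_E_ne_zero hw with ⟨h, h'⟩ | ⟨h, h'⟩ <;> rw [h, h']
          · exact min_le_left _ _
          · exact min_le_right _ _
        · rw [smul_eq_mul]
          exact Nat.mul_le_mul_right _ (Finset.card_image_le.trans hvδ)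
      rw [← Finset.add_sum_erase s _ hv, mul_add]
      calc _ ≤ _ := Finset.sum_le_sum_of_subset h₁
        _ ≤ _ := Nat.le.intro (Finset.sum_union_inter)
        _ ≤ _ := by omega
  have h := key _ subset_rfl
  rw [Γ.sum_deg, Finset.filter_true_of_mem] at h
  · linarith
  · intro e he
    simp only [Finset.mem_Icc] at he
    simp [Γ.a_lt e he.1 he.2, Γ.b_lt e he.1 he.2]

/-- The number of common neighbours of `u` and `v` in the graph formed by the edges of rank at
least `i`. -/
def common (ρ : ℕ → ℕ) (i u v : ℕ) : ℕ :=
  ((Finset.range Γ.n).filter fun w => i ≤ ρ (Γ.E u w) ∧ i ≤ ρ (Γ.E v w)).card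

theorem common_comm (ρ : ℕ → ℕ) (i u v : ℕ) : Γ.common ρ i u v = Γ.common ρ i v u := by
  simp only [common, and_comm]

/-- The number of common neighbours of the ends of `e` along edges of rank at least `i`. -/
def supp (ρ : ℕ → ℕ) (i e : ℕ) : ℕ := Γ.common ρ i (Γ.a e) (Γ.b e)

/-- All non-edges have the number `0`, so `ρ 0 < i` excludes non-neighbours. Scanning the adjacency
list of one end therefore finds every common neighbour. -/
theorem length_filter_nbrs {ρ : ℕ → ℕ} {i : ℕ} (h0 : ρ 0 < i) :
    ((Γ.nbrs u).filter fun w => decide (i ≤ ρ (Γ.E u w) ∧ i ≤ ρ (Γ.E v w))).length =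
      Γ.common ρ i u v := by
  rw [Γ.card_filter_nbrs (u := u) (fun w => i ≤ ρ (Γ.E u w) ∧ i ≤ ρ (Γ.E v w)), common]
  congr 1
  refine Finset.filter_congr fun w _ => ⟨fun h => h.2, fun h => ⟨fun h' => ?_, h⟩⟩
  rw [h'] at h; omega

theorem supp_eq_common (ρ : ℕ → ℕ) (i : ℕ) (he : e ≠ 0) (h : Γ.E u v = e) :
    Γ.supp ρ i e = Γ.common ρ i u v := by
  subst h
  rcases Γ.ends_of_E_ne_zero he with ⟨h₁, h₂⟩ | ⟨h₁, h₂⟩ <;> rw [supp, h₁, h₂]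
  exact common_comm ..

theorem deg_le : Γ.deg u ≤ Γ.m := by
  have : ((Γ.nbrs u).map (Γ.E u)).Nodup :=
    Γ.nodup_nbrs.map_on fun w hw w' _ h => Γ.E_inj (Γ.mem_nbrs.1 hw) h
  rw [deg, ← List.length_map (Γ.E u), ← List.toFinset_card_of_nodup this]
  refine (Finset.card_le_card (t := Finset.Icc 1 Γ.m) fun f hf => ?_).trans (by simp)
  simp only [List.mem_toFinset, List.mem_map, Γ.mem_nbrs, Finset.mem_Icc] at hf ⊢
  obtain ⟨w, hw, rfl⟩ := hf
  exact ⟨by omega, Γ.E_le _ _⟩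

/-- Only the set of remaining edges matters, not their order. Hence exchanges among the remaining
positions leave supports unchanged. -/
theorem common_congr {ρ ρ' : ℕ → ℕ} {i : ℕ} (h : ∀ f ≤ Γ.m, i ≤ ρ f ↔ i ≤ ρ' f) :
    Γ.common ρ i u v = Γ.common ρ' i u v := by
  rw [common, common]
  congr 1
  exact Finset.filter_congr fun w _ => by rw [h _ (Γ.E_le _ _), h _ (Γ.E_le _ _)]

theorem supp_congr {ρ ρ' : ℕ → ℕ} {i : ℕ} (h : ∀ f ≤ Γ.m, i ≤ ρ f ↔ i ≤ ρ' f) :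
    Γ.supp ρ i e = Γ.supp ρ' i e := Γ.common_congr h

/-- `o` enumerates the edges, and `ρ` is its inverse. -/
structure IsOrdering (o ρ : ℕ → ℕ) : Prop where
  rank_zero : ρ 0 = 0
  rank_edge : ∀ e, 1 ≤ e → e ≤ Γ.m → 1 ≤ ρ e ∧ ρ e ≤ Γ.m ∧ o (ρ e) = e
  edge_rank : ∀ p, 1 ≤ p → p ≤ Γ.m → 1 ≤ o p ∧ o p ≤ Γ.m ∧ ρ (o p) = p

/-- Every edge has the smallest support among itself and the edges behind it. -/
def Greedy (o ρ : ℕ → ℕ) (r : ℕ) : Prop :=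
  ∀ i, 1 ≤ i → i ≤ r → ∀ e, 1 ≤ e → e ≤ Γ.m → i ≤ ρ e → Γ.supp ρ i (o i) ≤ Γ.supp ρ i e

/-- The position of `e` in the stable sorting of the edges by the keys `S`. -/
def sortPos (S : ℕ → ℕ) (e : ℕ) : ℕ :=
  1 + ((Finset.Icc 1 Γ.m).filter fun f => S f < S e).card +
    ((Finset.Ico 1 e).filter fun f => S f = S e).card

/-! ### Positions in the counting sort -/

variable {S : ℕ → ℕ}

/-- In this form the position counts the predecessors of `e` in a strict linear order, so that
monotonicity and injectivity can be read off. -/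
theorem sortPos_eq (he : e ≤ Γ.m) : Γ.sortPos S e =
    1 + ((Finset.Icc 1 Γ.m).filter fun f => S f < S e ∨ S f = S e ∧ f < e).card := by
  rw [sortPos, add_assoc, ← Finset.card_union_of_disjoint]
  · congr 2
    ext f
    simp only [Finset.mem_union, Finset.mem_filter, Finset.mem_Icc, Finset.mem_Ico]
    omega
  · rw [Finset.disjoint_left]
    intro f
    simp only [Finset.mem_filter]
    omega

theorem sortPos_lt (he₁ : 1 ≤ e) (he : e ≤ Γ.m) (hf : f ≤ Γ.m)
    (h : S e < S f ∨ S e = S f ∧ e < f) : Γ.sortPos S e < Γ.sortPos S f := by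
  rw [Γ.sortPos_eq he, Γ.sortPos_eq hf]
  refine Nat.add_lt_add_left (Finset.card_lt_card ?_) 1
  rw [Finset.ssubset_iff_of_subset]
  · exact ⟨e, by simp [he₁, he]; omega, by simp⟩
  · intro x
    simp only [Finset.mem_filter, Finset.mem_Icc]
    omega

theorem sortPos_le (he₁ : 1 ≤ e) (he : e ≤ Γ.m) : Γ.sortPos S e ≤ Γ.m := by
  rw [Γ.sortPos_eq he, add_comm]
  refine (Finset.card_lt_card (t := Finset.Icc 1 Γ.m) ?_).trans_eq (by simp)
  rw [Finset.ssubset_iff_of_subset (Finset.filter_subset _ _)]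
  exact ⟨e, by simp [he₁, he], by simp⟩

/-- Positions lie between `1` and `m` and are distinct for distinct edges, so by the pigeonhole
principle every position is taken. -/
theorem isOrdering_sortPos {o ρ : ℕ → ℕ} (h0 : ρ 0 = 0)
    (hρ : ∀ e, 1 ≤ e → e ≤ Γ.m → ρ e = Γ.sortPos S e)
    (ho : ∀ e, 1 ≤ e → e ≤ Γ.m → o (Γ.sortPos S e) = e) : Γ.IsOrdering o ρ := by
  have hle : ∀ e, 1 ≤ e → e ≤ Γ.m → 1 ≤ Γ.sortPos S e ∧ Γ.sortPos S e ≤ Γ.m :=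
    fun e h₁ h₂ => ⟨by rw [sortPos]; omega, Γ.sortPos_le h₁ h₂⟩
  refine ⟨h0, fun e h₁ h₂ => ?_, fun p h₁ h₂ => ?_⟩
  · rw [hρ e h₁ h₂, ho e h₁ h₂]
    exact ⟨(hle e h₁ h₂).1, (hle e h₁ h₂).2, rfl⟩
  · obtain ⟨e, he, rfl⟩ := Finset.surjOn_of_injOn_of_card_le (s := Finset.Icc 1 Γ.m)
      (t := Finset.Icc 1 Γ.m) (Γ.sortPos S) (fun e he => by
        simp only [Finset.coe_Icc, Set.mem_Icc] at he ⊢; exact hle e he.1 he.2)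
      (fun e he f hf hef => by
        simp only [Finset.coe_Icc, Set.mem_Icc] at he hf
        by_contra hne
        have h₁ := Γ.sortPos_lt (S := S) (e := e) (f := f) he.1 he.2 hf.2
        have h₂ := Γ.sortPos_lt (S := S) (e := f) (f := e) hf.1 hf.2 he.2
        omega) le_rfl (by simpa using ⟨h₁, h₂⟩ : p ∈ (Finset.Icc 1 Γ.m : Set ℕ))
    simp only [Finset.coe_Icc, Set.mem_Icc] at he
    rw [ho e he.1 he.2, hρ e he.1 he.2]
    exact ⟨he.1, he.2, rfl⟩

/-- The left side is the bucket boundary that the prefix sums store in `start[c]`. The equivalence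
is the invariant kept by `Buckets`. -/
theorem le_sortPos_iff (he₁ : 1 ≤ e) (he : e ≤ Γ.m) (c : ℕ) :
    1 + ((Finset.Icc 1 Γ.m).filter fun f => S f < c).card ≤ Γ.sortPos S e ↔ c ≤ S e := by
  constructor
  · intro h
    by_contra hc
    rw [Γ.sortPos_eq he] at h
    refine (Nat.add_le_add_iff_left.1 h).not_gt (Finset.card_lt_card ?_)
    rw [Finset.ssubset_iff_of_subset]
    · exact ⟨e, by simp [he₁, he]; omega, by simp⟩
    · intro x
      simp only [Finset.mem_filter, Finset.mem_Icc]
      omega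
  · intro h
    rw [sortPos, add_assoc]
    refine Nat.add_le_add_left ((Finset.card_le_card ?_).trans (Nat.le_add_right _ _)) 1
    intro x
    simp only [Finset.mem_filter, Finset.mem_Icc]
    omega

/-! ### Edge orderings, and the effect of a removal on supports -/

variable {Γ} {o ρ : ℕ → ℕ} {p : ℕ}

theorem IsOrdering.rank_inj (h : Γ.IsOrdering o ρ) (he : 1 ≤ e ∧ e ≤ Γ.m) (hf : 1 ≤ f ∧ f ≤ Γ.m)
    (hρ : ρ e = ρ f) : e = f := by
  rw [← (h.rank_edge e he.1 he.2).2.2, hρ, (h.rank_edge f hf.1 hf.2).2.2]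

/-- Edges of the same rank are the same if this rank is positive. -/
theorem IsOrdering.E_ne_zero (h : Γ.IsOrdering o ρ) (hp : 0 < ρ (Γ.E u v)) : Γ.E u v ≠ 0 := by
  intro h'; rw [h', h.rank_zero] at hp; omega

theorem IsOrdering.sum_comp (h : Γ.IsOrdering o ρ) (g : ℕ → ℕ) :
    ∑ p ∈ Finset.Ico 1 (Γ.m + 1), g (o p) = ∑ e ∈ Finset.Icc 1 Γ.m, g e := by
  refine Finset.sum_nbij' o ρ ?_ ?_ ?_ ?_ ?_ <;> intro p hp <;>
    simp only [Finset.mem_Ico, Finset.mem_Icc] at hp ⊢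
  · have := h.edge_rank p (by omega) (by omega); omega
  · have := h.rank_edge p (by omega) (by omega); omega
  · exact (h.edge_rank p (by omega) (by omega)).2.2
  · exact (h.rank_edge p (by omega) (by omega)).2.2

/-- Removing the edge `e` takes away one common neighbour of the ends of `f` if `e` and `f` lie in
a common triangle, and none otherwise. -/
theorem IsOrdering.supp_succ (h : Γ.IsOrdering o ρ) {i : ℕ} (hi : 1 ≤ i) (hρ : ρ (Γ.E u v) = i)
    (hf : i < ρ f) (hf₁ : 1 ≤ f) (hf₂ : f ≤ Γ.m) :
    (∃ w, (f = Γ.E u w ∨ f = Γ.E v w) ∧ i < ρ (Γ.E u w) ∧ i < ρ (Γ.E v w)) ∧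
        Γ.supp ρ i f = Γ.supp ρ (i + 1) f + 1 ∨
      (¬ ∃ w, (f = Γ.E u w ∨ f = Γ.E v w) ∧ i < ρ (Γ.E u w) ∧ i < ρ (Γ.E v w)) ∧
        Γ.supp ρ i f = Γ.supp ρ (i + 1) f := by
  have huv := h.E_ne_zero (u := u) (v := v) (by omega)
  have hne := Γ.ne_of_E_ne_zero huv
  have hEf := Γ.E_ab hf₁ hf₂
  have hab := Γ.a_ne_b f hf₁ hf₂
  -- Ranks of edges are distinct, so the only edge that separates the thresholds `i` and `i + 1` is
  -- `uv`.
  have heq : ∀ x y, ρ (Γ.E x y) = i ↔ (x = u ∧ y = v ∨ x = v ∧ y = u) := by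
    intro x y
    constructor
    · intro hxy
      have hxy' := h.E_ne_zero (u := x) (v := y) (by omega)
      have := h.rank_inj ⟨by omega, Γ.E_le x y⟩ ⟨by omega, Γ.E_le u v⟩ (hxy.trans hρ.symm)
      rw [Γ.E_eq_iff _ _ _ huv] at this
      have := Γ.ends_of_E_ne_zero huv
      omega
    · rintro (⟨rfl, rfl⟩ | ⟨rfl, rfl⟩)
      · exact hρ
      · rw [Γ.E_comm]; exact hρ
  by_cases hw : ∃ w, (f = Γ.E u w ∨ f = Γ.E v w) ∧ i < ρ (Γ.E u w) ∧ i < ρ (Γ.E v w)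
  · refine .inl ⟨hw, ?_⟩
    -- The edge `yw` loses the common neighbour `z` because `yz` is removed, and it loses nothing
    -- else.
    have key : ∀ y z w, (∀ x x', ρ (Γ.E x x') = i ↔ (x = y ∧ x' = z ∨ x = z ∧ x' = y)) →
        y ≠ z → i < ρ (Γ.E y w) → i < ρ (Γ.E z w) →
        Γ.common ρ i y w = Γ.common ρ (i + 1) y w + 1 := by
      intro y z w heq hne h₁ h₂
      have hyz := (heq y z).2 (by simp)
      have hwy := Γ.ne_of_E_ne_zero (h.E_ne_zero (u := y) (v := w) (by omega))
      have hwz := Γ.ne_of_E_ne_zero (h.E_ne_zero (u := z) (v := w) (by omega))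
      have hz := (Γ.lt_of_E_ne_zero (h.E_ne_zero (u := z) (v := w) (by omega))).1
      rw [common, common, ← Finset.card_insert_of_notMem (a := z)]
      · congr 1
        ext x
        simp only [Finset.mem_filter, Finset.mem_range, Finset.mem_insert]
        have h₃ := heq y x
        have h₄ := heq w x
        by_cases hx : x = z
        · subst hx
          rw [hyz, Γ.E_comm w]
          simp [hz]; omega
        · simp only [hx, false_or]
          have : ¬ ρ (Γ.E y x) = i := by rw [h₃]; omega
          have : ¬ ρ (Γ.E w x) = i := by rw [h₄]; omega
          omega
      · simp only [Finset.mem_filter, hyz]; omega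
    have hsupp : ∀ x y, f = Γ.E x y → ∀ j, Γ.supp ρ j f = Γ.common ρ j x y :=
      fun x y h j => Γ.supp_eq_common ρ j (by omega) h.symm
    obtain ⟨w, hfw | hfw, h₁, h₂⟩ := hw
    · rw [hsupp _ _ hfw, hsupp _ _ hfw]
      exact key u v w heq hne h₁ h₂
    · rw [hsupp _ _ hfw, hsupp _ _ hfw]
      exact key v u w (fun x x' => by rw [heq]; omega) hne.symm h₂ h₁
  · refine .inr ⟨hw, ?_⟩
    -- Were a common neighbour of the ends of `f` lost, one of the two edges to it would be `uv`,
    -- and the other one would close a triangle with `f` and `uv`, against `hw`.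
    have key : ∀ y z x, f = Γ.E y z → y ≠ z → ρ (Γ.E y x) = i → ¬ i ≤ ρ (Γ.E z x) := by
      intro y z x hyz hyz' hx hx'
      have h₁ : ρ (Γ.E z x) ≠ i := by
        rw [heq] at hx; rw [Ne, heq]; omega
      rw [heq] at hx
      rcases hx with ⟨rfl, rfl⟩ | ⟨rfl, rfl⟩ <;> refine hw ⟨z, ?_⟩
      · rw [Γ.E_comm z] at hx' h₁; rw [← hyz]; exact ⟨.inl rfl, hf, by omega⟩
      · rw [Γ.E_comm z] at hx' h₁; rw [← hyz]; exact ⟨.inr rfl, by omega, hf⟩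
    rw [supp, supp, common, common]
    congr 1
    refine Finset.filter_congr fun x _ => ⟨fun hx => ?_, fun hx => by omega⟩
    by_contra hcon
    have : ρ (Γ.E (Γ.a f) x) = i ∨ ρ (Γ.E (Γ.b f) x) = i := by omega
    rcases this with h' | h'
    · exact key _ _ x hEf.symm hab h' hx.2
    · exact key _ _ x ((Γ.E_comm _ _).trans hEf).symm hab.symm h' hx.1

/-! ### Counting memory cells -/

variable (Γ)

/-- The memory cells in which the program stores something. -/
def cells : Finset (Tab × ℕ × ℕ) :=
  ({.src, .dst, .deg, .sup, .ord, .pos, .start, .fill, .rank, .vs, .vlev, .es, .elev,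
      .clique} : Finset Tab) ×ˢ
      (Finset.range (Γ.m + Γ.n + 2) ×ˢ {0}) ∪
    ((Finset.Icc 1 Γ.m).image (fun e => (Tab.edge, Γ.a e, Γ.b e)) ∪
      (Finset.Icc 1 Γ.m).image (fun e => (Tab.edge, Γ.b e, Γ.a e))) ∪
    (Finset.range Γ.n).biUnion fun u => (Finset.range (Γ.deg u)).image fun j => (Tab.adj, u, j)

/-- Fourteen plain arrays of `m + n + 2` cells each; `edge` and `adj` add at most `2m` cells each,
two per edge. -/
theorem card_cells_le : Γ.cells.card ≤ 18 * Γ.m + 14 * Γ.n + 28 := by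
  have h₁ : ((Finset.Icc 1 Γ.m).image (fun e => (Tab.edge, Γ.a e, Γ.b e))).card ≤ Γ.m :=
    Finset.card_image_le.trans (by simp)
  have h₂ : ((Finset.Icc 1 Γ.m).image (fun e => (Tab.edge, Γ.b e, Γ.a e))).card ≤ Γ.m :=
    Finset.card_image_le.trans (by simp)
  have h₃ : ((Finset.range Γ.n).biUnion fun u =>
      (Finset.range (Γ.deg u)).image fun j => (Tab.adj, u, j)).card ≤ 2 * Γ.m := by
    rw [← Γ.sum_deg]
    exact Finset.card_biUnion_le.trans
      (Finset.sum_le_sum fun u _ => Finset.card_image_le.trans (by simp))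
  refine (Finset.card_union_le _ _).trans ?_
  refine (Nat.add_le_add_right (Finset.card_union_le _ _) _).trans ?_
  refine (Nat.add_le_add_right (Nat.add_le_add_left (Finset.card_union_le _ _) _) _).trans ?_
  have h₄ : ∀ t : Finset Tab, t.card ≤ 14 →
      (t ×ˢ (Finset.range (Γ.m + Γ.n + 2) ×ˢ ({0} : Finset ℕ))).card ≤
        14 * (Γ.m + Γ.n + 2) := by
    intro t ht
    rw [Finset.card_product, Finset.card_product, Finset.card_range, Finset.card_singleton,
      mul_one]
    exact Nat.mul_le_mul_right _ ht
  have h₅ := h₄ {.src, .dst, .deg, .sup, .ord, .pos, .start, .fill, .rank, .vs, .vlev, .es, .elev,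
    .clique} (by decide)
  omega

theorem mem_cells {t : Tab} {i : ℕ} (ht : t ≠ .edge ∧ t ≠ .adj) (hi : i < Γ.m + Γ.n + 2) :
    (t, i, 0) ∈ Γ.cells := by
  simp only [cells, Finset.mem_union, Finset.mem_product, Finset.mem_range, hi]
  refine .inl (.inl ⟨?_, by simp⟩)
  cases t <;> simp at ht ⊢

theorem edge_mem_cells (h : Γ.E u v ≠ 0) : (Tab.edge, u, v) ∈ Γ.cells := by
  simp only [cells, Finset.mem_union, Finset.mem_image, Finset.mem_Icc]
  refine .inl (.inr ?_)
  rcases Γ.ends_of_E_ne_zero h with ⟨h₁, h₂⟩ | ⟨h₁, h₂⟩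
  · exact .inl ⟨Γ.E u v, ⟨by omega, Γ.E_le _ _⟩, by simp [h₁, h₂]⟩
  · exact .inr ⟨Γ.E u v, ⟨by omega, Γ.E_le _ _⟩, by simp [h₁, h₂]⟩

theorem adj_mem_cells {j : ℕ} (hu : u < Γ.n) (hj : j < Γ.deg u) : (Tab.adj, u, j) ∈ Γ.cells := by
  simp only [cells, Finset.mem_union, Finset.mem_biUnion, Finset.mem_image, Finset.mem_range]
  exact .inr ⟨u, hu, j, hj, rfl⟩

end NumGraph

end EBBkCT

/-! ### Building the graph -/

namespace EBBkCT

open RAM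

variable {Γ : NumGraph} {k : ℕ}

/-- The part of the state that does not change outside of procedure calls. -/
structure TopLevel (Γ : NumGraph) (k : ℕ) (out : List ℕ) (s : State Reg Tab) :
    Prop where
  n : s.reg .n = Γ.n
  m : s.reg .m = Γ.m
  k : s.reg .k = k
  used : s.used ⊆ Γ.cells
  output : s.output = out
  depth : s.depth = 1
  maxDepth : s.maxDepth ≤ Γ.n + 1

/-- The tables `src`, `dst`, `edge`, `deg` and `adj` represent the graph. -/
structure HasGraph (Γ : NumGraph) (M : Tab → ℕ → ℕ → ℕ) : Prop where
  src : ∀ e, 1 ≤ e → e ≤ Γ.m → M .src e 0 = Γ.a e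
  dst : ∀ e, 1 ≤ e → e ≤ Γ.m → M .dst e 0 = Γ.b e
  edge : ∀ u v, M .edge u v = Γ.E u v
  deg : ∀ u, M .deg u 0 = Γ.deg u
  adj : ∀ u j, M .adj u j = (Γ.nbrs u)[j]?.getD 0

/-- The part of the graph that consists of the first `e` edges. -/
structure HasGraphUpTo (Γ : NumGraph) (e : ℕ) (M : Tab → ℕ → ℕ → ℕ) : Prop where
  src : ∀ e, 1 ≤ e → e ≤ Γ.m → M .src e 0 = Γ.a e
  dst : ∀ e, 1 ≤ e → e ≤ Γ.m → M .dst e 0 = Γ.b e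
  edge : ∀ u v, M .edge u v = if Γ.E u v ≤ e then Γ.E u v else 0
  deg : ∀ u, M .deg u 0 = (Γ.adjList u e).length
  adj : ∀ u j, M .adj u j = (Γ.adjList u e)[j]?.getD 0

theorem TopLevel.congr {out out' : List ℕ} {s s' : State Reg Tab} (h : TopLevel Γ k out s)
    (hn : s'.reg .n = s.reg .n) (hm : s'.reg .m = s.reg .m) (hk : s'.reg .k = s.reg .k)
    (hu : s'.used ⊆ Γ.cells) (ho : s'.output = out') (hd : s'.depth = s.depth)
    (hd' : s'.maxDepth ≤ Γ.n + 1) : TopLevel Γ k out' s' :=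
  ⟨hn.trans h.n, hm.trans h.m, hk.trans h.k, hu, ho, hd.trans h.depth, hd'⟩

theorem getD_append_singleton {l : List ℕ} {w j : ℕ} :
    (l ++ [w])[j]?.getD 0 = if j = l.length then w else l[j]?.getD 0 := by
  rcases lt_trichotomy j l.length with h | h | h
  · rw [List.getElem?_append_left h, if_neg h.ne]
  · simp [h]
  · rw [List.getElem?_eq_none, List.getElem?_eq_none, if_neg h.ne']
    · omega
    · rw [List.length_append, List.length_singleton]; omega

theorem runs_buildGraph {out : List ℕ} {P : Cmd Reg Tab} {s : State Reg Tab}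
    (ht : TopLevel Γ k out s) (hg : HasGraphUpTo Γ 0 s.mem) :
    Runs P buildGraph s (10 + Γ.m * 70) fun s' => TopLevel Γ k out s' ∧
      HasGraph Γ s'.mem ∧ ∀ t, t ≠ .edge → t ≠ .adj → t ≠ .deg → s'.mem t = s.mem t := by
  refine .loop_const (lov := 1) (hiv := Γ.m + 1) (fun e s' => s'.reg .e = e ∧ TopLevel Γ k out s' ∧
      HasGraphUpTo Γ (e - 1) s'.mem ∧
      ∀ t, t ≠ .edge → t ≠ .adj → t ≠ .deg → s'.mem t = s.mem t) 60 rfl (by omega) (by decide) ?_ ?_ ?_ ?_ ?_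
  · refine ⟨rfl, ht.congr rfl rfl rfl ht.used ht.output rfl ht.maxDepth, hg, fun _ _ _ _ => rfl⟩
  · rintro i s ⟨h₁, h₂, -⟩
    exact ⟨h₁, by simp [h₂.m]⟩
  · rintro e s' he₁ he₂ ⟨h₁, h₂, h₃, h₆⟩
    refine .straight rfl (by decide) ?_
    have he₂' : e ≤ Γ.m := by omega
    have hlt₁ := Γ.a_lt e he₁ he₂'
    have hlt₂ := Γ.b_lt e he₁ he₂'
    have hne := Γ.a_ne_b e he₁ he₂'
    have hE := Γ.E_ab he₁ he₂'
    obtain ⟨e, rfl⟩ : ∃ e', e = e' + 1 := ⟨e - 1, by omega⟩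
    simp only [Nat.add_sub_cancel] at h₃ ⊢
    -- The next free place in the list of an end of the new edge lies below the final degree, so the
    -- cell written there is one of `cells`.
    have hdeg : ∀ u, (Γ.a (e + 1) = u ∨ Γ.b (e + 1) = u) →
        (Γ.adjList u e).length < Γ.deg u := by
      intro u hu
      refine lt_of_lt_of_le ?_ (Γ.length_adjList_le (u := u) he₂')
      rw [NumGraph.adjList]
      split_ifs <;> simp; omega
    refine .set (Γ.a (e + 1)) (by simp [rd, h₁, h₃.src, he₂']) ?_
    refine .set (Γ.b (e + 1)) (by simp [rd, h₁, h₃.dst, he₂']) ?_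
    refine .store (Γ.a (e + 1)) (Γ.b (e + 1)) (e + 1) (by simp) (by simp) (by simp [h₁]) ?_
    refine .store (Γ.b (e + 1)) (Γ.a (e + 1)) (e + 1) (by simp) (by simp) (by simp [h₁]) ?_
    refine .store (Γ.a (e + 1)) (Γ.adjList (Γ.a (e + 1)) e).length (Γ.b (e + 1)) (by simp)
      (by simp [rd, h₃.deg]) (by simp) ?_
    refine .store (Γ.a (e + 1)) 0 ((Γ.adjList (Γ.a (e + 1)) e).length + 1) (by simp)
      (by simp) (by simp [rd, h₃.deg]) ?_
    refine .store (Γ.b (e + 1)) (Γ.adjList (Γ.b (e + 1)) e).length (Γ.a (e + 1)) (by simp)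
      (by simp [rd, h₃.deg, hne.symm]) (by simp) ?_
    refine .store (Γ.b (e + 1)) 0 ((Γ.adjList (Γ.b (e + 1)) e).length + 1) (by simp)
      (by simp) (by simp [rd, h₃.deg, hne.symm]) (.nil ?_)
    refine ⟨by simpa using h₁, by simp, h₂.congr (by simp) (by simp) (by simp) ?_ h₂.output
      (by simp) h₂.maxDepth, ⟨?_, ?_, ?_, ?_, ?_⟩, ?_⟩
    · simp only [setMem_used, setReg_used, Finset.insert_subset_iff]
      refine ⟨Γ.mem_cells (by decide) (by omega), Γ.adj_mem_cells hlt₂ (hdeg _ (by simp)),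
        Γ.mem_cells (by decide) (by omega), Γ.adj_mem_cells hlt₁ (hdeg _ (by simp)),
        Γ.edge_mem_cells (by rw [Γ.E_comm]; omega), Γ.edge_mem_cells (by omega), h₂.used⟩
    · simpa using h₃.src
    · simpa using h₃.dst
    · intro u v
      simp [h₃.edge]
      have := Γ.E_eq_iff u v (e + 1) (by omega)
      split_ifs <;> omega
    · intro u
      simp only [NumGraph.adjList, List.length_append]
      simp [h₃.deg]
      by_cases hu : u = Γ.b (e + 1)
      · subst hu
        simp [hne]
      · by_cases hu' : u = Γ.a (e + 1)
        · subst hu'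
          simp [hne]
        · simp [hu, hu', Ne.symm hu, Ne.symm hu']
    · intro u j
      simp only [NumGraph.adjList]
      simp [h₃.adj]
      by_cases hu : u = Γ.b (e + 1)
      · subst hu
        simp [hne, hne.symm, getD_append_singleton]
      · by_cases hu' : u = Γ.a (e + 1)
        · subst hu'
          simp [hne, getD_append_singleton]
        · simp [hu, hu', Ne.symm hu, Ne.symm hu']
    · intro t h h' h''
      simp [h, h', h'', h₆]
  · omega
  · rintro s' ⟨h₁, h₂, h₃, h₄⟩
    refine ⟨h₂, ⟨h₃.src, h₃.dst, ?_, h₃.deg, h₃.adj⟩, h₄⟩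
    intro u v
    simp [h₃.edge, Γ.E_le u v]

end EBBkCT

/-! ### Sorting the edges by their supports -/

namespace EBBkCT

open RAM

variable {Γ : NumGraph} {k : ℕ} {out : List ℕ} {P : Cmd Reg Tab} {s : State Reg Tab} {t : ℕ}
  {Φ : State Reg Tab → Prop}

@[simp] theorem eval_rd (a : Tab) (i : Expr Reg Tab) :
    (rd a i).eval s = s.mem a (i.eval s) 0 := rfl

theorem setReg_comm {x y : Reg} (h : x ≠ y) (c d : ℕ) :
    (s.setReg x c).setReg y d = (s.setReg y d).setReg x c := by
  simp only [State.setReg, Function.update_comm h]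

theorem setReg_setReg (x : Reg) (c d : ℕ) : (s.setReg x c).setReg x d = s.setReg x d := by
  simp only [State.setReg, Function.update_idem]

theorem HasGraph.congr {M M' : Tab → ℕ → ℕ → ℕ} (h : HasGraph Γ M)
    (hM : ∀ t ∈ [Tab.src, .dst, .edge, .deg, .adj], M' t = M t) : HasGraph Γ M' := by
  simp only [List.mem_cons, List.not_mem_nil, or_false, forall_eq_or_imp, forall_eq] at hM
  obtain ⟨h₁, h₂, h₃, h₄, h₅⟩ := hM
  exact ⟨by rw [h₁]; exact h.src, by rw [h₂]; exact h.dst, by rw [h₃]; exact h.edge,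
    by rw [h₄]; exact h.deg, by rw [h₅]; exact h.adj⟩

/-- What follows may use only that `uv` is the edge `e` and that `u` has the smaller degree; the
order of the ends in the input is forgotten. -/
theorem eff_loadEnds (hg : HasGraph Γ s.mem) {e : ℕ} (he : s.reg .e = e) (he₁ : 1 ≤ e)
    (he₂ : e ≤ Γ.m) (h : ∀ u v, Γ.E u v = e → Γ.deg u = Γ.minDeg e →
      Φ ((s.setReg .u u).setReg .v v)) : Eff loadEnds s Φ := by
  refine .set (Γ.a e) (by simp [he, hg.src, he₁, he₂]) ?_
  refine .set (Γ.b e) (by simp [he, hg.dst, he₁, he₂]) (.when ?_ ?_)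
  · intro hlt
    simp [hg.deg] at hlt
    refine .set (Γ.b e) (by simp [he, hg.dst, he₁, he₂]) ?_
    refine .set (Γ.a e) (by simp [he, hg.src, he₁, he₂]) (.nil (.nil ?_))
    rw [setReg_comm (by decide : Reg.v ≠ .u), setReg_setReg, setReg_setReg]
    exact h _ _ ((Γ.E_comm _ _).trans (Γ.E_ab he₁ he₂)) (by simp [NumGraph.minDeg, hlt.le])
  · intro hlt
    simp [hg.deg] at hlt
    exact .nil (h _ _ (Γ.E_ab he₁ he₂) (by simp [NumGraph.minDeg, hlt]))

theorem length_filter_take_succ {l : List ℕ} {p : ℕ → Prop} [DecidablePred p] {j : ℕ}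
    (hj : j < l.length) : ((l.take (j + 1)).filter fun w => decide (p w)).length =
      ((l.take j).filter fun w => decide (p w)).length + if p (l[j]?.getD 0) then 1 else 0 := by
  rw [List.take_add_one, List.filter_append, List.length_append]
  simp only [List.getElem?_eq_getElem hj, Option.toList_some, Option.getD_some]
  split_ifs with h <;> simp [h]

/-- `s'` arises from `s` by changing registers. -/
structure SameMem (s s' : State Reg Tab) : Prop where
  mem : s'.mem = s.mem
  used : s'.used = s.used
  output : s'.output = s.output
  depth : s'.depth = s.depth
  maxDepth : s'.maxDepth = s.maxDepth

theorem SameMem.refl (s : State Reg Tab) : SameMem s s := ⟨rfl, rfl, rfl, rfl, rfl⟩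

theorem SameMem.setReg {s' : State Reg Tab} (h : SameMem s s') (x : Reg) (c : ℕ) :
    SameMem s (s'.setReg x c) := ⟨h.mem, h.used, h.output, h.depth, h.maxDepth⟩

/-- With the edge numbers as ranks and the threshold `1` every edge counts as present, so `common id
1` is the number of common neighbours in the whole graph. -/
theorem runs_countCommon (hg : HasGraph Γ s.mem) {u v : ℕ} (hu : s.reg .u = u) (hv : s.reg .v = v)
    (hc : s.reg .c = 0) (h : ∀ s', SameMem s s' →
      (∀ r, r ≠ .j → r ≠ .w → r ≠ .c → s'.reg r = s.reg r) →
      s'.reg .c = Γ.common id 1 u v → Φ s') :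
    Runs P (loop .j 0 (rd .deg (.var .u)) [
        .set .w (.get .adj (.var .u) (.var .j)),
        when (.lt 0 (.get .edge (.var .v) (.var .w))) [.set .c (.add (.var .c) 1)]]) s
      (10 + Γ.deg u * 40) Φ := by
  refine .loop_const (lov := 0) (hiv := Γ.deg u) (fun j s' => s'.reg .j = j ∧ SameMem s s' ∧
      (∀ r, r ≠ .j → r ≠ .w → r ≠ .c → s'.reg r = s.reg r) ∧
      s'.reg .c = (((Γ.nbrs u).take j).filter fun w => decide (0 < Γ.E v w)).length) 30
    rfl (by omega) (by decide) ?_ ?_ ?_ (by omega) ?_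
  · exact ⟨rfl, (SameMem.refl s).setReg _ _, fun r h₁ h₂ h₃ => by simp [h₁], by simp [hc]⟩
  · rintro i s' ⟨h₁, h₂, h₃, h₄⟩
    exact ⟨h₁, by simp [h₂.mem, hg.deg, h₃, hu]⟩
  · rintro j s' - hj ⟨h₁, h₂, h₃, h₄⟩
    refine .straight rfl (by decide) ?_
    refine .set ((Γ.nbrs u)[j]?.getD 0) (by simp [h₁, h₂.mem, hg.adj, h₃, hu]) (.when ?_ ?_)
    · intro hlt
      simp [h₂.mem, hg.edge, h₃, hv] at hlt
      refine .set _ rfl (.nil (.nil ?_))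
      refine ⟨by simpa using h₁, by simp, ((h₂.setReg _ _).setReg _ _).setReg _ _,
        fun r h h' h'' => by simp [h, h', h'', h₃], ?_⟩
      rw [length_filter_take_succ hj, if_pos hlt]
      simp [h₄]
    · intro hlt
      simp [h₂.mem, hg.edge, h₃, hv] at hlt
      refine .nil ⟨by simpa using h₁, by simp, (h₂.setReg _ _).setReg _ _,
        fun r h h' h'' => by simp [h, h', h₃ r h h' h''], ?_⟩
      rw [length_filter_take_succ hj, if_neg (by omega)]
      simp [h₄]
  · rintro s' ⟨h₁, h₂, h₃, h₄⟩
    refine h s' h₂ h₃ ?_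
    rw [h₄, ← Γ.length_filter_nbrs (ρ := id) (by simp), NumGraph.deg, List.take_length]
    congr 1
    refine List.filter_congr fun w hw => ?_
    have := Γ.mem_nbrs.1 hw
    simp only [id, decide_eq_decide]
    omega

/-- The keys of the sorting. -/
def initSupp (Γ : NumGraph) (e : ℕ) : ℕ := Γ.supp id 1 e

/-- The common neighbours are neighbours of one end other than the opposite end, and a degree is at
most `m`. So supports are legitimate bucket indices. -/
theorem NumGraph.supp_lt {ρ : ℕ → ℕ} {i e : ℕ} (h0 : ρ 0 < i) (he₁ : 1 ≤ e) (he : e ≤ Γ.m) :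
    Γ.supp ρ i e < Γ.m := by
  have hE := Γ.E_ab he₁ he
  rw [NumGraph.supp, ← Γ.length_filter_nbrs h0]
  refine lt_of_lt_of_le ?_ (Γ.deg_le (u := Γ.a e))
  refine lt_of_le_of_ne (List.length_filter_le _ _) fun h => ?_
  erw [List.length_filter_eq_length_iff] at h
  have := h (Γ.b e) (Γ.mem_nbrs.2 (by omega : Γ.E (Γ.a e) (Γ.b e) ≠ 0))
  simp [Γ.E_self] at this
  omega

theorem initSupp_lt {e : ℕ} (he₁ : 1 ≤ e) (he : e ≤ Γ.m) : initSupp Γ e < Γ.m :=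
  Γ.supp_lt (by simp) he₁ he

theorem card_filter_Ico_succ (p : ℕ → Prop) [DecidablePred p] {e : ℕ} (he : 1 ≤ e) :
    ((Finset.Ico 1 (e + 1)).filter p).card =
      ((Finset.Ico 1 e).filter p).card + if p e then 1 else 0 := by
  rw [Finset.card_filter, Finset.sum_Ico_succ_top he, Finset.card_filter]

/-- Edges with `c` common neighbours are counted in cell `c + 1`, so that prefix sums will count the
edges with strictly fewer than a given number. -/
theorem runs_supports {out : List ℕ} (ht : TopLevel Γ k out s)
    (hg : HasGraph Γ s.mem) (h0 : ∀ c, s.mem .start c 0 = 0) : Runs P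
    (loop .e 1 (.add (.var .m) 1) [
      loadEnds, .set .c 0,
      loop .j 0 (rd .deg (.var .u)) [
        .set .w (.get .adj (.var .u) (.var .j)),
        when (.lt 0 (.get .edge (.var .v) (.var .w))) [.set .c (.add (.var .c) 1)]],
      wr .sup (.var .e) (.var .c),
      wr .start (.add (.var .c) 1) (.add (rd .start (.add (.var .c) 1)) 1)]) s
    (10 + ∑ e ∈ Finset.Icc 1 Γ.m, (Γ.minDeg e * 40 + 110)) fun s' => TopLevel Γ k out s' ∧
      HasGraph Γ s'.mem ∧ (∀ t, t ≠ .sup → t ≠ .start → s'.mem t = s.mem t) ∧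
      (∀ e, 1 ≤ e → e ≤ Γ.m → s'.mem .sup e 0 = initSupp Γ e) ∧
      ∀ c, s'.mem .start c 0 = ((Finset.Icc 1 Γ.m).filter fun e => initSupp Γ e + 1 = c).card := by
  refine .loop (lov := 1) (hiv := Γ.m + 1) (fun e s' => s'.reg .e = e ∧ TopLevel Γ k out s' ∧
      (∀ t, t ≠ .sup → t ≠ .start → s'.mem t = s.mem t) ∧
      (∀ f, 1 ≤ f → f < e → s'.mem .sup f 0 = initSupp Γ f) ∧
      ∀ c, s'.mem .start c 0 = ((Finset.Ico 1 e).filter fun e => initSupp Γ e + 1 = c).card)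
    (fun e => Γ.minDeg e * 40 + 100) rfl (by omega) (by decide) ?_ ?_ ?_ le_rfl ?_
  · exact ⟨rfl, ht.congr rfl rfl rfl ht.used ht.output rfl ht.maxDepth, fun _ _ _ => rfl,
      fun _ _ _ => by omega, fun c => by simp [h0]⟩
  · rintro i s' ⟨h₁, h₂, -⟩
    exact ⟨h₁, by simp [h₂.m]⟩
  · rintro e s' he₁ he₂ ⟨h₁, h₂, h₃, h₄, h₅⟩
    have he : e ≤ Γ.m := by omega
    have hg' : HasGraph Γ s'.mem := hg.congr fun t ht => h₃ t (by rintro rfl; simp at ht)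
      (by rintro rfl; simp at ht)
    refine .take (t₁ := Γ.minDeg e * 40 + 50) 2 ?_ rfl
      (Nat.le_trans (Nat.add_le_add_right (show _ ≤ 50 by decide) _) (by omega))
    refine .cons (eff_loadEnds hg' h₁ he₁ he fun u v hE hdeg => .set 0 rfl (.nil ?_))
    refine .cons (t₁ := 10 + Γ.deg u * 40) (t₂ := 40) ?_ (by rw [hdeg]; omega)
    refine runs_countCommon (u := u) (v := v) ?_ ?_ ?_ ?_ ?_
    · exact hg'
    · simp
    · simp
    · simp
    intro s'' h₆ h₇ h₈
    rw [← Γ.supp_eq_common id 1 (by omega) hE] at h₈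
    have h₉ := initSupp_lt he₁ he
    have h₁₀ : s''.reg .e = e := by rw [h₇ .e (by decide) (by decide) (by decide)]; simpa using h₁
    have h₁₁ : s''.mem = s'.mem := h₆.mem
    refine .straight rfl (by decide) ?_
    refine .store e 0 (initSupp Γ e) (by simp [h₁₀]) rfl (by simp [h₈, initSupp]) ?_
    refine .store (initSupp Γ e + 1) 0 (s'.mem .start (initSupp Γ e + 1) 0 + 1)
      (by simp [h₈, initSupp]) rfl (by simp [h₈, h₁₁, initSupp]) (.nil ?_)
    refine ⟨by simpa using h₁₀, by simp, h₂.congr (by simp [h₇]) (by simp [h₇]) (by simp [h₇]) ?_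
      (by simp [h₆.output, h₂.output]) (by simp [h₆.depth]) (by simp [h₆.maxDepth, h₂.maxDepth]),
      fun t h h' => by simp [h, h', h₁₁, h₃], ?_, ?_⟩
    · simp only [setMem_used, setReg_used, Finset.insert_subset_iff, h₆.used]
      exact ⟨Γ.mem_cells (by decide) (by omega), Γ.mem_cells (by decide) (by omega), h₂.used⟩
    · intro f hf hf'
      rcases (show f = e ∨ f < e by omega) with rfl | hf''
      · simp
      · simp [h₁₁, hf''.ne, h₄ f hf hf'']
    · intro c
      rw [card_filter_Ico_succ _ he₁]
      by_cases hc : c = initSupp Γ e + 1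
      · simp [hc, h₅]
      · simp [hc, h₁₁, h₅, Ne.symm hc]
  · rintro s' ⟨h₁, h₂, h₃, h₄, h₅⟩
    refine ⟨h₂, hg.congr fun t ht => h₃ t (by rintro rfl; simp at ht) (by rintro rfl; simp at ht),
      h₃, fun e he he' => h₄ e he (by omega), h₅⟩

/-- Cell `0` holds `1`, the first position, so the running sum at `c` is the first position behind
all edges with key below `c`. -/
theorem runs_prefixSums (ht : TopLevel Γ k out s)
    (hs : ∀ c, s.mem .start c 0 =
      if c = 0 then 1 else ((Finset.Icc 1 Γ.m).filter fun e => initSupp Γ e + 1 = c).card) :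
    Runs P (loop .c 1 (.add (.var .m) 1)
      [wr .start (.var .c) (.add (rd .start (.sub (.var .c) 1)) (rd .start (.var .c)))]) s
    (10 + Γ.m * 30) fun s' => TopLevel Γ k out s' ∧ (∀ t, t ≠ .start → s'.mem t = s.mem t) ∧
      ∀ c ≤ Γ.m, s'.mem .start c 0 =
        1 + ((Finset.Icc 1 Γ.m).filter fun e => initSupp Γ e < c).card := by
  refine .loop_const (lov := 1) (hiv := Γ.m + 1) (fun c s' => s'.reg .c = c ∧
      TopLevel Γ k out s' ∧ (∀ t, t ≠ .start → s'.mem t = s.mem t) ∧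
      (∀ c' < c, s'.mem .start c' 0 =
        1 + ((Finset.Icc 1 Γ.m).filter fun e => initSupp Γ e < c').card) ∧
      ∀ c' ≥ c, s'.mem .start c' 0 =
        ((Finset.Icc 1 Γ.m).filter fun e => initSupp Γ e + 1 = c').card)
    20 rfl (by omega) (by decide) ?_ ?_ ?_ (by omega) ?_
  · refine ⟨rfl, ht.congr rfl rfl rfl ht.used ht.output rfl ht.maxDepth, fun _ _ => rfl, ?_, ?_⟩
    · intro c hc
      obtain rfl : c = 0 := by omega
      simp [hs]
    · intro c hc
      simp [hs]; omega
  · rintro i s' ⟨h₁, h₂, -⟩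
    exact ⟨h₁, by simp [h₂.m]⟩
  · rintro c s' hc₁ hc₂ ⟨h₁, h₂, h₃, h₄, h₅⟩
    refine .straight rfl (by decide) ?_
    refine .store c 0 (1 + ((Finset.Icc 1 Γ.m).filter fun e => initSupp Γ e < c).card)
      (by simp [h₁]) rfl ?_ (.nil ?_)
    · have : (Finset.Icc 1 Γ.m).filter (fun e => initSupp Γ e < c) =
          (Finset.Icc 1 Γ.m).filter (fun e => initSupp Γ e < c - 1) ∪
          (Finset.Icc 1 Γ.m).filter (fun e => initSupp Γ e + 1 = c) := by
        ext e
        simp only [Finset.mem_union, Finset.mem_filter, Finset.mem_Icc]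
        omega
      rw [this, Finset.card_union_of_disjoint, ← add_assoc, ← h₄ _ (by omega), ← h₅ _ le_rfl]
      · simp [h₁, Expr.eval]
      · rw [Finset.disjoint_left]
        intro e
        simp only [Finset.mem_filter, Finset.mem_Icc]
        omega
    · refine ⟨by simpa using h₁, by simp, h₂.congr (by simp) (by simp) (by simp) ?_ h₂.output rfl
        h₂.maxDepth, fun t h => by simp [h, h₃], ?_, ?_⟩
      · simp only [setMem_used, setReg_used, Finset.insert_subset_iff]
        exact ⟨Γ.mem_cells (by decide) (by omega), h₂.used⟩
      · intro c' hc'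
        rcases (show c' = c ∨ c' < c by omega) with rfl | h
        · simp
        · simp [h.ne, h₄ _ h]
      · intro c' hc'
        simp [(show c' ≠ c by omega), h₅ c' (by omega)]
  · rintro s' ⟨h₁, h₂, h₃, h₄, h₅⟩
    exact ⟨h₂, h₃, fun c hc => h₄ c (by omega)⟩

/-- The entry `fill[c]` is the number of edges with key `c` placed so far, hence `start[c] +
fill[c]` is `sortPos` of the current edge. -/
theorem runs_place (ht : TopLevel Γ k out s)
    (hs : ∀ c ≤ Γ.m, s.mem .start c 0 =
        1 + ((Finset.Icc 1 Γ.m).filter fun e => initSupp Γ e < c).card)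
    (hS : ∀ e, 1 ≤ e → e ≤ Γ.m → s.mem .sup e 0 = initSupp Γ e)
    (hf : ∀ c, s.mem .fill c 0 = 0) :
    Runs P (loop .e 1 (.add (.var .m) 1) [
      .set .c (rd .sup (.var .e)), .set .t (.add (rd .start (.var .c)) (rd .fill (.var .c))),
      wr .fill (.var .c) (.add (rd .fill (.var .c)) 1),
      wr .ord (.var .t) (.var .e), wr .pos (.var .e) (.var .t)]) s
    (10 + Γ.m * 60) fun s' => TopLevel Γ k out s' ∧
      (∀ t, t ≠ .fill → t ≠ .ord → t ≠ .pos → s'.mem t = s.mem t) ∧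
      s'.mem .pos 0 0 = s.mem .pos 0 0 ∧
      (∀ e, 1 ≤ e → e ≤ Γ.m → s'.mem .pos e 0 = Γ.sortPos (initSupp Γ) e) ∧
      ∀ e, 1 ≤ e → e ≤ Γ.m → s'.mem .ord (Γ.sortPos (initSupp Γ) e) 0 = e := by
  refine .loop_const (lov := 1) (hiv := Γ.m + 1) (fun e s' => s'.reg .e = e ∧
      TopLevel Γ k out s' ∧ (∀ t, t ≠ .fill → t ≠ .ord → t ≠ .pos → s'.mem t = s.mem t) ∧
      s'.mem .pos 0 0 = s.mem .pos 0 0 ∧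
      (∀ f, 1 ≤ f → f < e → s'.mem .pos f 0 = Γ.sortPos (initSupp Γ) f) ∧
      (∀ f, 1 ≤ f → f < e → s'.mem .ord (Γ.sortPos (initSupp Γ) f) 0 = f) ∧
      ∀ c, s'.mem .fill c 0 = ((Finset.Ico 1 e).filter fun f => initSupp Γ f = c).card)
    50 rfl (by omega) (by decide) ?_ ?_ ?_ (by omega) ?_
  · exact ⟨rfl, ht.congr rfl rfl rfl ht.used ht.output rfl ht.maxDepth, fun _ _ _ _ => rfl, rfl,
      fun _ _ _ => by omega, fun _ _ _ => by omega, fun c => by simp [hf]⟩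
  · rintro i s' ⟨h₁, h₂, -⟩
    exact ⟨h₁, by simp [h₂.m]⟩
  · rintro e s' he₁ he₂ ⟨h₁, h₂, h₃, h₄, h₅, h₆, h₇⟩
    have he : e ≤ Γ.m := by omega
    have hlt := initSupp_lt he₁ he
    have hle := Γ.sortPos_le (S := initSupp Γ) he₁ he
    refine .straight rfl (by decide) ?_
    refine .set (initSupp Γ e) (by simp [h₁, h₃, hS, he₁, he]) ?_
    refine .set (Γ.sortPos (initSupp Γ) e)
      (by simp [h₃, hs, hlt.le, h₇, NumGraph.sortPos]) ?_
    refine .store (initSupp Γ e) 0 (s'.mem .fill (initSupp Γ e) 0 + 1) (by simp) rfl (by simp) ?_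
    refine .store (Γ.sortPos (initSupp Γ) e) 0 e (by simp) rfl (by simp [h₁]) ?_
    refine .store e 0 (Γ.sortPos (initSupp Γ) e) (by simp [h₁]) rfl (by simp) (.nil ?_)
    refine ⟨by simpa using h₁, by simp, h₂.congr (by simp) (by simp) (by simp) ?_ h₂.output rfl
        h₂.maxDepth, fun t h h' h'' => by simp [h, h', h'', h₃], ?_, ?_, ?_, ?_⟩
    · simp only [setMem_used, setReg_used, Finset.insert_subset_iff]
      exact ⟨Γ.mem_cells (by decide) (by omega), Γ.mem_cells (by decide) (by omega),
        Γ.mem_cells (by decide) (by omega), h₂.used⟩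
    · simp [h₄]; omega
    · intro f hf hf'
      rcases (show f = e ∨ f < e by omega) with rfl | h
      · simp
      · simp [h.ne, h₅ f hf h]
    · intro f hf hf'
      rcases (show f = e ∨ f < e by omega) with rfl | h
      · simp
      · have : Γ.sortPos (initSupp Γ) f ≠ Γ.sortPos (initSupp Γ) e := by
          have h₁ := Γ.sortPos_lt (S := initSupp Γ) hf (by omega : f ≤ Γ.m) he
          have h₂ := Γ.sortPos_lt (S := initSupp Γ) he₁ he (by omega : f ≤ Γ.m)
          omega
        simp [this, h₆ f hf h]
    · intro c
      rw [card_filter_Ico_succ _ he₁]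
      by_cases hc : c = initSupp Γ e
      · simp [hc, h₇]
      · simp [hc, h₇, Ne.symm hc]
  · rintro s' ⟨h₁, h₂, h₃, h₄, h₅, h₆, h₇⟩
    exact ⟨h₂, h₃, h₄, fun e he he' => h₅ e he (by omega), fun e he he' => h₆ e he (by omega)⟩

/-- The tables `ord`, `pos`, `sup` and `start` represent a sorting of the edges by their supports,
as far as positions greater than `i` are concerned. -/
structure Buckets (Γ : NumGraph) (i : ℕ) (M : Tab → ℕ → ℕ → ℕ) : Prop where
  isOrdering : Γ.IsOrdering (M .ord · 0) (M .pos · 0)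
  start : ∀ c ≤ Γ.m, ∀ p, i < p → p ≤ Γ.m → (c ≤ M .sup (M .ord p 0) 0 ↔ M .start c 0 ≤ p)

theorem runs_sortBySupport (ht : TopLevel Γ k out s) (hg : HasGraph Γ s.mem)
    (h0 : ∀ t, t = .start ∨ t = .fill ∨ t = .pos → ∀ c, s.mem t c 0 = 0) :
    Runs P sortBySupport s (60 + Γ.m * 200 + 40 * ∑ e ∈ Finset.Icc 1 Γ.m, Γ.minDeg e)
      fun s' => TopLevel Γ k out s' ∧
      HasGraph Γ s'.mem ∧ (∀ t, t ≠ .sup → t ≠ .start → t ≠ .fill → t ≠ .ord → t ≠ .pos →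
        s'.mem t = s.mem t) ∧
      (∀ e, 1 ≤ e → e ≤ Γ.m → s'.mem .sup e 0 = initSupp Γ e) ∧ Buckets Γ 0 s'.mem := by
  refine (runs_supports ht hg (h0 _ (by simp))).then (t₂ := Γ.m * 90 + 45) ?_
    (by simp only [Finset.sum_add_distrib, ← Finset.sum_mul]; simp; omega)
  rintro s₁ ⟨ht₁, hg₁, hM₁, hsup₁, hstart₁⟩
  refine .take (t₁ := Γ.m * 90 + 25) 1 (.store 0 0 1 rfl rfl rfl (.nil ?_)) rfl
    (Nat.le_trans (Nat.add_le_add_right (show _ ≤ 20 by decide) _) (by omega))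
  refine (runs_prefixSums (Γ := Γ) (k := k) (out := out) ?_ ?_).then (t₂ := Γ.m * 60 + 11) ?_
    (by omega)
  · exact ht₁.congr rfl rfl rfl
      (by simp [Finset.insert_subset_iff, ht₁.used, Γ.mem_cells (t := .start) (i := 0)])
      ht₁.output rfl ht₁.maxDepth
  · intro c
    simp [hstart₁]
  rintro s₂ ⟨ht₂, hM₂, hstart₂⟩
  refine (runs_place ht₂ hstart₂ ?_ ?_).then (t₂ := 1) ?_ (by omega)
  · intro e he he'
    rw [hM₂ _ (by decide)]
    simp [hsup₁ e he he']
  · intro c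
    rw [hM₂ _ (by decide)]
    simp [hM₁, h0]
  rintro s₃ ⟨ht₃, hM₃, hpos₀, hpos, hord⟩
  have hM : ∀ t, t ≠ .sup → t ≠ .start → t ≠ .fill → t ≠ .ord → t ≠ .pos →
      s₃.mem t = s.mem t := by
    intro t h₁ h₂ h₃ h₄ h₅
    rw [hM₃ t h₃ h₄ h₅, hM₂ t h₂, setMem_mem_ne _ _ _ _ _ h₂, hM₁ t h₁ h₂]
  have hsup : ∀ e, 1 ≤ e → e ≤ Γ.m → s₃.mem .sup e 0 = initSupp Γ e := by
    intro e he he'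
    rw [hM₃ _ (by decide) (by decide) (by decide), hM₂ _ (by decide)]
    simp [hsup₁ e he he']
  -- The cell `pos[0]` has kept its initial `0`, which gives the missing edge the rank `0`.
  have hO : Γ.IsOrdering (s₃.mem .ord · 0) (s₃.mem .pos · 0) := by
    refine Γ.isOrdering_sortPos ?_ hpos hord
    rw [hpos₀, hM₂ _ (by decide)]
    simp [hM₁, h0]
  refine .nil ⟨ht₃, hg.congr fun t ht => ?_, hM, hsup, hO, ?_⟩ le_rfl
  · simp only [List.mem_cons, List.not_mem_nil, or_false] at ht
    rcases ht with rfl | rfl | rfl | rfl | rfl <;>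
      exact hM _ (by decide) (by decide) (by decide) (by decide) (by decide)
  · intro c hc p hp hp'
    obtain ⟨h₁, h₂, h₃⟩ := hO.edge_rank p hp hp'
    rw [hsup _ h₁ h₂, ← Γ.le_sortPos_iff h₁ h₂, ← hpos _ h₁ h₂, h₃,
      hM₃ _ (by decide) (by decide) (by decide), hstart₂ c hc]

end EBBkCT

/-! ### Peeling -/

namespace EBBkCT

open RAM

variable {Γ : NumGraph} {k : ℕ} {out : List ℕ} {P : Cmd Reg Tab} {s : State Reg Tab} {t : ℕ}
  {Φ : State Reg Tab → Prop}

namespace NumGraph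

variable {o ρ : ℕ → ℕ}

/-- The conditionals mirror the stores in `decrease`, the last store being tested first, so that the
case in which `f` already stands at `t` is covered as well. -/
theorem IsOrdering.swap (h : Γ.IsOrdering o ρ) {f t : ℕ} (hf : 1 ≤ f ∧ f ≤ Γ.m)
    (ht : 1 ≤ t ∧ t ≤ Γ.m) :
    Γ.IsOrdering (fun p => if p = ρ f then o t else if p = t then f else o p)
      (fun e => if e = o t then ρ f else if e = f then t else ρ e) := by
  have h₁ := h.edge_rank t ht.1 ht.2
  have h₂ := h.rank_edge f hf.1 hf.2
  refine ⟨?_, fun e he he' => ?_, fun p hp hp' => ?_⟩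
  · rw [if_neg (by omega), if_neg (by omega), h.rank_zero]
  · have h₃ := h.rank_edge e he he'
    by_cases h₄ : e = o t
    · simp [h₄, h₂]
    by_cases h₅ : e = f
    · subst h₅
      have : t ≠ ρ e := by rintro rfl; exact h₄ h₂.2.2.symm
      simp [h₄, this, ht]
    · have h₆ : ρ e ≠ ρ f := fun h' => h₅ (by rw [← h₃.2.2, h', h₂.2.2])
      have h₇ : ρ e ≠ t := fun h' => h₄ (by rw [← h₃.2.2, h'])
      simp [h₄, h₅, h₆, h₇, h₃]
  · have h₃ := h.edge_rank p hp hp'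
    by_cases h₄ : p = ρ f
    · simp [h₄, h₁]
    by_cases h₅ : p = t
    · subst h₅
      have : f ≠ o p := by rintro rfl; exact h₄ h₁.2.2.symm
      simp [h₄, this, hf]
    · have h₆ : o p ≠ o t := fun h' => h₅ (by rw [← h₃.2.2, h', h₁.2.2])
      have h₇ : o p ≠ f := fun h' => h₄ (by rw [← h₃.2.2, h'])
      simp [h₄, h₅, h₆, h₇, h₃]

theorem Greedy.congr {o' ρ' : ℕ → ℕ} {r : ℕ} (h : Γ.Greedy o ρ r)
    (ho : ∀ p, 1 ≤ p → p ≤ r → o' p = o p)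
    (hρ : ∀ i ≤ r, ∀ e ≤ Γ.m, i ≤ ρ' e ↔ i ≤ ρ e) : Γ.Greedy o' ρ' r := by
  intro i hi hi' e he he' hie
  rw [Γ.supp_congr (hρ i hi'), Γ.supp_congr (hρ i hi'), ho i hi hi']
  exact h i hi hi' e he he' ((hρ i hi' e he').1 hie)

end NumGraph

/-- Once `f` stands first in its bucket, moving the boundary past it puts it at the end of the
bucket below. The maximum with `i + 1` is needed because a boundary may point to a position that
removals have already passed; the invariant speaks only of positions beyond `i`. -/
theorem Buckets.decrease {M M' : Tab → ℕ → ℕ → ℕ} {i f p₀ : ℕ} (h : Buckets Γ i M)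
    (hf : 1 ≤ f ∧ f ≤ Γ.m) (hpos : i < M .pos f 0) (hsup : 1 ≤ M .sup f 0 ∧ M .sup f 0 ≤ Γ.m)
    (hp₀ : p₀ = max (M .start (M .sup f 0) 0) (i + 1))
    (hord : ∀ p, M' .ord p 0 =
      if p = M .pos f 0 then M .ord p₀ 0 else if p = p₀ then f else M .ord p 0)
    (hpos' : ∀ e, M' .pos e 0 =
      if e = M .ord p₀ 0 then M .pos f 0 else if e = f then p₀ else M .pos e 0)
    (hstart : ∀ c, M' .start c 0 = if c = M .sup f 0 then p₀ + 1 else M .start c 0)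
    (hsup' : ∀ e, M' .sup e 0 = if e = f then M .sup f 0 - 1 else M .sup e 0) :
    Buckets Γ i M' ∧ p₀ ≤ M .pos f 0 := by
  obtain ⟨hO, hs⟩ := h
  have h₁ := hO.rank_edge f hf.1 hf.2
  have h₂ := hs _ hsup.2 _ hpos h₁.2.1
  rw [h₁.2.2] at h₂
  have hle : p₀ ≤ M .pos f 0 := by omega
  have h₃ := hO.edge_rank p₀ (by omega) (by omega)
  refine ⟨⟨?_, ?_⟩, hle⟩
  · have := hO.swap hf (t := p₀) (by omega)
    simpa only [← hord, ← hpos'] using this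
  · intro c hc p hp hp'
    -- Since `p₀` lies between the boundary and the place of `f`, the edge at `p₀` has the same
    -- support as `f`. The exchange thus disturbs no boundary, and only the one numbered by the old
    -- support of `f` has to move.
    have h₄ := hs c hc p₀ (by omega) (by omega)
    have h₅ := hs c hc _ hpos (by omega)
    have h₆ := hs _ hsup.2 p₀ (by omega) (by omega)
    have h₇ := hs c hc p hp hp'
    rw [h₁.2.2] at h₅
    rw [hstart, hord, hsup']
    by_cases hpq : p = M .pos f 0
    · rw [if_pos hpq]
      by_cases hqt : M .ord p₀ 0 = f
      · rw [if_pos hqt]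
        have : p = p₀ := by rw [hpq, ← hqt, h₃.2.2]
        split_ifs <;> omega
      · rw [if_neg hqt]
        have : p ≠ p₀ := by rintro rfl; exact hqt (by rw [hpq, h₁.2.2])
        split_ifs <;> omega
    · rw [if_neg hpq]
      by_cases hpt : p = p₀
      · rw [if_pos hpt, if_pos rfl]
        split_ifs <;> omega
      · have h₈ := hO.edge_rank p (by omega) hp'
        have : M .ord p 0 ≠ f := by intro h; rw [h] at h₈; omega
        rw [if_neg hpt, if_neg this]
        split_ifs with h₉
        · subst h₉; omega
        · exact h₇

/-- The effect of `decrease`. -/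
structure Decreased (Γ : NumGraph) (i f : ℕ) (s s' : State Reg Tab) : Prop where
  reg : ∀ x, x ≠ .c → x ≠ .t → x ≠ .r → x ≠ .q → s'.reg x = s.reg x
  used : s'.used ⊆ Γ.cells
  output : s'.output = s.output
  depth : s'.depth = s.depth
  maxDepth : s'.maxDepth = s.maxDepth
  mem : ∀ t, t ≠ .ord → t ≠ .pos → t ≠ .start → t ≠ .sup → s'.mem t = s.mem t
  buckets : Buckets Γ i s'.mem
  sup : ∀ e, s'.mem .sup e 0 = if e = f then s.mem .sup f 0 - 1 else s.mem .sup e 0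
  ord : ∀ p ≤ i, s'.mem .ord p 0 = s.mem .ord p 0
  pos : ∀ e, s'.mem .pos e 0 = s.mem .pos e 0 ∨ i < s'.mem .pos e 0 ∧ i < s.mem .pos e 0

theorem eff_decrease {x : Reg} (hx : x ≠ .c ∧ x ≠ .t ∧ x ≠ .r ∧ x ≠ .q) {i f : ℕ}
    (hB : Buckets Γ i s.mem) (hu : s.used ⊆ Γ.cells) (hi : s.reg .i = i) (hxf : s.reg x = f)
    (hf : 1 ≤ f ∧ f ≤ Γ.m) (hpos : i < s.mem .pos f 0)
    (hsup : 1 ≤ s.mem .sup f 0 ∧ s.mem .sup f 0 ≤ Γ.m)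
    (h : ∀ s', Decreased Γ i f s s' → Φ s') : Eff (decrease x) s Φ := by
  generalize hM : s.mem = M at *
  obtain ⟨p₀, hp₀⟩ : ∃ p₀, p₀ = max (M .start (M .sup f 0) 0) (i + 1) := ⟨_, rfl⟩
  -- The remaining commands are the same whether or not `t` had to be raised to `i + 1`; in both
  -- cases it holds `p₀`.
  have key : Eff (block [.set .r (rd .ord (.var .t)), .set .q (rd .pos (.var x)),
      wr .ord (.var .t) (.var x), wr .pos (.var x) (.var .t), wr .ord (.var .q) (.var .r),
      wr .pos (.var .r) (.var .q), wr .start (.var .c) (.add (.var .t) 1),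
      wr .sup (.var x) (.sub (.var .c) 1)])
      ((s.setReg .c (M .sup f 0)).setReg .t p₀) Φ := by
    refine .set (M .ord p₀ 0) (by simp [hM]) ?_
    refine .set (M .pos f 0) (by simp [hx, hxf, hM]) ?_
    refine .store p₀ 0 f (by simp [hM]) rfl (by simp [hx, hxf, hM]) ?_
    refine .store f 0 p₀ (by simp [hx, hxf, hM]) rfl (by simp [hM]) ?_
    refine .store (M .pos f 0) 0 (M .ord p₀ 0) (by simp [hM]) rfl (by simp [hM]) ?_
    refine .store (M .ord p₀ 0) 0 (M .pos f 0) (by simp [hM]) rfl (by simp [hM]) ?_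
    refine .store (M .sup f 0) 0 (p₀ + 1) (by simp [hM]) rfl (by simp [hM]) ?_
    refine .store f 0 (M .sup f 0 - 1) (by simp [hx, hxf, hM]) rfl (by simp [Expr.eval, hM])
      (.nil ?_)
    generalize hs' : State.setMem (R := Reg) _ Tab.sup _ _ _ = s'
    have hord : ∀ p, s'.mem .ord p 0 =
        if p = M .pos f 0 then M .ord p₀ 0 else if p = p₀ then f else M .ord p 0 := by
      intro p; subst hs'; simp [hM]
    have hpos' : ∀ e, s'.mem .pos e 0 =
        if e = M .ord p₀ 0 then M .pos f 0 else if e = f then p₀ else M .pos e 0 := by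
      intro p; subst hs'; simp [hM]
    have hsup' : ∀ e, s'.mem .sup e 0 = if e = f then M .sup f 0 - 1 else M .sup e 0 := by
      intro p; subst hs'; simp [hM]
    obtain ⟨hB', hle⟩ := hB.decrease hf hpos hsup hp₀ hord hpos'
      (fun c => by subst hs'; simp [hM]) hsup'
    have hO := hB.isOrdering
    have h₁ := hO.rank_edge f hf.1 hf.2
    have h₃ := hO.edge_rank p₀ (by omega) (by omega)
    refine h _ ⟨fun y h₁ h₂ h₃ h₄ => ?_, ?_, ?_, ?_, ?_, fun t h₁ h₂ h₃ h₄ => ?_, hB',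
      fun e => by rw [hsup', hM], fun p hp => ?_, fun e => ?_⟩
    · subst hs'; simp [h₁, h₂, h₃, h₄]
    · subst hs'
      simp only [setMem_used, setReg_used, Finset.insert_subset_iff]
      refine ⟨?_, ?_, ?_, ?_, ?_, ?_, hu⟩ <;> exact Γ.mem_cells (by decide) (by omega)
    · subst hs'; rfl
    · subst hs'; rfl
    · subst hs'; rfl
    · subst hs'; simp [h₁, h₂, h₃, h₄]
    · rw [hord, hM, if_neg (by omega), if_neg (by omega)]
    · rw [hpos', hM]
      by_cases h₅ : e = M .ord p₀ 0
      · subst h₅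
        rw [if_pos rfl]
        omega
      · by_cases h₆ : e = f
        · subst h₆
          rw [if_neg h₅, if_pos rfl]
          omega
        · rw [if_neg h₅, if_neg h₆]
          exact .inl rfl
  refine .set (M .sup f 0) (by simp [hxf, hM])
    (.set (M .start (M .sup f 0) 0) (by simp [hM]) (.when ?_ ?_))
  · intro hlt
    simp [hi, hM] at hlt
    refine .set p₀ (by simp [hi, hM]; omega) (.nil ?_)
    rw [setReg_setReg]
    exact key
  · intro hlt
    simp [hi, hM] at hlt
    rw [show M .start (M .sup f 0) 0 = p₀ by omega]
    exact key

/-- What is preserved while the edge of rank `i` is being removed; `M` is the memory before. -/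
structure Removing (Γ : NumGraph) (k : ℕ) (out : List ℕ) (i : ℕ) (M : Tab → ℕ → ℕ → ℕ)
    (s : State Reg Tab) : Prop where
  top : TopLevel Γ k out s
  mem : ∀ t, t ≠ .ord → t ≠ .pos → t ≠ .start → t ≠ .sup → s.mem t = M t
  buckets : Buckets Γ i s.mem
  ord : ∀ p ≤ i, s.mem .ord p 0 = M .ord p 0
  pos : ∀ e, s.mem .pos e 0 = M .pos e 0 ∨ i < s.mem .pos e 0 ∧ i < M .pos e 0

theorem Removing.setReg {i c : ℕ} {M : Tab → ℕ → ℕ → ℕ} (h : Removing Γ k out i M s) {x : Reg}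
    (hx : x ≠ .n ∧ x ≠ .m ∧ x ≠ .k) : Removing Γ k out i M (s.setReg x c) :=
  ⟨h.top.congr (by simp [hx.1.symm]) (by simp [hx.2.1.symm]) (by simp [hx.2.2.symm]) h.top.used
    h.top.output rfl h.top.maxDepth, h.mem, h.buckets, h.ord, h.pos⟩

theorem Removing.decreased {i f : ℕ} {M : Tab → ℕ → ℕ → ℕ} {s' : State Reg Tab}
    (h : Removing Γ k out i M s) (h' : Decreased Γ i f s s') : Removing Γ k out i M s' := by
  refine ⟨h.top.congr (h'.reg _ (by decide) (by decide) (by decide) (by decide))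
    (h'.reg _ (by decide) (by decide) (by decide) (by decide))
    (h'.reg _ (by decide) (by decide) (by decide) (by decide)) h'.used
    (h'.output.trans h.top.output) h'.depth (h'.maxDepth.trans_le h.top.maxDepth),
    fun t h₁ h₂ h₃ h₄ => (h'.mem t h₁ h₂ h₃ h₄).trans (h.mem t h₁ h₂ h₃ h₄), h'.buckets,
    fun p hp => (h'.ord p hp).trans (h.ord p hp), fun e => ?_⟩
  have h₁ := h.pos e
  have h₂ := h'.pos e
  omega

/-- `f` lies in a triangle with the edge `uv` whose other edges have rank greater than `i` and
whose third vertex is in the list `l`. -/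
def Triangle (Γ : NumGraph) (ρ : ℕ → ℕ) (i u v : ℕ) (l : List ℕ) (f : ℕ) : Prop :=
  ∃ w ∈ l, (f = Γ.E u w ∨ f = Γ.E v w) ∧ i < ρ (Γ.E u w) ∧ i < ρ (Γ.E v w)

/-- The table `sup` when the triangles with third vertex in `l` are still to be dealt with. -/
def HasSupp (Γ : NumGraph) (i u v : ℕ) (M : Tab → ℕ → ℕ → ℕ) (l : List ℕ) (σ : ℕ → ℕ) : Prop :=
  ∀ f, 1 ≤ f → f ≤ Γ.m → i < M .pos f 0 →
    Triangle Γ (M .pos · 0) i u v l f ∧ σ f = Γ.supp (M .pos · 0) (i + 1) f + 1 ∨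
    ¬ Triangle Γ (M .pos · 0) i u v l f ∧ σ f = Γ.supp (M .pos · 0) (i + 1) f

/-- An edge `f` other than `uv` lies in at most one triangle with `uv`, so its stored support is too
large by one exactly while the third vertex of that triangle is still to come in the adjacency list.
An edge is recognised as still present by `rank = 0`; the test `0 < x` excludes the missing edge,
whose entry is `0` too. -/
theorem runs_removeEdge {i u v : ℕ} {M : Tab → ℕ → ℕ → ℕ} (hM : s.mem = M)
    (hR : Removing Γ k out i M s) (hg : HasGraph Γ M)
    (hrank : ∀ f ≤ Γ.m, M .rank f 0 = if M .pos f 0 ≤ i then M .pos f 0 else 0)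
    (hi : s.reg .i = i) (hi₁ : 1 ≤ i) (hu : s.reg .u = u) (hv : s.reg .v = v)
    (huv : M .pos (Γ.E u v) 0 = i)
    (hsup : ∀ f, 1 ≤ f → f ≤ Γ.m → i < M .pos f 0 → M .sup f 0 = Γ.supp (M .pos · 0) i f)
    (h : ∀ s', Removing Γ k out i M s' → s'.reg .i = i →
      (∀ f, 1 ≤ f → f ≤ Γ.m → i < M .pos f 0 →
        s'.mem .sup f 0 = Γ.supp (M .pos · 0) (i + 1) f) → Φ s') :
    Runs P (loop .j 0 (rd .deg (.var .u)) [
      .set .w (.get .adj (.var .u) (.var .j)), .set .f (.get .edge (.var .u) (.var .w)),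
      .set .x (.get .edge (.var .v) (.var .w)),
      when (.and (.lt 0 (.var .x)) (.and (.eq (rd .rank (.var .f)) 0) (.eq (rd .rank (.var .x)) 0)))
        [decrease .f, decrease .x]]) s (10 + Γ.deg u * 200) Φ := by
  have hO : Γ.IsOrdering (M .ord · 0) (M .pos · 0) := hM ▸ hR.buckets.isOrdering
  have huv' : Γ.E u v ≠ 0 := hO.E_ne_zero (by omega)
  have hne := Γ.ne_of_E_ne_zero huv'
  refine .loop_const (lov := 0) (hiv := Γ.deg u) (fun j s' => s'.reg .j = j ∧
      Removing Γ k out i M s' ∧ s'.reg .i = i ∧ s'.reg .u = u ∧ s'.reg .v = v ∧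
      HasSupp Γ i u v M ((Γ.nbrs u).drop j) (s'.mem .sup · 0)) 190
    rfl (by omega) (by decide) ?_ ?_ ?_ (by omega) ?_
  · refine ⟨rfl, hR.setReg (by decide), hi, hu, hv, fun f hf hf' hif => ?_⟩
    simp only [setReg_mem, hM, hsup f hf hf' hif]
    have := hO.supp_succ hi₁ huv hif hf hf'
    have heq : Triangle Γ (M .pos · 0) i u v ((Γ.nbrs u).drop 0) f ↔
        ∃ w, (f = Γ.E u w ∨ f = Γ.E v w) ∧ i < M .pos (Γ.E u w) 0 ∧ i < M .pos (Γ.E v w) 0 := by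
      simp only [Triangle, List.drop_zero, Γ.mem_nbrs]
      exact ⟨fun ⟨w, h⟩ => ⟨w, h.2⟩, fun ⟨w, h⟩ => ⟨w, hO.E_ne_zero (by omega), h⟩⟩
    rwa [heq]
  · rintro j s' ⟨h₁, h₂, h₃, h₄, h₅, h₆⟩
    refine ⟨h₁, ?_⟩
    simp only [eval_rd, eval_var, h₄, h₂.mem .deg (by decide) (by decide) (by decide) (by decide)]
    exact hg.deg u
  · rintro j s' - hj ⟨h₁, h₂, h₃, h₄, h₅, h₆⟩
    have hadj : s'.mem .adj u j = (Γ.nbrs u)[j]?.getD 0 := by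
      rw [h₂.mem .adj (by decide) (by decide) (by decide) (by decide), hg.adj]
    have hedge : s'.mem .edge = M .edge :=
      h₂.mem .edge (by decide) (by decide) (by decide) (by decide)
    have hrank' : s'.mem .rank = M .rank :=
      h₂.mem .rank (by decide) (by decide) (by decide) (by decide)
    have hdrop : (Γ.nbrs u).drop j = (Γ.nbrs u)[j]?.getD 0 :: (Γ.nbrs u).drop (j + 1) := by
      rw [List.drop_eq_getElem_cons hj, List.getElem?_eq_getElem hj]; rfl
    generalize (Γ.nbrs u)[j]?.getD 0 = w at hadj hdrop
    have hw : w ∉ (Γ.nbrs u).drop (j + 1) := by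
      have := Γ.nodup_nbrs (u := u) |>.sublist (List.drop_sublist j _)
      rw [hdrop] at this
      exact (List.nodup_cons.1 this).1
    have hmem : w ∈ Γ.nbrs u := List.mem_of_mem_drop (i := j) (by simp [hdrop])
    rw [Γ.mem_nbrs] at hmem
    have hr₁ := hO.rank_edge _ (by omega) (Γ.E_le u w)
    refine .straight rfl (by decide) ?_
    refine .set w (by simp [h₁, h₄, hadj]) ?_
    refine .set (Γ.E u w) (by simp [h₄, hedge, hg.edge]) ?_
    refine .set (Γ.E v w) (by simp [h₅, hedge, hg.edge]) (.when ?_ ?_)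
    · intro hlt
      simp [hrank', hrank _ (Γ.E_le u w), hrank _ (Γ.E_le v w)] at hlt
      have hvw : Γ.E v w ≠ 0 := by omega
      have hr₂ := hO.rank_edge _ (by omega) (Γ.E_le v w)
      have hiu : i < M .pos (Γ.E u w) 0 := by omega
      have hiv : i < M .pos (Γ.E v w) 0 := by omega
      have hfx : Γ.E u w ≠ Γ.E v w := by
        intro h'
        rw [Γ.E_comm u, Γ.E_comm v] at h'
        exact hne (Γ.E_inj (by rwa [Γ.E_comm]) h')
      -- The third vertex of the triangle is the end of `f` other than `u` and `v`. Once `w` has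
      -- been dealt with, no later entry of the list concerns `f`.
      have hnot : ∀ f, (f = Γ.E u w ∨ f = Γ.E v w) →
          ¬ Triangle Γ (M .pos · 0) i u v ((Γ.nbrs u).drop (j + 1)) f := by
        rintro f hf ⟨w', hw', hf', -, -⟩
        have hww' : w ≠ w' := by rintro rfl; exact hw hw'
        have h₀ := Γ.ne_of_E_ne_zero hmem
        have h₀' := Γ.ne_of_E_ne_zero hvw
        have e₁ := Γ.ends_of_E_ne_zero hmem
        have e₂ := Γ.ends_of_E_ne_zero hvw
        have e₃ : f ≠ 0 := by omega
        rcases hf' with rfl | rfl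
        · have e₄ := Γ.ends_of_E_ne_zero e₃
          rcases hf with hf | hf <;> rw [hf] at e₄ <;> omega
        · have e₄ := Γ.ends_of_E_ne_zero e₃
          rcases hf with hf | hf <;> rw [hf] at e₄ <;> omega
      have hcons : ∀ f, Triangle Γ (M .pos · 0) i u v ((Γ.nbrs u).drop j) f ↔
          (f = Γ.E u w ∨ f = Γ.E v w) ∨
            Triangle Γ (M .pos · 0) i u v ((Γ.nbrs u).drop (j + 1)) f := by
        intro f
        simp [Triangle, hdrop, hiu, hiv]
      have hposeq : ∀ e, i < M .pos e 0 → i < s'.mem .pos e 0 := by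
        intro e he
        have := h₂.pos e
        omega
      -- The pending triangle makes both stored supports at least `1`, and at most `m` by `supp_lt`,
      -- as `eff_decrease` requires.
      have hs₁ := h₆ _ (by omega) (Γ.E_le u w) hiu
      have hs₂ := h₆ _ (by omega) (Γ.E_le v w) hiv
      have hlt₁ := NumGraph.supp_lt (ρ := (M .pos · 0)) (i := i + 1) (e := Γ.E u w)
        (by have := hO.rank_zero; omega) (by omega) (Γ.E_le u w)
      have hlt₂ := NumGraph.supp_lt (ρ := (M .pos · 0)) (i := i + 1) (e := Γ.E v w)
        (by have := hO.rank_zero; omega) (by omega) (Γ.E_le v w)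
      rw [hcons] at hs₁ hs₂
      simp only [true_or, or_true, true_and, not_true, false_and, or_false] at hs₁ hs₂
      refine .cons (eff_decrease (i := i) (f := Γ.E u w) (by decide) h₂.buckets h₂.top.used
        (by simp [h₃]) (by simp) ⟨by omega, Γ.E_le u w⟩ (hposeq _ hiu)
        (by simp only [setReg_mem]; omega) fun s₁ hd₁ => ?_)
      have hR₁ := (((h₂.setReg (by decide)).setReg (by decide)).setReg (by decide)).decreased hd₁
      have hreg₁ := hd₁.reg
      refine .cons (eff_decrease (i := i) (f := Γ.E v w) (by decide) hd₁.buckets hd₁.used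
        ?_ ?_ ⟨by omega, Γ.E_le v w⟩ ?_ ?_ fun s₂ hd₂ => .nil (.nil ?_))
      · rw [hreg₁ _ (by decide) (by decide) (by decide) (by decide)]; simp [h₃]
      · rw [hreg₁ _ (by decide) (by decide) (by decide) (by decide)]; simp
      · have h₇ := hd₁.pos (Γ.E v w)
        have h₈ := hposeq _ hiv
        simp only [setReg_mem] at h₇
        omega
      · rw [hd₁.sup, if_neg hfx.symm]
        simp only [setReg_mem]
        omega
      have hreg : ∀ y, y ≠ .c → y ≠ .t → y ≠ .r → y ≠ .q → y ≠ .w → y ≠ .f → y ≠ .x →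
          s₂.reg y = s'.reg y := by
        intro y y₁ y₂ y₃ y₄ y₅ y₆ y₇
        rw [hd₂.reg y y₁ y₂ y₃ y₄, hreg₁ y y₁ y₂ y₃ y₄]
        simp [y₅, y₆, y₇]
      refine ⟨by rw [hreg] <;> first | exact h₁ | decide, by simp,
        (hR₁.decreased hd₂).setReg (by decide), ?_, ?_, ?_, ?_⟩
      · simp only [setReg_reg, reduceCtorEq, if_false]
        rw [hreg] <;> first | exact h₃ | decide
      · simp only [setReg_reg, reduceCtorEq, if_false]
        rw [hreg] <;> first | exact h₄ | decide
      · simp only [setReg_reg, reduceCtorEq, if_false]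
        rw [hreg] <;> first | exact h₅ | decide
      · intro f hf hf' hif
        have h₉ := h₆ f hf hf' hif
        simp only [setReg_mem]
        rw [hd₂.sup, hd₁.sup, hd₁.sup]
        simp only [setReg_mem]
        by_cases hfu : f = Γ.E u w ∨ f = Γ.E v w
        · refine .inr ⟨hnot f hfu, ?_⟩
          rcases hfu with rfl | rfl
          · rw [if_neg hfx, if_pos rfl]; omega
          · rw [if_pos rfl, if_neg hfx.symm]; omega
        · rw [hcons] at h₉
          rw [if_neg (fun h => hfu (.inr h)), if_neg (fun h => hfu (.inl h))]
          simpa only [hfu, false_or] using h₉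
    · intro hlt
      simp [hrank', hrank _ (Γ.E_le u w), hrank _ (Γ.E_le v w)] at hlt
      refine .nil ⟨by simpa using h₁, by simp,
        (((h₂.setReg (by decide)).setReg (by decide)).setReg (by decide)).setReg (by decide),
        by simpa using h₃, by simpa using h₄, by simpa using h₅, fun f hf hf' hif => ?_⟩
      have h₉ := h₆ f hf hf' hif
      have : Triangle Γ (M .pos · 0) i u v ((Γ.nbrs u).drop j) f ↔
            Triangle Γ (M .pos · 0) i u v ((Γ.nbrs u).drop (j + 1)) f := by
        simp only [Triangle, hdrop, List.mem_cons, exists_eq_or_imp, or_iff_right_iff_imp]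
        rintro ⟨-, h₇, h₈⟩
        have := hO.E_ne_zero (u := v) (v := w) (by omega)
        omega
      rwa [this] at h₉
  · rintro s' ⟨h₁, h₂, h₃, h₄, h₅, h₆⟩
    refine h s' h₂ h₃ fun f hf hf' hif => ?_
    have := h₆ f hf hf' hif
    rw [NumGraph.deg, List.drop_length] at this
    simpa [Triangle] using this

/-- The invariant of the peeling, before the edge of rank `i` is chosen. -/
structure Peeling (Γ : NumGraph) (k : ℕ) (out : List ℕ) (i : ℕ) (s : State Reg Tab) : Prop where
  top : TopLevel Γ k out s
  graph : HasGraph Γ s.mem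
  buckets : Buckets Γ (i - 1) s.mem
  rank : ∀ f ≤ Γ.m, s.mem .rank f 0 = if s.mem .pos f 0 < i then s.mem .pos f 0 else 0
  sup : ∀ f, 1 ≤ f → f ≤ Γ.m → i ≤ s.mem .pos f 0 →
    s.mem .sup f 0 = Γ.supp (s.mem .pos · 0) i f
  greedy : Γ.Greedy (s.mem .ord · 0) (s.mem .pos · 0) (i - 1)

theorem Peeling.setReg {i c : ℕ} (h : Peeling Γ k out i s) {x : Reg}
    (hx : x ≠ .n ∧ x ≠ .m ∧ x ≠ .k) : Peeling Γ k out i (s.setReg x c) :=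
  ⟨h.top.congr (by simp [hx.1.symm]) (by simp [hx.2.1.symm]) (by simp [hx.2.2.symm]) h.top.used
    h.top.output rfl h.top.maxDepth, h.graph, h.buckets, h.rank, h.sup, h.greedy⟩

/-- The boundary of the bucket of the edge at position `i` is at most `i`, hence at most every later
position; so all later edges have at least its support. -/
theorem Peeling.greedy_self {i : ℕ} (h : Peeling Γ k out i s) (hi : 1 ≤ i) (hi' : i ≤ Γ.m) :
    Γ.Greedy (s.mem .ord · 0) (s.mem .pos · 0) i := by
  intro j hj hj' e he he' hje
  beta_reduce at hje ⊢
  rcases (show j = i ∨ j ≤ i - 1 by omega) with rfl | hj''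
  · have h₁ := h.buckets.isOrdering.edge_rank j hi hi'
    have h₂ := h.buckets.isOrdering.rank_edge e he he'
    have h₃ := h.sup _ h₁.1 h₁.2.1 h₁.2.2.ge
    have h₄ := h.sup e he he' hje
    have h₅ := NumGraph.supp_lt (ρ := (s.mem .pos · 0)) (i := j) (e := s.mem .ord j 0)
        (by have := h.buckets.isOrdering.rank_zero; omega) h₁.1 h₁.2.1
    have h₆ := h.buckets.start (s.mem .sup (s.mem .ord j 0) 0) (by omega) j (by omega) hi'
    have h₇ := h.buckets.start (s.mem .sup (s.mem .ord j 0) 0) (by omega) (s.mem .pos e 0)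
      (by omega) h₂.2.1
    rw [h₂.2.2] at h₇
    omega
  · exact h.greedy j hj hj'' e he he' hje

theorem runs_peelRound {i : ℕ} (h : Peeling Γ k out i s) (hi : s.reg .i = i) (hi₁ : 1 ≤ i)
    (hi₂ : i ≤ Γ.m) :
    Runs P (block [
      .set .e (rd .ord (.var .i)), wr .rank (.var .e) (.var .i), loadEnds,
      loop .j 0 (rd .deg (.var .u)) [
        .set .w (.get .adj (.var .u) (.var .j)), .set .f (.get .edge (.var .u) (.var .w)),
        .set .x (.get .edge (.var .v) (.var .w)),
        when (.and (.lt 0 (.var .x))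
            (.and (.eq (rd .rank (.var .f)) 0) (.eq (rd .rank (.var .x)) 0)))
          [decrease .f, decrease .x]]]) s (60 + Γ.minDeg (s.mem .ord i 0) * 200) fun s' =>
      s'.reg .i = i ∧ Peeling Γ k out (i + 1) s' ∧
      ∀ p ≤ i, s'.mem .ord p 0 = s.mem .ord p 0 := by
  have hO := h.buckets.isOrdering
  have he := hO.edge_rank i hi₁ hi₂
  refine .take (t₁ := 11 + Γ.minDeg (s.mem .ord i 0) * 200) 3 ?_ rfl
    (Nat.le_trans (Nat.add_le_add_right (show _ ≤ 49 by decide) _) (by omega))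
  refine .set (s.mem .ord i 0) (by simp [hi]) ?_
  refine .store (s.mem .ord i 0) 0 i (by simp) rfl (by simp [hi]) ?_
  have hg : HasGraph Γ ((s.setReg .e (s.mem .ord i 0)).setMem .rank (s.mem .ord i 0) 0 i).mem := by
    refine h.graph.congr fun t ht => ?_
    simp only [List.mem_cons, List.not_mem_nil, or_false] at ht
    rcases ht with rfl | rfl | rfl | rfl | rfl <;> simp
  refine .cons (eff_loadEnds hg (by simp) he.1 he.2.1 fun u v hE hdeg => .nil ?_)
  refine .cons (t₁ := 10 + Γ.deg u * 200) (t₂ := 1) ?_ (by rw [hdeg]; omega)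
  refine runs_removeEdge (k := k) (out := out) (i := i) (u := u) (v := v) rfl ?_ ?_ ?_ (by simp [hi]) hi₁
    (by simp)
    (by simp) ?_ ?_ ?_
  · refine ⟨h.top.congr (by simp) (by simp) (by simp) ?_ h.top.output rfl h.top.maxDepth,
      fun _ _ _ _ _ => rfl, ⟨by simpa using hO, fun c hc p hp hp' => ?_⟩, fun _ _ => rfl,
      fun _ => .inl rfl⟩
    · simp only [setMem_used, setReg_used, Finset.insert_subset_iff]
      exact ⟨Γ.mem_cells (by decide) (by omega), h.top.used⟩
    · simpa using h.buckets.start c hc p (by omega) hp'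
  · exact hg
  · intro f hf
    simp [h.rank f hf]
    have h₀ := hO.rank_zero
    by_cases hfi : f = s.mem .ord i 0
    · subst hfi
      simp [he]
    · have : s.mem .pos f 0 ≠ i := by
        intro h'
        rcases Nat.eq_zero_or_pos f with rfl | hf'
        · omega
        · have := hO.rank_edge f hf' hf
          rw [h'] at this
          exact hfi this.2.2.symm
      simp [hfi]
      split_ifs <;> omega
  · simp [hE, he]
  · intro f hf hf'
    simp
    intro hif
    exact h.sup f hf hf' hif.le
  · intro s' hR hi' hsup
    have hmem : ∀ t, t ≠ .ord → t ≠ .pos → t ≠ .start → t ≠ .sup → t ≠ .rank →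
        s'.mem t = s.mem t := by
      intro t h₁ h₂ h₃ h₄ h₅
      rw [hR.mem t h₁ h₂ h₃ h₄]
      simp [h₅]
    have hpos := hR.pos
    have hord := hR.ord
    simp only [setReg_mem, setMem_mem_ne, ne_eq, reduceCtorEq, not_false_eq_true] at hsup hpos hord
    -- Exchanges take place beyond position `i` only, so the remaining graphs at the thresholds up
    -- to `i + 1` are the same before and after.
    have hcongr : ∀ j ≤ i + 1, ∀ f ≤ Γ.m, j ≤ s'.mem .pos f 0 ↔ j ≤ s.mem .pos f 0 := by
      intro j hj f _
      have := hpos f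
      omega
    refine .nil ⟨hi', ⟨hR.top, h.graph.congr fun t ht => ?_, hR.buckets, ?_, ?_, ?_⟩, hord⟩ le_rfl
    · simp only [List.mem_cons, List.not_mem_nil, or_false] at ht
      rcases ht with rfl | rfl | rfl | rfl | rfl <;>
        exact hmem _ (by decide) (by decide) (by decide) (by decide) (by decide)
    · intro f hf
      rw [hR.mem .rank (by decide) (by decide) (by decide) (by decide)]
      simp [h.rank f hf]
      have h₀ := hO.rank_zero
      have h₁ := hpos f
      by_cases hfi : f = s.mem .ord i 0
      · subst hfi
        simp only [he, if_true] at h₁ ⊢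
        have : s'.mem .pos (s.mem .ord i 0) 0 = i := by omega
        simp [this]
      · have : s.mem .pos f 0 ≠ i := by
          intro h'
          rcases Nat.eq_zero_or_pos f with rfl | hf'
          · omega
          · have := hO.rank_edge f hf' hf
            rw [h'] at this
            exact hfi this.2.2.symm
        simp only [hfi, if_false]
        split_ifs <;> omega
    · intro f hf hf' hif
      rw [hsup f hf hf' (((hcongr (i + 1) le_rfl f hf').1 hif)),
        Γ.supp_congr (hcongr (i + 1) le_rfl)]
    · exact (h.greedy_self hi₁ hi₂).congr (fun p _ hp => hord p hp)
        fun j hj f hf => hcongr j (by omega) f hf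

/-- The cost of a round depends on the edge found at position `i` at that moment, which calls for
the rule with elapsed time. Entries up to `i` are final, so in the end the sum over positions
becomes the sum of `minDeg` over the edges. -/
theorem runs_peel (ht : TopLevel Γ k out s) (hg : HasGraph Γ s.mem) (hB : Buckets Γ 0 s.mem)
    (hrank : ∀ e, s.mem .rank e 0 = 0)
    (hsup : ∀ e, 1 ≤ e → e ≤ Γ.m → s.mem .sup e 0 = initSupp Γ e) :
    Runs P peel s (10 + Γ.m * 70 + 200 * ∑ e ∈ Finset.Icc 1 Γ.m, Γ.minDeg e) fun s' =>
      TopLevel Γ k out s' ∧ HasGraph Γ s'.mem ∧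
      Γ.IsOrdering (s'.mem .ord · 0) (s'.mem .rank · 0) ∧
      Γ.Greedy (s'.mem .ord · 0) (s'.mem .rank · 0) Γ.m := by
  refine .loop_elapsed (lov := 1) (hiv := Γ.m + 1) (fun i g s' => s'.reg .i = i ∧
      Peeling Γ k out i s' ∧
      g ≤ 2 + ∑ p ∈ Finset.Ico 1 i, (Γ.minDeg (s'.mem .ord p 0) * 200 + 70))
    rfl (by omega) ?_ ?_ ?_ ?_
  · refine ⟨rfl, Peeling.setReg ⟨ht, hg, hB, ?_, ?_, ?_⟩ (by decide), by simp [Expr.cost]⟩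
    · intro f _
      rw [hrank]
      split_ifs <;> omega
    · intro f hf hf' _
      rw [hsup f hf hf', initSupp]
      refine Γ.supp_congr fun e he => ?_
      have h₀ := hB.isOrdering.rank_zero
      rcases Nat.eq_zero_or_pos e with rfl | he'
      · simp only [id, h₀]
      · have := hB.isOrdering.rank_edge e he' he
        simp only [id]
        omega
    · intro i hi hi'
      omega
  · rintro i g s' ⟨h₁, h₂, -⟩
    exact ⟨h₁, by simp [h₂.top.m]⟩
  · rintro i g s' hi₁ hi₂ ⟨h₁, h₂, h₃⟩
    refine ⟨_, (runs_peelRound h₂ h₁ hi₁ (by omega)).mono le_rfl ?_⟩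
    rintro s'' ⟨h₄, h₅, h₆⟩
    refine ⟨h₄, by simp, h₅.setReg (by decide), ?_⟩
    rw [Finset.sum_Ico_succ_top hi₁]
    simp only [setReg_mem, h₆ i le_rfl]
    rw [Finset.sum_congr rfl fun p hp => by rw [h₆ p (by simp at hp; omega)]]
    have : (Expr.var Reg.m + 1 : Expr Reg Tab).cost = 3 := rfl
    omega
  · rintro g s' ⟨h₁, h₂, h₃⟩
    have hO := h₂.buckets.isOrdering
    have hrank : ∀ e ≤ Γ.m, s'.mem .rank e 0 = s'.mem .pos e 0 := by
      intro e he
      rw [h₂.rank e he, if_pos]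
      rcases Nat.eq_zero_or_pos e with rfl | he'
      · have := hO.rank_zero
        omega
      · have := hO.rank_edge e he' he
        omega
    refine ⟨?_, h₂.top, h₂.graph, ⟨?_, ?_, ?_⟩, ?_⟩
    · rw [hO.sum_comp (fun e => Γ.minDeg e * 200 + 70), Finset.sum_add_distrib,
        ← Finset.sum_mul] at h₃
      simp only [Finset.sum_const, Nat.card_Icc, smul_eq_mul] at h₃
      have : (Expr.var Reg.m + 1 : Expr Reg Tab).cost = 3 := rfl
      simp only [Nat.add_sub_cancel] at h₃
      omega
    · rw [hrank 0 (by omega)]; exact hO.rank_zero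
    · intro e he he'
      rw [hrank e he']; exact hO.rank_edge e he he'
    · intro p hp hp'
      have := hO.edge_rank p hp hp'
      rw [hrank _ this.2.1]; exact this
    · refine NumGraph.Greedy.congr h₂.greedy (fun _ _ _ => rfl) fun i _ e he => ?_
      rw [hrank e he]

end EBBkCT

/-! ### The cliques listed by the recursive procedure -/

namespace EBBkCT

namespace NumGraph

variable (Γ : NumGraph) (ρ : ℕ → ℕ)

/-- The vertices of the instance produced by branching at `e`. -/
def childV (V : List ℕ) (e : ℕ) : List ℕ :=
  V.filter fun w => decide (ρ e < ρ (Γ.E (Γ.a e) w) ∧ ρ e < ρ (Γ.E (Γ.b e) w))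

/-- The edges of rank greater than that of `e` with both ends in `V'`. -/
def childE (V' Es : List ℕ) (e : ℕ) : List ℕ :=
  Es.filter fun f => decide (ρ e < ρ f ∧ Γ.a f ∈ V' ∧ Γ.b f ∈ V')

/-- The vertex sequences that are printed, without the vertices chosen so far, for an instance with
the vertices `V` and the edges `Es`. -/
def cliqueLists : ℕ → List ℕ → List ℕ → List (List ℕ)
  | 0, _, _ => []
  | 1, V, _ => V.map fun w => [w]
  | 2, V, Es => if V.length < 2 then [] else Es.map fun f => [Γ.a f, Γ.b f]
  | l + 3, V, Es => if V.length < l + 3 then [] else Es.flatMap fun e =>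
      (cliqueLists (l + 1) (Γ.childV ρ V e) (Γ.childE ρ (Γ.childV ρ V e) Es e)).map
        fun q => Γ.a e :: Γ.b e :: q

/-- The time taken by the loops over the vertices and the edges of the top-level instance, of which
there are `nv` and `ne`, in a branch with parameter `l`. -/
def loopCost (nv ne l : ℕ) : ℕ := 1 + nv + if 2 ≤ l then ne else 0

/-- A bound on the time taken by a call, up to a constant factor. -/
def listCost (k nv ne : ℕ) : ℕ → List ℕ → List ℕ → ℕ
  | 0, _, _ => 0
  | 1, V, _ => loopCost nv ne 1 + k * V.length
  | 2, _, Es => loopCost nv ne 2 + k * Es.length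
  | l + 3, V, Es => loopCost nv ne 2 + (Es.map fun e => loopCost nv ne (l + 1) +
      listCost k nv ne (l + 1) (Γ.childV ρ V e) (Γ.childE ρ (Γ.childV ρ V e) Es e)).sum

/-- The cliques with `s` vertices, all in `V`, and edges of rank greater than `r`. -/
def cliques (r : ℕ) (V : List ℕ) (s : ℕ) : Finset (Finset ℕ) :=
  (V.toFinset.powersetCard s).filter fun K => ∀ x ∈ K, ∀ y ∈ K, x ≠ y → r < ρ (Γ.E x y)

variable {Γ ρ} {r s e f : ℕ} {V Es : List ℕ} {K : Finset ℕ} {o : ℕ → ℕ}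

theorem mem_cliques : K ∈ Γ.cliques ρ r V s ↔
    (∀ x ∈ K, x ∈ V) ∧ K.card = s ∧ ∀ x ∈ K, ∀ y ∈ K, x ≠ y → r < ρ (Γ.E x y) := by
  simp only [cliques, Finset.mem_filter, Finset.mem_powersetCard, Finset.subset_iff,
    List.mem_toFinset, and_assoc]

variable (Γ ρ) in
/-- `V` and `Es` list the vertices, and the edges of rank greater than `r` between them. -/
structure IsInstance (r : ℕ) (V Es : List ℕ) : Prop where
  nodup_vertices : V.Nodup
  nodup_edges : Es.Nodup
  mem_edges : ∀ f, f ∈ Es ↔ (1 ≤ f ∧ f ≤ Γ.m) ∧ r < ρ f ∧ Γ.a f ∈ V ∧ Γ.b f ∈ V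

theorem mem_childV {w : ℕ} : w ∈ Γ.childV ρ V e ↔
    w ∈ V ∧ ρ e < ρ (Γ.E (Γ.a e) w) ∧ ρ e < ρ (Γ.E (Γ.b e) w) := by
  simp [childV]

theorem mem_childE {V' : List ℕ} : f ∈ Γ.childE ρ V' Es e ↔
    f ∈ Es ∧ ρ e < ρ f ∧ Γ.a f ∈ V' ∧ Γ.b f ∈ V' := by
  simp [childE]

theorem IsInstance.child (h : Γ.IsInstance ρ r V Es) (he : e ∈ Es) :
    Γ.IsInstance ρ (ρ e) (Γ.childV ρ V e) (Γ.childE ρ (Γ.childV ρ V e) Es e) := by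
  refine ⟨h.nodup_vertices.filter _, h.nodup_edges.filter _, fun f => ?_⟩
  have h₁ := ((h.mem_edges e).1 he).2.1
  rw [mem_childE, h.mem_edges]
  constructor
  · rintro ⟨⟨h₂, -⟩, h₃⟩
    exact ⟨h₂, h₃⟩
  · rintro ⟨h₂, h₃, h₄, h₅⟩
    exact ⟨⟨h₂, by omega, (mem_childV.1 h₄).1, (mem_childV.1 h₅).1⟩, h₃, h₄, h₅⟩

/-- A loop has the number `0`, and its rank `0` exceeds no rank. -/
theorem IsOrdering.ends_notMem_childV (hO : Γ.IsOrdering o ρ) :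
    Γ.a e ∉ Γ.childV ρ V e ∧ Γ.b e ∉ Γ.childV ρ V e := by
  constructor <;> intro h <;> have := mem_childV.1 h <;>
    simp only [E_self, hO.rank_zero] at this <;> omega

/-- A clique of the child instance together with the ends of `e` is a clique in which `e` has the
smallest rank. -/
theorem IsInstance.clique_of_child (h : Γ.IsInstance ρ r V Es) (he : e ∈ Es)
    (hK : K ∈ Γ.cliques ρ (ρ e) (Γ.childV ρ V e) s) (hO : Γ.IsOrdering o ρ) :
    (Γ.a e ∉ K ∧ Γ.b e ∉ K) ∧
      insert (Γ.a e) (insert (Γ.b e) K) ∈ Γ.cliques ρ r V (s + 2) ∧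
      ∀ x ∈ insert (Γ.a e) (insert (Γ.b e) K), ∀ y ∈ insert (Γ.a e) (insert (Γ.b e) K),
        x ≠ y → ρ e ≤ ρ (Γ.E x y) := by
  obtain ⟨⟨he₁, he₂⟩, hr, ha, hb⟩ := (h.mem_edges e).1 he
  obtain ⟨hK₁, hK₂, hK₃⟩ := mem_cliques.1 hK
  have hE := Γ.E_ab he₁ he₂
  have hab := Γ.a_ne_b e he₁ he₂
  have hnot := hO.ends_notMem_childV (e := e) (V := V)
  have haK : Γ.a e ∉ K := fun h => hnot.1 (hK₁ _ h)
  have hbK : Γ.b e ∉ K := fun h => hnot.2 (hK₁ _ h)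
  have hmin : ∀ x ∈ insert (Γ.a e) (insert (Γ.b e) K),
      ∀ y ∈ insert (Γ.a e) (insert (Γ.b e) K), x ≠ y → ρ e ≤ ρ (Γ.E x y) := by
    intro x hx y hy hxy
    simp only [Finset.mem_insert] at hx hy
    rcases hx with rfl | rfl | hx <;> rcases hy with rfl | rfl | hy
    · exact absurd rfl hxy
    · rw [hE]
    · exact (mem_childV.1 (hK₁ _ hy)).2.1.le
    · rw [Γ.E_comm, hE]
    · exact absurd rfl hxy
    · exact (mem_childV.1 (hK₁ _ hy)).2.2.le
    · rw [Γ.E_comm]; exact (mem_childV.1 (hK₁ _ hx)).2.1.le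
    · rw [Γ.E_comm]; exact (mem_childV.1 (hK₁ _ hx)).2.2.le
    · exact (hK₃ x hx y hy hxy).le
  refine ⟨⟨haK, hbK⟩, mem_cliques.2 ⟨?_, ?_, fun x hx y hy hxy => ?_⟩, hmin⟩
  · intro x hx
    simp only [Finset.mem_insert] at hx
    rcases hx with rfl | rfl | hx
    · exact ha
    · exact hb
    · exact (mem_childV.1 (hK₁ _ hx)).1
  · rw [Finset.card_insert_of_notMem, Finset.card_insert_of_notMem hbK, hK₂]
    simp [hab, haK]
  · have := hmin x hx y hy hxy
    omega

/-- The branch is the edge of smallest rank of the clique. Ranks being distinct, all its other edges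
have strictly larger rank, so the other vertices survive in the child instance. -/
theorem IsInstance.child_of_clique (h : Γ.IsInstance ρ r V Es)
    (hK : K ∈ Γ.cliques ρ r V (s + 2)) (hO : Γ.IsOrdering o ρ) :
    ∃ e ∈ Es, ∃ K' ∈ Γ.cliques ρ (ρ e) (Γ.childV ρ V e) s,
      insert (Γ.a e) (insert (Γ.b e) K') = K := by
  obtain ⟨hK₁, hK₂, hK₃⟩ := mem_cliques.1 hK
  have hne : K.offDiag.Nonempty := by
    obtain ⟨x, hx, y, hy, hxy⟩ := Finset.one_lt_card.1 (by omega : 1 < K.card)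
    exact ⟨(x, y), Finset.mem_offDiag.2 ⟨hx, hy, hxy⟩⟩
  obtain ⟨⟨x, y⟩, hxy, hmin⟩ := Finset.exists_min_image K.offDiag (fun p => ρ (Γ.E p.1 p.2)) hne
  obtain ⟨hx, hy, hxy⟩ := Finset.mem_offDiag.1 hxy
  dsimp only at hx hy hxy hmin
  have hr := hK₃ x hx y hy hxy
  have hE := hO.E_ne_zero (u := x) (v := y) (by omega)
  have hends := Γ.ends_of_E_ne_zero hE
  obtain ⟨e, he⟩ : ∃ e, e = Γ.E x y := ⟨_, rfl⟩
  rw [← he] at hends hr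
  have he₁ : 1 ≤ e ∧ e ≤ Γ.m := ⟨by omega, by rw [he]; exact Γ.E_le x y⟩
  have hab := Γ.a_ne_b e he₁.1 he₁.2
  have hab' := Γ.E_ab he₁.1 he₁.2
  have ha : Γ.a e ∈ K := by rcases hends with h | h <;> rw [h.1] <;> assumption
  have hb : Γ.b e ∈ K := by rcases hends with h | h <;> rw [h.2] <;> assumption
  have hlt : ∀ x' ∈ K, ∀ y' ∈ K, x' ≠ y' → (x' ≠ Γ.a e ∧ x' ≠ Γ.b e ∨ y' ≠ Γ.a e ∧ y' ≠ Γ.b e) →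
      ρ e < ρ (Γ.E x' y') := by
    intro x' hx' y' hy' hxy' hne
    have h₁ := hmin (x', y') (Finset.mem_offDiag.2 ⟨hx', hy', hxy'⟩)
    dsimp only at h₁
    rw [← he] at h₁
    refine lt_of_le_of_ne h₁ fun h₂ => ?_
    have h₃ := hK₃ x' hx' y' hy' hxy'
    have h₄ := hO.E_ne_zero (u := x') (v := y') (by omega)
    have h₅ := hO.rank_inj he₁ ⟨by omega, Γ.E_le x' y'⟩ h₂
    have h₆ := Γ.ends_of_E_ne_zero h₄
    rw [← h₅] at h₆
    omega
  refine ⟨e, (h.mem_edges e).2 ⟨he₁, hr, hK₁ _ ha, hK₁ _ hb⟩, (K.erase (Γ.a e)).erase (Γ.b e),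
    mem_cliques.2 ⟨fun w hw => ?_, ?_, fun x' hx' y' hy' hxy' => ?_⟩, ?_⟩
  · simp only [Finset.mem_erase] at hw
    exact mem_childV.2 ⟨hK₁ _ hw.2.2, hlt _ ha _ hw.2.2 (Ne.symm hw.2.1) (.inr ⟨hw.2.1, hw.1⟩),
      hlt _ hb _ hw.2.2 (Ne.symm hw.1) (.inr ⟨hw.2.1, hw.1⟩)⟩
  · rw [Finset.card_erase_of_mem, Finset.card_erase_of_mem ha, hK₂]
    · omega
    · simp [hab.symm, hb]
  · simp only [Finset.mem_erase] at hx' hy'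
    exact hlt x' hx'.2.2 y' hy'.2.2 hxy' (.inl ⟨hx'.2.1, hx'.1⟩)
  · rw [Finset.insert_comm, Finset.insert_comm, Finset.insert_erase, Finset.insert_erase ha]
    simp [hab.symm, hb]

/-- The edge of smallest rank of a clique determines the branch in which it is found. -/
theorem IsInstance.child_unique (h : Γ.IsInstance ρ r V Es) (hO : Γ.IsOrdering o ρ)
    {e₁ e₂ : ℕ} {K₁ K₂ : Finset ℕ} (he₁ : e₁ ∈ Es) (he₂ : e₂ ∈ Es)
    (hK₁ : K₁ ∈ Γ.cliques ρ (ρ e₁) (Γ.childV ρ V e₁) s)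
    (hK₂ : K₂ ∈ Γ.cliques ρ (ρ e₂) (Γ.childV ρ V e₂) s)
    (heq : insert (Γ.a e₁) (insert (Γ.b e₁) K₁) = insert (Γ.a e₂) (insert (Γ.b e₂) K₂)) :
    e₁ = e₂ ∧ K₁ = K₂ := by
  obtain ⟨hn₁, -, hm₁⟩ := h.clique_of_child he₁ hK₁ hO
  obtain ⟨hn₂, -, hm₂⟩ := h.clique_of_child he₂ hK₂ hO
  have hr₁ := ((h.mem_edges _).1 he₁).1
  have hr₂ := ((h.mem_edges _).1 he₂).1
  have h₁ := hm₁ (Γ.a e₂) (by rw [heq]; simp) (Γ.b e₂) (by rw [heq]; simp)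
    (Γ.a_ne_b _ hr₂.1 hr₂.2)
  have h₂ := hm₂ (Γ.a e₁) (by rw [← heq]; simp) (Γ.b e₁) (by rw [← heq]; simp)
    (Γ.a_ne_b _ hr₁.1 hr₁.2)
  rw [Γ.E_ab hr₂.1 hr₂.2] at h₁
  rw [Γ.E_ab hr₁.1 hr₁.2] at h₂
  obtain rfl := hO.rank_inj hr₁ hr₂ (by omega)
  refine ⟨rfl, ?_⟩
  have hab := Γ.a_ne_b _ hr₁.1 hr₁.2
  ext x
  have := Finset.ext_iff.1 heq x
  simp only [Finset.mem_insert] at this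
  by_cases hxa : x = Γ.a e₁
  · subst hxa; simp [hn₁, hn₂]
  · by_cases hxb : x = Γ.b e₁
    · subst hxb; simp [hn₁, hn₂]
    · simpa [hxa, hxb] using this

theorem cliques_eq_empty (h : V.length < s) : Γ.cliques ρ r V s = ∅ := by
  ext K
  simp only [mem_cliques, Finset.notMem_empty, iff_false]
  rintro ⟨h₁, h₂, -⟩
  have := Finset.card_le_card (fun x hx => List.mem_toFinset.2 (h₁ x hx) : K ⊆ V.toFinset)
  have := V.toFinset_card_le
  omega

/-- The procedure lists every clique exactly once. -/
theorem cliqueLists_spec (hO : Γ.IsOrdering o ρ) : ∀ {l r : ℕ} {V Es : List ℕ}, 1 ≤ l →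
    Γ.IsInstance ρ r V Es →
    (∀ q ∈ Γ.cliqueLists ρ l V Es, q.length = l) ∧
    (∀ K, K ∈ (Γ.cliqueLists ρ l V Es).map List.toFinset ↔ K ∈ Γ.cliques ρ r V l) ∧
    ((Γ.cliqueLists ρ l V Es).map List.toFinset).Nodup
  | 0, _, _, _, h, _ => by omega
  | 1, r, V, Es, _, hI => by
    refine ⟨by simp [cliqueLists], fun K => ?_, ?_⟩
    · simp only [cliqueLists, List.map_map, List.mem_map, Function.comp, mem_cliques,
        Finset.card_eq_one]
      constructor
      · rintro ⟨w, hw, rfl⟩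
        exact ⟨by simp [hw], ⟨w, by simp⟩, by simp⟩
      · rintro ⟨h₁, ⟨w, rfl⟩, h₃⟩
        exact ⟨w, by simpa using h₁, by simp⟩
    · simp only [cliqueLists, List.map_map]
      exact hI.nodup_vertices.map fun w w' h => by simpa using h
  | 2, r, V, Es, _, hI => by
    by_cases hV : V.length < 2
    · simp [cliqueLists, hV, cliques_eq_empty hV]
    have hmem : ∀ f ∈ Es, 1 ≤ f ∧ f ≤ Γ.m := fun f hf => ((hI.mem_edges f).1 hf).1
    refine ⟨by simp [cliqueLists, hV], fun K => ?_, ?_⟩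
    · simp only [cliqueLists, hV, if_false, List.map_map, List.mem_map, Function.comp, mem_cliques,
        Finset.card_eq_two]
      constructor
      · rintro ⟨f, hf, rfl⟩
        obtain ⟨⟨h₁, h₂⟩, h₃, h₄, h₅⟩ := (hI.mem_edges f).1 hf
        refine ⟨by simp [h₄, h₅], ⟨_, _, Γ.a_ne_b f h₁ h₂, by simp⟩, ?_⟩
        simp [Γ.E_ab h₁ h₂, Γ.E_comm (Γ.b f) (Γ.a f), h₃]
      · rintro ⟨h₁, ⟨x, y, hxy, rfl⟩, h₃⟩
        have h₄ := h₃ x (by simp) y (by simp) hxy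
        have h₅ := hO.E_ne_zero (u := x) (v := y) (by omega)
        have hx := h₁ x (by simp)
        have hy := h₁ y (by simp)
        have h₆ := Γ.ends_of_E_ne_zero h₅
        refine ⟨Γ.E x y, (hI.mem_edges _).2 ⟨⟨by omega, Γ.E_le x y⟩, h₄, ?_⟩, ?_⟩
        · rcases h₆ with h | h <;> rw [h.1, h.2]
          exacts [⟨hx, hy⟩, ⟨hy, hx⟩]
        · rcases h₆ with h | h <;> rw [h.1, h.2] <;> simp [Finset.pair_comm]
    · simp only [cliqueLists, hV, if_false, List.map_map]
      refine hI.nodup_edges.map_on fun f hf g hg hfg => ?_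
      simp only [Function.comp, List.toFinset_cons, List.toFinset_nil,
        LawfulSingleton.insert_empty_eq] at hfg
      have h₁ := Γ.E_ab (hmem f hf).1 (hmem f hf).2
      have h₂ := Γ.a_ne_b f (hmem f hf).1 (hmem f hf).2
      have h₃ := Finset.ext_iff.1 hfg (Γ.a f)
      have h₄ := Finset.ext_iff.1 hfg (Γ.b f)
      simp only [Finset.mem_insert, Finset.mem_singleton, true_or, or_true, true_iff] at h₃ h₄
      have h₅ := Γ.E_ab (hmem g hg).1 (hmem g hg).2
      rcases h₃ with h₃ | h₃ <;> rcases h₄ with h₄ | h₄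
      · omega
      · rw [← h₁, ← h₅, h₃, h₄]
      · rw [← h₁, ← h₅, h₃, h₄, Γ.E_comm]
      · omega
  | l + 3, r, V, Es, _, hI => by
    by_cases hV : V.length < l + 3
    · simp [cliqueLists, hV, cliques_eq_empty hV]
    have ih := fun e (he : e ∈ Es) => cliqueLists_spec hO (l := l + 1) (by omega) (hI.child he)
    refine ⟨?_, fun K => ?_, ?_⟩
    · simp only [cliqueLists, hV, if_false, List.mem_flatMap, List.mem_map]
      rintro q ⟨e, he, q', hq', rfl⟩
      simp [(ih e he).1 q' hq']
    · simp only [cliqueLists, hV, if_false, List.mem_flatMap, List.mem_map]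
      constructor
      · rintro ⟨q, ⟨e, he, q', hq', rfl⟩, rfl⟩
        have := ((ih e he).2.1 q'.toFinset).1 (List.mem_map_of_mem hq')
        simpa using (hI.clique_of_child he this hO).2.1
      · intro hK
        obtain ⟨e, he, K', hK', rfl⟩ := hI.child_of_clique (s := l + 1) hK hO
        obtain ⟨q', hq', rfl⟩ := List.mem_map.1 (((ih e he).2.1 K').2 hK')
        exact ⟨_, ⟨e, he, q', hq', rfl⟩, by simp⟩
    · simp only [cliqueLists, hV, if_false, List.map_flatMap, List.map_map, List.nodup_flatMap]
      have hcomp : ∀ e, (List.toFinset ∘ fun q => Γ.a e :: Γ.b e :: q) =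
          (fun K => insert (Γ.a e) (insert (Γ.b e) K)) ∘ List.toFinset := by
        intro e; funext q; simp
      have hmem : ∀ e ∈ Es, ∀ K, K ∈ ((Γ.cliqueLists ρ (l + 1) (Γ.childV ρ V e)
          (Γ.childE ρ (Γ.childV ρ V e) Es e)).map List.toFinset) →
          K ∈ Γ.cliques ρ (ρ e) (Γ.childV ρ V e) (l + 1) := fun e he K => ((ih e he).2.1 K).1
      refine ⟨fun e he => ?_, ?_⟩
      · rw [hcomp, ← List.map_map]
        exact (ih e he).2.2.map_on fun K₁ h₁ K₂ h₂ heq =>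
          (hI.child_unique hO he he (hmem e he _ h₁) (hmem e he _ h₂) heq).2
      · refine hI.nodup_edges.pairwise_of_forall_ne fun e he e' he' hne => ?_
        rw [Function.onFun, List.disjoint_left]
        intro K h₁ h₂
        rw [hcomp, ← List.map_map, List.mem_map] at h₁ h₂
        obtain ⟨K₁, h₁, rfl⟩ := h₁
        obtain ⟨K₂, h₂, heq⟩ := h₂
        exact hne (hI.child_unique hO he he' (hmem e he _ h₁) (hmem e' he' _ h₂) heq.symm).1

/-! ### The number of branches -/

/-- Adding the ends of the branching edge is injective on pairs of an edge and a clique of its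
child, because the edge is recovered as the one of smallest rank. Iterated, this bounds the number
of calls at each depth. -/
theorem IsInstance.sum_cliques_le (h : Γ.IsInstance ρ r V Es) (hO : Γ.IsOrdering o ρ) (s : ℕ) :
    (Es.map fun e => (Γ.cliques ρ (ρ e) (Γ.childV ρ V e) s).card).sum ≤
      (Γ.cliques ρ r V (s + 2)).card := by
  rw [← List.sum_toFinset _ h.nodup_edges, ← Finset.card_sigma]
  refine Finset.card_le_card_of_injOn
    (fun p => insert (Γ.a p.1) (insert (Γ.b p.1) p.2)) ?_ ?_
  · rintro ⟨e, K⟩ hp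
    simp only [Finset.coe_sigma, Set.mem_sigma_iff, Finset.mem_coe, List.mem_toFinset] at hp
    exact (h.clique_of_child hp.1 hp.2 hO).2.1
  · rintro ⟨e, K⟩ hp ⟨e', K'⟩ hp' heq
    simp only [Finset.coe_sigma, Set.mem_sigma_iff, Finset.mem_coe, List.mem_toFinset] at hp hp'
    obtain ⟨rfl, rfl⟩ := h.child_unique hO hp.1 hp'.1 hp.2 hp'.2 heq
    rfl

theorem card_cliques_zero : (Γ.cliques ρ r V 0).card = 1 := by
  rw [Finset.card_eq_one]
  refine ⟨∅, ?_⟩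
  ext K
  simp only [mem_cliques, Finset.card_eq_zero, Finset.mem_singleton]
  constructor
  · exact fun h => h.2.1
  · rintro rfl
    simp

theorem card_cliques_le : (Γ.cliques ρ r V s).card ≤ V.length.choose s := by
  refine (Finset.card_filter_le _ _).trans ?_
  rw [Finset.card_powersetCard]
  exact Nat.choose_le_choose _ V.toFinset_card_le

theorem IsInstance.length_edges_le (h : Γ.IsInstance ρ r V Es) (hO : Γ.IsOrdering o ρ) :
    Es.length ≤ (Γ.cliques ρ r V 2).card := by
  have := h.sum_cliques_le hO 0
  simpa [card_cliques_zero] using this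

theorem length_le_card_cliques (h : V.Nodup) : V.length ≤ (Γ.cliques ρ r V 1).card := by
  rw [← List.toFinset_card_of_nodup h, ← Finset.card_map ⟨_, Finset.singleton_injective⟩]
  refine Finset.card_le_card fun K hK => ?_
  simp only [Finset.mem_map, Function.Embedding.coeFn_mk, List.mem_toFinset] at hK
  obtain ⟨w, hw, rfl⟩ := hK
  simp [mem_cliques, hw]

/-- The calls at depth `j` number at most the cliques with `2j` vertices. Each pays `loopCost`
twice, for the marking done by its caller and for its own scan, whence the factor `2`. The last term
is the printing of the `l`-cliques. -/
theorem listCost_le (hO : Γ.IsOrdering o ρ) (k nv ne : ℕ) : ∀ {l r : ℕ} {V Es : List ℕ}, 1 ≤ l →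
    Γ.IsInstance ρ r V Es →
    loopCost nv ne l + Γ.listCost ρ k nv ne l V Es ≤
      2 * ∑ j ∈ Finset.range ((l + 1) / 2),
        (Γ.cliques ρ r V (2 * j)).card * loopCost nv ne (l - 2 * j) +
      k * (Γ.cliques ρ r V l).card
  | 0, _, _, _, h, _ => by omega
  | 1, r, V, Es, _, hI => by
    have := Nat.mul_le_mul_left k (length_le_card_cliques (Γ := Γ) (ρ := ρ) (r := r)
      hI.nodup_vertices)
    simp [listCost, card_cliques_zero]
    omega
  | 2, r, V, Es, _, hI => by
    have := Nat.mul_le_mul_left k (hI.length_edges_le hO)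
    simp [listCost, card_cliques_zero]
    omega
  | l + 3, r, V, Es, _, hI => by
    have ih := fun e (he : e ∈ Es) => listCost_le hO k nv ne (l := l + 1) (by omega) (hI.child he)
    have h₁ : (l + 3 + 1) / 2 = (l + 1 + 1) / 2 + 1 := by omega
    rw [h₁, Finset.sum_range_succ']
    have h₂ := List.sum_le_sum ih
    have h₃ : (Es.map fun e => 2 * ∑ j ∈ Finset.range ((l + 1 + 1) / 2),
        (Γ.cliques ρ (ρ e) (Γ.childV ρ V e) (2 * j)).card * loopCost nv ne (l + 1 - 2 * j) +
          k * (Γ.cliques ρ (ρ e) (Γ.childV ρ V e) (l + 1)).card).sum ≤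
        2 * ∑ j ∈ Finset.range ((l + 1 + 1) / 2),
          (Γ.cliques ρ r V (2 * (j + 1))).card * loopCost nv ne (l + 3 - 2 * (j + 1)) +
          k * (Γ.cliques ρ r V (l + 3)).card := by
      rw [List.sum_map_add, List.sum_map_mul_left, List.sum_map_mul_left]
      refine Nat.add_le_add (Nat.mul_le_mul_left _ ?_)
        (Nat.mul_le_mul_left _ (hI.sum_cliques_le hO (l + 1)))
      rw [← List.sum_toFinset _ hI.nodup_edges, Finset.sum_comm]
      refine Finset.sum_le_sum fun j _ => ?_
      rw [← Finset.sum_mul, show l + 3 - 2 * (j + 1) = l + 1 - 2 * j by omega]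
      refine Nat.mul_le_mul_right _ ?_
      rw [List.sum_toFinset _ hI.nodup_edges]
      exact hI.sum_cliques_le hO (2 * j)
    have h₄ : loopCost nv ne 2 = loopCost nv ne (l + 3) := by
      simp [loopCost]
    simp only [listCost, mul_zero, card_cliques_zero, one_mul, h₄, Nat.sub_zero]
    omega

/-! ### From clique counts to powers of `v / 2` -/

theorem choose_mul_le (v s : ℕ) : (v.choose s : ℝ) ≤ 2 * ((v : ℝ) / 2) ^ s := by
  have h₂ : (2 : ℝ) ^ s ≤ 2 * (s.factorial : ℝ) := by
    have : 2 ^ s ≤ 2 * s.factorial := by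
      induction s with
      | zero => simp
      | succ s ih =>
        rcases Nat.eq_zero_or_pos s with rfl | hs
        · simp
        · rw [pow_succ, Nat.factorial_succ]
          have := Nat.mul_le_mul_right s.factorial (show 2 ≤ s + 1 by omega)
          omega
    exact_mod_cast this
  refine (Nat.choose_le_pow_div s v).trans ?_
  rw [div_pow, div_le_iff₀ (by positivity)]
  rw [show 2 * ((v : ℝ) ^ s / 2 ^ s) * s.factorial =
    (v : ℝ) ^ s * (2 * s.factorial / 2 ^ s) by ring]
  exact le_mul_of_one_le_right (by positivity) ((one_le_div (by positivity)).2 h₂)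

theorem loopCost_mono {nv ne ne' l : ℕ} (h : ne ≤ ne') : loopCost nv ne l ≤ loopCost nv ne' l := by
  simp only [loopCost]
  split_ifs <;> omega

/-- With `x = v / 2 ≥ 1` the cost is `1 + 2x ≤ 3x` for `i = 1`, and `1 + 2x + 4x² ≤ 7x²` for `i ≥
2`. The bound depends on not scanning edges when `i = 1`. -/
theorem loopCost_le {v i : ℕ} (hv : 2 ≤ v) (hi : 1 ≤ i) :
    (loopCost v (v ^ 2) i : ℝ) ≤ 7 * ((v : ℝ) / 2) ^ i := by
  have hx : (1 : ℝ) ≤ (v : ℝ) / 2 := by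
    rw [le_div_iff₀ two_pos]; exact_mod_cast (by omega : 1 * 2 ≤ v)
  have hv' : (v : ℝ) = 2 * ((v : ℝ) / 2) := by ring
  set x : ℝ := (v : ℝ) / 2
  rcases (show i = 1 ∨ 2 ≤ i by omega) with rfl | hi'
  · simp only [loopCost, pow_one]
    norm_num
    linarith
  · have h₁ : x ^ 2 ≤ x ^ i := pow_le_pow_right₀ hx hi'
    simp only [loopCost, hi', if_true]
    push_cast
    rw [hv']
    nlinarith

/-- The cost of a top-level branch. -/
theorem IsInstance.listCost_le (h : Γ.IsInstance ρ r V Es) (hO : Γ.IsOrdering o ρ) {k l : ℕ}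
    (hl : 1 ≤ l) (hk : k = l + 2) :
    ((loopCost V.length (V.length ^ 2) l + Γ.listCost ρ k V.length Es.length l V Es : ℕ) : ℝ) ≤
      20 + 40 * k * ((V.length : ℝ) / 2) ^ l := by
  have hne : Es.length ≤ V.length ^ 2 :=
    (h.length_edges_le hO).trans (card_cliques_le.trans (Nat.choose_le_pow _ _))
  have h₁ := NumGraph.listCost_le hO k V.length Es.length hl h
  have h₂ : ∑ j ∈ Finset.range ((l + 1) / 2), (Γ.cliques ρ r V (2 * j)).card *
        loopCost V.length Es.length (l - 2 * j) ≤
      ∑ j ∈ Finset.range ((l + 1) / 2), V.length.choose (2 * j) *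
        loopCost V.length (V.length ^ 2) (l - 2 * j) :=
    Finset.sum_le_sum fun j _ => Nat.mul_le_mul card_cliques_le (loopCost_mono hne)
  have h₃ : k * (Γ.cliques ρ r V l).card ≤ k * V.length.choose l :=
    Nat.mul_le_mul_left _ card_cliques_le
  generalize V.length = v at *
  have h₄ : loopCost v (v ^ 2) l + Γ.listCost ρ k v Es.length l V Es ≤ loopCost v (v ^ 2) l +
      2 * ∑ j ∈ Finset.range ((l + 1) / 2), v.choose (2 * j) * loopCost v (v ^ 2) (l - 2 * j) +
      k * v.choose l := by omega
  refine (Nat.cast_le.2 h₄).trans ?_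
  -- For `v ≤ 1` powers of `v / 2` are useless as bounds, but only `j = 0` contributes and
  -- everything is at most a constant.
  rcases Nat.lt_or_ge v 2 with hv | hv
  · have hW : ∀ i, loopCost v (v ^ 2) i ≤ 3 := by
      intro i
      simp only [loopCost]
      have : v ^ 2 ≤ 1 := by interval_cases v <;> simp
      split_ifs <;> omega
    have h₅ : ∑ j ∈ Finset.range ((l + 1) / 2),
        v.choose (2 * j) * loopCost v (v ^ 2) (l - 2 * j) ≤ 3 := by
      refine (Finset.sum_le_sum (g := fun j => if j = 0 then 3 else 0) fun j _ => ?_).trans ?_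
      · split_ifs with hj
        · subst hj; simpa using hW l
        · rw [Nat.choose_eq_zero_of_lt (by omega), zero_mul]
      · rw [Finset.sum_ite_eq']
        split_ifs <;> omega
    have h₆ : k * v.choose l ≤ 3 := by
      rcases (show l = 1 ∨ v < l by omega) with rfl | hl'
      · rw [Nat.choose_one_right, hk]; omega
      · rw [Nat.choose_eq_zero_of_lt hl']; omega
    have h₇ := hW l
    have h₈ : loopCost v (v ^ 2) l +
      2 * ∑ j ∈ Finset.range ((l + 1) / 2), v.choose (2 * j) * loopCost v (v ^ 2) (l - 2 * j) +
      k * v.choose l ≤ 20 := by omega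
    have h₉ : (0 : ℝ) ≤ 40 * k * ((v : ℝ) / 2) ^ l := by positivity
    have : ((loopCost v (v ^ 2) l +
      2 * ∑ j ∈ Finset.range ((l + 1) / 2), v.choose (2 * j) * loopCost v (v ^ 2) (l - 2 * j) +
      k * v.choose l : ℕ) : ℝ) ≤ 20 := by exact_mod_cast h₈
    linarith
  -- Each depth costs at most `2 · 7` times `(v / 2) ^ l`. With the initial `7`, twice at most `k`
  -- depths, and `2k` for printing, the factor is `7 + 28k + 2k ≤ 40k`.
  · have hterm : ∀ j ∈ Finset.range ((l + 1) / 2),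
        ((v.choose (2 * j) : ℝ) * loopCost v (v ^ 2) (l - 2 * j)) ≤ 14 * ((v : ℝ) / 2) ^ l := by
      intro j hj
      rw [Finset.mem_range] at hj
      calc _ ≤ (2 * ((v : ℝ) / 2) ^ (2 * j)) * (7 * ((v : ℝ) / 2) ^ (l - 2 * j)) :=
            mul_le_mul (choose_mul_le v (2 * j)) (loopCost_le hv (by omega)) (by positivity)
              (by positivity)
        _ = 14 * ((v : ℝ) / 2) ^ (2 * j + (l - 2 * j)) := by rw [pow_add]; ring
        _ = _ := by rw [show 2 * j + (l - 2 * j) = l by omega]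
    have h₅ := Finset.sum_le_card_nsmul _ _ _ hterm
    have h₆ := loopCost_le hv hl
    have h₇ := choose_mul_le v l
    rw [Finset.card_range, nsmul_eq_mul] at h₅
    push_cast
    have h₈ : (((l + 1) / 2 : ℕ) : ℝ) ≤ k := by exact_mod_cast (by omega : (l + 1) / 2 ≤ k)
    have h₉ : (1 : ℝ) ≤ k := by exact_mod_cast (by omega : 1 ≤ k)
    have hx : (0 : ℝ) ≤ ((v : ℝ) / 2) ^ l := by positivity
    have h₁₀ := mul_le_mul_of_nonneg_right h₈ (by positivity : 0 ≤ 14 * ((v : ℝ) / 2) ^ l)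
    have h₁₁ := mul_le_mul_of_nonneg_left h₇ (by positivity : (0 : ℝ) ≤ k)
    have h₁₂ := mul_le_mul_of_nonneg_right h₉ hx
    nlinarith

end NumGraph

end EBBkCT

/-! ### The recursive procedure -/

namespace EBBkCT

open RAM

variable {Γ : NumGraph} {k : ℕ} {P : Cmd Reg Tab} {s s' : State Reg Tab} {T : ℕ}
  {Φ : State Reg Tab → Prop}

/-- The rule for loops over a list, in which most of the work is done for the entries with the
property `p`. -/
theorem runs_forList {x : Reg} {hi : Expr Reg Tab} {body : List (Cmd Reg Tab)} (L : List ℕ)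
    (p : ℕ → Prop) [DecidablePred p] (I : List ℕ → State Reg Tab → Prop) (A : ℕ) (cost : ℕ → ℕ)
    (hc : hi.cost ≤ 3) (h0 : I [] (s.setReg x 0))
    (hreg : ∀ D s', I D s' → hi.eval s' = L.length)
    (hstep : ∀ i w L₁ L₂ s', L = L₁ ++ w :: L₂ → i = L₁.length →
      I (L₁.filter fun w => decide (p w)) s' → s'.reg x = i →
      (p w → Runs P (block body) s' (A + cost w) fun s'' => s''.reg x = i ∧
        I ((L₁.filter fun w => decide (p w)) ++ [w]) (s''.setReg x (i + 1))) ∧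
      (¬ p w → Runs P (block body) s' A fun s'' => s''.reg x = i ∧
        I (L₁.filter fun w => decide (p w)) (s''.setReg x (i + 1))))
    (hT : 10 + L.length * (A + 10) + ((L.filter fun w => decide (p w)).map cost).sum ≤ T)
    (hend : ∀ s', I (L.filter fun w => decide (p w)) s' → Φ s') :
    Runs P (loop x 0 hi body) s T Φ := by
  refine .loop_elapsed (lov := 0) (hiv := L.length) (fun i g s' => s'.reg x = i ∧
      I ((L.take i).filter fun w => decide (p w)) s' ∧
      g ≤ 4 + i * (A + 10) + (((L.take i).filter fun w => decide (p w)).map cost).sum)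
    rfl (by omega) ⟨by simp, by simpa using h0, by simp [Expr.cost]⟩
    (fun i g s' h => ⟨h.1, hreg _ _ h.2.1⟩) ?_ ?_
  · rintro i g s' - hi' ⟨h₁, h₂, h₃⟩
    have hL : L = L.take i ++ L[i] :: L.drop (i + 1) := by
      rw [← List.drop_eq_getElem_cons, List.take_append_drop]
    have htake : L.take (i + 1) = L.take i ++ [L[i]] := by
      rw [List.take_add_one, List.getElem?_eq_getElem hi']; rfl
    obtain ⟨h₄, h₅⟩ := hstep i L[i] _ _ s' hL (by simp; omega) h₂ h₁
    by_cases hp : p L[i]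
    · refine ⟨_, (h₄ hp).mono le_rfl fun s'' h => ⟨h.1, by simp, ?_, ?_⟩⟩
      · rw [htake, List.filter_append]
        simpa [hp] using h.2
      · rw [htake, List.filter_append, List.map_append, List.sum_append]
        simp [hp]
        linarith
    · refine ⟨_, (h₅ hp).mono le_rfl fun s'' h => ⟨h.1, by simp, ?_, ?_⟩⟩
      · rw [htake, List.filter_append]
        simpa [hp] using h.2
      · rw [htake, List.filter_append, List.map_append, List.sum_append]
        simp [hp]
        linarith
  · rintro g s' ⟨h₁, h₂, h₃⟩
    rw [List.take_length] at h₂ h₃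
    exact ⟨by omega, hend _ h₂⟩

/-- `s'` arises from `s` by printing `out` and changing the registers in `rs`. -/
structure Printed (rs : List Reg) (out : List ℕ) (s s' : State Reg Tab) : Prop where
  reg : ∀ z ∉ rs, s'.reg z = s.reg z
  mem : s'.mem = s.mem
  used : s'.used = s.used
  output : s'.output = s.output ++ out
  depth : s'.depth = s.depth
  maxDepth : s'.maxDepth = s.maxDepth

theorem Printed.refl (rs : List Reg) (s : State Reg Tab) : Printed rs [] s s :=
  ⟨fun _ _ => rfl, rfl, rfl, by simp, rfl, rfl⟩

theorem Printed.trans {rs : List Reg} {out out' : List ℕ} {s'' : State Reg Tab}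
    (h : Printed rs out s s') (h' : Printed rs out' s' s'') : Printed rs (out ++ out') s s'' :=
  ⟨fun z hz => (h'.reg z hz).trans (h.reg z hz), h'.mem.trans h.mem, h'.used.trans h.used,
    by rw [h'.output, h.output, List.append_assoc], h'.depth.trans h.depth,
    h'.maxDepth.trans h.maxDepth⟩

theorem Printed.setReg {rs : List Reg} {out : List ℕ} {z : Reg} {c : ℕ} (h : Printed rs out s s')
    (hz : z ∈ rs) : Printed rs out s (s'.setReg z c) :=
  ⟨fun z' hz' => by
    rw [setReg_reg, if_neg (by rintro rfl; exact hz' hz)]; exact h.reg z' hz', h.mem, h.used,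
    h.output, h.depth, h.maxDepth⟩

theorem Printed.print {rs : List Reg} {out : List ℕ} {c : ℕ} (h : Printed rs out s s') :
    Printed rs (out ++ [c]) s (s'.print c) :=
  ⟨h.reg, h.mem, h.used, by rw [print_output, h.output, List.append_assoc], h.depth, h.maxDepth⟩

theorem Printed.mono {rs rs' : List Reg} {out : List ℕ} (h : Printed rs out s s')
    (hrs : ∀ z ∈ rs, z ∈ rs') : Printed rs' out s s' :=
  ⟨fun z hz => h.reg z fun h' => hz (hrs z h'), h.mem, h.used, h.output, h.depth, h.maxDepth⟩

/-- The first `h` entries of the table `clique`. -/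
def prefixOf (M : Tab → ℕ → ℕ → ℕ) (h : ℕ) : List ℕ := (List.range h).map fun j => M .clique j 0

theorem runs_printPart {hi : Expr Reg Tab} {h : ℕ} (hc : hi.cost ≤ 3)
    (hhi : ∀ s', (∀ z, z ≠ .j → s'.reg z = s.reg z) → s'.mem = s.mem → hi.eval s' = h) :
    Runs P (printPart hi) s (10 + h * 20) (Printed [.j] (prefixOf s.mem h) s) := by
  refine .loop_const (lov := 0) (hiv := h) (fun i s' => s'.reg .j = i ∧
    Printed [.j] (prefixOf s.mem i) s s') 10 rfl (by omega) ⟨by decide, hc⟩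
    ⟨by simp, (Printed.refl _ s).setReg (by simp)⟩
    (fun i s' h => ⟨h.1, hhi _ (fun z hz => h.2.reg z (by simpa using hz)) h.2.mem⟩) ?_ (by omega)
    fun s' h => h.2
  rintro i s' - hi' ⟨h₁, h₂⟩
  refine .straight rfl (by decide) ?_
  refine (show Eff _ s' _ from ?_ : Eff (block [.out (rd .clique (.var .j))]) s' _)
  show (s'.print _).reg .j = i ∧ _ ∧ _
  refine ⟨h₁, by simp, ?_⟩
  have : prefixOf s.mem (i + 1) = prefixOf s.mem i ++ [(rd .clique (.var .j)).eval s'] := by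
    simp [prefixOf, List.range_succ, h₁, h₂.mem]
  rw [this]
  exact h₂.print.setReg (by simp)

/-- `s'` arises from `s` by changing the table `lev` and the registers in `rs`. -/
structure Relabelled (Γ : NumGraph) (rs : List Reg) (lev : Tab) (s s' : State Reg Tab) : Prop where
  reg : ∀ z ∉ rs, s'.reg z = s.reg z
  mem : ∀ t, t ≠ lev → s'.mem t = s.mem t
  used : s'.used ⊆ Γ.cells
  output : s'.output = s.output
  depth : s'.depth = s.depth
  maxDepth : s'.maxDepth = s.maxDepth

theorem Relabelled.refl {rs : List Reg} {lev : Tab} (h : s.used ⊆ Γ.cells) :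
    Relabelled Γ rs lev s s := ⟨fun _ _ => rfl, fun _ _ => rfl, h, rfl, rfl, rfl⟩

theorem Relabelled.setReg {rs : List Reg} {lev : Tab} {z : Reg} {c : ℕ}
    (h : Relabelled Γ rs lev s s') (hz : z ∈ rs) : Relabelled Γ rs lev s (s'.setReg z c) :=
  ⟨fun z' hz' => by
    rw [setReg_reg, if_neg (by rintro rfl; exact hz' hz)]; exact h.reg z' hz', h.mem, h.used,
    h.output, h.depth, h.maxDepth⟩

theorem Relabelled.setMem {rs : List Reg} {lev : Tab} {i c : ℕ}
    (h : Relabelled Γ rs lev s s') (hc : (lev, i, 0) ∈ Γ.cells) :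
    Relabelled Γ rs lev s (s'.setMem lev i 0 c) :=
  ⟨h.reg, fun t ht => by rw [setMem_mem_ne _ _ _ _ _ ht, h.mem t ht],
    by rw [setMem_used, Finset.insert_subset_iff]; exact ⟨hc, h.used⟩, h.output, h.depth,
    h.maxDepth⟩

/-- The table with the entries at the elements of `D` replaced by `c`. -/
def relabel (D : List ℕ) (c : ℕ) (v : ℕ → ℕ → ℕ) (i j : ℕ) : ℕ := if i ∈ D ∧ j = 0 then c else v i j

theorem relabel_append {D : List ℕ} {c w : ℕ} {v : ℕ → ℕ → ℕ} {lev : Tab}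
    (h : s.mem lev = relabel D c v) : (s.setMem lev w 0 c).mem lev = relabel (D ++ [w]) c v := by
  funext i j
  rw [setMem_mem_self, h]
  simp only [relabel, List.mem_append, List.mem_singleton]
  by_cases h₁ : i ∈ D <;> by_cases h₂ : i = w <;> by_cases h₃ : j = 0 <;> simp [h₁, h₂, h₃]

/-- The loops that undo the marking of a child instance. -/
theorem runs_restore {lst lev : Tab} {r hi : Reg} {L : List ℕ} {d : ℕ}
    (hr : r ≠ .y ∧ r ≠ .d ∧ r ≠ hi ∧ hi ≠ .y) (hlev : lst ≠ lev) (hL : L.Nodup)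
    (hhi : s.reg hi = L.length) (hd : s.reg .d = d)
    (hlst : ∀ x < L.length, s.mem lst x 0 = L[x]?.getD 0) (hu : s.used ⊆ Γ.cells)
    (hcell : ∀ w ∈ L, (lev, w, 0) ∈ Γ.cells) :
    Runs P (loop .y 0 (.var hi) [
        .set r (rd lst (.var .y)),
        when (.eq (rd lev (.var r)) (.add (.var .d) 1)) [wr lev (.var r) (.var .d)]]) s
      (10 + L.length * 40) fun s' => Relabelled Γ [.y, r] lev s s' ∧
        s'.mem lev = relabel (L.filter fun w => decide (s.mem lev w 0 = d + 1)) d (s.mem lev) := by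
  refine runs_forList L (fun w => s.mem lev w 0 = d + 1) (fun D s' =>
    Relabelled Γ [.y, r] lev s s' ∧ s'.mem lev = relabel D d (s.mem lev)) 30 (fun _ => 0)
    (by simp [Expr.cost]) ⟨(Relabelled.refl hu).setReg (by simp), ?_⟩ ?_ ?_ ?_ fun s' h => h
  · funext i j; simp [relabel]
  · rintro D s' ⟨h₁, -⟩
    simp [h₁.reg hi (by simp [hr.2.2.2, hr.2.2.1.symm]), hhi]
  · rintro i w L₁ L₂ s' hL₁ hi' ⟨h₁, h₂⟩ hx
    have hw : w ∉ L₁.filter fun w => decide (s.mem lev w 0 = d + 1) := by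
      rw [hL₁, List.nodup_append] at hL
      intro hw
      exact hL.2.2 w (List.mem_of_mem_filter hw) w (by simp) rfl
    have hlst' : s'.mem lst i 0 = w := by
      rw [h₁.mem _ hlev, hlst i (by rw [hL₁, hi']; simp), hL₁, hi']
      simp
    have hlevw : s'.mem lev w 0 = s.mem lev w 0 := by rw [h₂]; simp only [relabel, hw]; simp
    have hd' : s'.reg .d = d := by rw [h₁.reg _ (by simp [hr.2.1.symm]), hd]
    have hry : (Reg.y = r) = False := by simp [hr.1.symm]
    have hrd : (Reg.d = r) = False := by simp [hr.2.1.symm]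
    constructor
    · intro hp
      refine .straight rfl (by simp [block, Cmd.bound, when, Test.cost, wr, rd, Expr.cost])
        (.set w (by simp [hx, hlst']) (.when (fun _ => ?_) fun h => ?_))
      · refine .store w 0 d (by simp) rfl (by simp [hd', hrd]) (.nil (.nil ?_))
        refine ⟨by simp [hx, hry], ((h₁.setReg (by simp)).setMem (hcell w (by simp [hL₁]))).setReg
          (by simp), relabel_append (by simpa using h₂)⟩
      · simp [hlevw, hp, hd', hrd] at h
    · intro hp
      refine .straight rfl (by simp [block, Cmd.bound, when, Test.cost, wr, rd, Expr.cost])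
        (.set w (by simp [hx, hlst']) (.when (fun h => ?_) fun _ => ?_))
      · simp [hlevw, hp, hd', hrd] at h
      · exact .nil ⟨by simp [hx, hry], (h₁.setReg (by simp)).setReg (by simp), by simpa using h₂⟩
  · simp

end EBBkCT

/-! ### Marking the instance of a branch -/

namespace EBBkCT

open RAM

variable {Γ : NumGraph} {k : ℕ} {P : Cmd Reg Tab} {s s' : State Reg Tab} {T : ℕ}
  {Φ : State Reg Tab → Prop} {ρ : ℕ → ℕ} {VL EL : List ℕ} {d e : ℕ}

/-- As `VL` has no repetitions, an entry is still unchanged when it is inspected, so the set of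
marked vertices can be described by the table before the loop. -/
theorem runs_markVertices (hg : HasGraph Γ s.mem) (hρ : ∀ f, s.mem .rank f 0 = ρ f)
    (hvs : ∀ x < VL.length, s.mem .vs x 0 = VL[x]?.getD 0) (hn : VL.Nodup)
    (hnv : s.reg .nv = VL.length) (hd : s.reg .d = d) (he : s.reg .e = e)
    (hu : s.reg .u = Γ.a e) (hv : s.reg .v = Γ.b e) (hc : s.reg .c = 0) (hus : s.used ⊆ Γ.cells)
    (hcell : ∀ w ∈ VL, (Tab.vlev, w, 0) ∈ Γ.cells) :
    Runs P (loop .y 0 (.var .nv) [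
        .set .w (rd .vs (.var .y)),
        when (.and (.eq (rd .vlev (.var .w)) (.var .d))
            (.and (.lt (rd .rank (.var .e)) (rd .rank (.get .edge (.var .u) (.var .w))))
              (.lt (rd .rank (.var .e)) (rd .rank (.get .edge (.var .v) (.var .w)))))) [
          wr .vlev (.var .w) (.add (.var .d) 1), .set .c (.add (.var .c) 1)]]) s
      (10 + VL.length * 70) fun s' => ∃ V', V' = (VL.filter fun w => decide (s.mem .vlev w 0 = d ∧
          ρ e < ρ (Γ.E (Γ.a e) w) ∧ ρ e < ρ (Γ.E (Γ.b e) w))) ∧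
        Relabelled Γ [.y, .w, .c] .vlev s s' ∧ s'.reg .c = V'.length ∧
        s'.mem .vlev = relabel V' (d + 1) (s.mem .vlev) := by
  refine runs_forList VL (fun w => s.mem .vlev w 0 = d ∧
      ρ e < ρ (Γ.E (Γ.a e) w) ∧ ρ e < ρ (Γ.E (Γ.b e) w)) (fun D s' =>
    Relabelled Γ [.y, .w, .c] .vlev s s' ∧ s'.reg .c = D.length ∧
      s'.mem .vlev = relabel D (d + 1) (s.mem .vlev)) 60 (fun _ => 0)
    (by simp [Expr.cost]) ⟨(Relabelled.refl hus).setReg (by simp), by simp [hc], ?_⟩ ?_ ?_ ?_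
    fun s' h => ⟨_, rfl, h⟩
  · funext i j; simp [relabel]
  · rintro D s' ⟨h₁, -⟩
    simp [h₁.reg .nv (by decide), hnv]
  · rintro i w L₁ L₂ s' hL₁ hi' ⟨h₁, h₂, h₃⟩ hx
    have hw : w ∉ L₁ := by
      rw [hL₁, List.nodup_append] at hn
      exact fun hw => hn.2.2 w hw w (by simp) rfl
    have hlst' : s'.mem .vs i 0 = w := by
      rw [h₁.mem _ (by decide), hvs i (by rw [hL₁, hi']; simp), hL₁, hi']
      simp
    have hlevw : s'.mem .vlev w 0 = s.mem .vlev w 0 := by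
      rw [h₃, relabel, if_neg]
      exact fun h => hw (List.mem_of_mem_filter h.1)
    have hd' : s'.reg .d = d := by rw [h₁.reg _ (by decide), hd]
    have he' : s'.reg .e = e := by rw [h₁.reg _ (by decide), he]
    have hu' : s'.reg .u = Γ.a e := by rw [h₁.reg _ (by decide), hu]
    have hv' : s'.reg .v = Γ.b e := by rw [h₁.reg _ (by decide), hv]
    have hrk : ∀ f, s'.mem .rank f 0 = ρ f := by rw [h₁.mem _ (by decide)]; exact hρ
    have hed : ∀ x y, s'.mem .edge x y = Γ.E x y := by rw [h₁.mem _ (by decide)]; exact hg.edge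
    constructor
    · intro hp
      refine .straight rfl (by decide)
        (.set w (by simp [hx, hlst']) (.when (fun _ => ?_) fun h => ?_))
      · refine .store w 0 (d + 1) (by simp) rfl (by simp [hd']) (.set _ rfl (.nil (.nil ?_)))
        refine ⟨by simp [hx], (((h₁.setReg (by simp)).setMem (hcell w (by simp [hL₁]))).setReg
          (by simp)).setReg (by simp), by simp [h₂], relabel_append (s := s'.setReg .w w) h₃⟩
      · simp [Test.eval, hlevw, hp.1, hd', he', hu', hv', hrk, hed] at h
        exact absurd hp.2.2 (by have := h hp.2.1; omega)
    · intro hp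
      refine .straight rfl (by decide)
        (.set w (by simp [hx, hlst']) (.when (fun h => ?_) fun _ => ?_))
      · simp [Test.eval, hlevw, hd', he', hu', hv', hrk, hed] at h
        exact absurd h hp
      · exact .nil ⟨by simp [hx], (h₁.setReg (by simp)).setReg (by simp), by simpa using h₂,
          by simpa using h₃⟩
  · simp

/-- With the vertices marked beforehand, membership of the ends in the child instance is read off
from their level `d + 1`. -/
theorem runs_markEdges (hg : HasGraph Γ s.mem) (hρ : ∀ f, s.mem .rank f 0 = ρ f)
    (hes : ∀ x < EL.length, s.mem .es x 0 = EL[x]?.getD 0) (hn : EL.Nodup)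
    (hne : s.reg .ne = EL.length) (hd : s.reg .d = d) (he : s.reg .e = e) (hus : s.used ⊆ Γ.cells)
    (hEL : ∀ f ∈ EL, 1 ≤ f ∧ f ≤ Γ.m) (hcell : ∀ w ∈ EL, (Tab.elev, w, 0) ∈ Γ.cells) :
    Runs P (loop .y 0 (.var .ne) [
        .set .f (rd .es (.var .y)),
        when (.and (.and (.eq (rd .elev (.var .f)) (.var .d))
              (.lt (rd .rank (.var .e)) (rd .rank (.var .f))))
            (.and (.eq (rd .vlev (rd .src (.var .f))) (.add (.var .d) 1))
              (.eq (rd .vlev (rd .dst (.var .f))) (.add (.var .d) 1)))) [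
          wr .elev (.var .f) (.add (.var .d) 1)]]) s
      (10 + EL.length * 70) fun s' => ∃ E', E' = (EL.filter fun f => decide (s.mem .elev f 0 = d ∧
          ρ e < ρ f ∧ s.mem .vlev (Γ.a f) 0 = d + 1 ∧ s.mem .vlev (Γ.b f) 0 = d + 1)) ∧
        Relabelled Γ [.y, .f] .elev s s' ∧
        s'.mem .elev = relabel E' (d + 1) (s.mem .elev) := by
  refine runs_forList EL (fun f => s.mem .elev f 0 = d ∧
          ρ e < ρ f ∧ s.mem .vlev (Γ.a f) 0 = d + 1 ∧ s.mem .vlev (Γ.b f) 0 = d + 1) (fun D s' =>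
    Relabelled Γ [.y, .f] .elev s s' ∧
      s'.mem .elev = relabel D (d + 1) (s.mem .elev)) 60 (fun _ => 0)
    (by simp [Expr.cost]) ⟨(Relabelled.refl hus).setReg (by simp), ?_⟩ ?_ ?_ ?_
    fun s' h => ⟨_, rfl, h⟩
  · funext i j; simp [relabel]
  · rintro D s' ⟨h₁, -⟩
    simp [h₁.reg .ne (by decide), hne]
  · rintro i w L₁ L₂ s' hL₁ hi' ⟨h₁, h₃⟩ hx
    have hw : w ∉ L₁ := by
      rw [hL₁, List.nodup_append] at hn
      exact fun hw => hn.2.2 w hw w (by simp) rfl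
    have hlst' : s'.mem .es i 0 = w := by
      rw [h₁.mem _ (by decide), hes i (by rw [hL₁, hi']; simp), hL₁, hi']
      simp
    have hlevw : s'.mem .elev w 0 = s.mem .elev w 0 := by
      rw [h₃, relabel, if_neg]
      exact fun h => hw (List.mem_of_mem_filter h.1)
    have hd' : s'.reg .d = d := by rw [h₁.reg _ (by decide), hd]
    have he' : s'.reg .e = e := by rw [h₁.reg _ (by decide), he]
    have hrk : ∀ f, s'.mem .rank f 0 = ρ f := by rw [h₁.mem _ (by decide)]; exact hρ
    have hvl : s'.mem .vlev = s.mem .vlev := h₁.mem _ (by decide)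
    have hw' := hEL w (by simp [hL₁])
    have hsrc : s'.mem .src w 0 = Γ.a w := by rw [h₁.mem _ (by decide)]; exact hg.src w hw'.1 hw'.2
    have hdst : s'.mem .dst w 0 = Γ.b w := by rw [h₁.mem _ (by decide)]; exact hg.dst w hw'.1 hw'.2
    constructor
    · intro hp
      refine .straight rfl (by decide)
        (.set w (by simp [hx, hlst']) (.when (fun _ => ?_) fun h => ?_))
      · refine .store w 0 (d + 1) (by simp) rfl (by simp [hd']) (.nil (.nil ?_))
        refine ⟨by simp [hx], (((h₁.setReg (by simp)).setMem (hcell w (by simp [hL₁]))).setReg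
          (by simp)), relabel_append (s := s'.setReg .f w) h₃⟩
      · simp [Test.eval, hlevw, hp, hd', he', hrk, hsrc, hdst, hvl] at h
    · intro hp
      refine .straight rfl (by decide)
        (.set w (by simp [hx, hlst']) (.when (fun h => ?_) fun _ => ?_))
      · simp [Test.eval, hlevw, hd', he', hrk, hsrc, hdst, hvl, and_assoc] at h
        exact absurd h hp
      · exact .nil ⟨by simp [hx], (h₁.setReg (by simp)).setReg (by simp), by simpa using h₃⟩
  · simp

/-- Marking the entries with some of the entries `v = d` by `d + 1`. -/
theorem filter_relabel {L D : List ℕ} {v : ℕ → ℕ → ℕ} (hD : ∃ p, D = L.filter p)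
    (hv : ∀ w ∈ L, v w 0 ≤ d) :
    (L.filter fun w => decide (relabel D (d + 1) v w 0 = d + 1)) = D := by
  obtain ⟨p, rfl⟩ := hD
  refine List.filter_congr fun w hw => ?_
  have := hv w hw
  by_cases h : p w <;> simp [relabel, hw, h]
  omega

theorem relabel_relabel {D : List ℕ} {v : ℕ → ℕ → ℕ} (hD : ∀ w ∈ D, v w 0 = d) :
    relabel D d (relabel D (d + 1) v) = v := by
  funext i j
  simp only [relabel]
  split_ifs with h
  · rw [h.2, hD i h.1]
  · rfl

/-- `s'` arises from `s` by printing `out` and changing entries of `clique` from number `h` on, as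
far as the output and the tables are concerned. -/
structure Listed (Γ : NumGraph) (h : ℕ) (out : List ℕ) (s s' : State Reg Tab) : Prop where
  mem : ∀ t, t ≠ .clique → s'.mem t = s.mem t
  clique : ∀ j < h, s'.mem .clique j 0 = s.mem .clique j 0
  used : s'.used ⊆ Γ.cells
  output : s'.output = s.output ++ out
  depth : s'.depth = s.depth
  maxDepth : s'.maxDepth ≤ Γ.n + 1

theorem Printed.listed {rs : List Reg} {out : List ℕ} {h : ℕ} (hp : Printed rs out s s')
    (hu : s.used ⊆ Γ.cells) (hd : s.maxDepth ≤ Γ.n + 1) : Listed Γ h out s s' :=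
  ⟨fun _ _ => by rw [hp.mem], fun _ _ => by rw [hp.mem], by rw [hp.used]; exact hu, hp.output,
    hp.depth, by rw [hp.maxDepth]; exact hd⟩

theorem Listed.prefixOf_eq {h : ℕ} {out : List ℕ} (hl : Listed Γ h out s s') :
    prefixOf s'.mem h = prefixOf s.mem h :=
  List.map_congr_left fun j hj => hl.clique j (List.mem_range.1 hj)

/-- The states in which a branch with the parameter `l` and the instance `V`, `Es` begins, where
`VL` and `EL` list the vertices and edges of the instance of the current top-level branch. -/
structure AtBranch (Γ : NumGraph) (ρ : ℕ → ℕ) (VL EL : List ℕ) (k l r : ℕ) (V Es : List ℕ)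
    (s : State Reg Tab) : Prop where
  graph : HasGraph Γ s.mem
  rank : ∀ f, s.mem .rank f 0 = ρ f
  vs : ∀ x < VL.length, s.mem .vs x 0 = VL[x]?.getD 0
  es : ∀ x < EL.length, s.mem .es x 0 = EL[x]?.getD 0
  nodupV : VL.Nodup
  nodupE : EL.Nodup
  ltV : ∀ w ∈ VL, w < Γ.n
  leE : ∀ f ∈ EL, 1 ≤ f ∧ f ≤ Γ.m
  vlev : ∀ w ∈ VL, s.mem .vlev w 0 ≤ s.reg .d
  elev : ∀ f ∈ EL, s.mem .elev f 0 ≤ s.reg .d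
  vertices : V = VL.filter fun w => decide (s.mem .vlev w 0 = s.reg .d)
  edges : 2 ≤ l → Es = EL.filter fun f => decide (s.mem .elev f 0 = s.reg .d)
  inst : Γ.IsInstance ρ r V Es
  regk : s.reg .k = k
  regl : s.reg .l = l
  regnv : s.reg .nv = VL.length
  regne : s.reg .ne = EL.length
  two_le : l + 2 ≤ k
  used : s.used ⊆ Γ.cells
  depth : s.depth + V.length ≤ Γ.n + 1
  maxDepth : s.maxDepth ≤ Γ.n + 1
  clique : k - l + V.length ≤ Γ.n

end EBBkCT

/-! ### The loops of the recursive procedure -/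

namespace RAM

variable {R A : Type} [DecidableEq R] [DecidableEq A] {P : Cmd R A} {s : State R A}
  {Φ : State R A → Prop} {t t₁ t₂ : ℕ} {b : Test R A} {l l' : List (Cmd R A)}

theorem Eff.out {e : Expr R A} (v : ℕ) (he : e.eval s = v) (h : Eff (block l) (s.print v) Φ) :
    Eff (block (.out e :: l)) s Φ := by
  subst he; exact h

theorem Runs.when_true (hb : b.eval s = true)
    (h : Runs P (block l') s t₁ fun s' => Runs P (block l) s' t₂ Φ)
    (ht : b.cost + 1 + t₁ + t₂ ≤ t) : Runs P (block (when b l' :: l)) s t Φ :=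
  .cons (.ite (fun _ => h) (fun h' => absurd hb h') le_rfl) ht

theorem Runs.when_false (hb : ¬ b.eval s = true) (h : Runs P (block l) s t₂ Φ)
    (ht : b.cost + 2 + t₂ ≤ t) : Runs P (block (when b l' :: l)) s t Φ :=
  .cons (.ite (t₁ := 1) (fun h' => absurd h' hb) (fun _ => .skip h le_rfl) le_rfl) (by omega)

end RAM

namespace EBBkCT

open RAM

variable {Γ : NumGraph} {k : ℕ} {P : Cmd Reg Tab} {s s' : State Reg Tab} {T : ℕ}
  {Φ : State Reg Tab → Prop} {ρ : ℕ → ℕ} {VL EL V Es : List ℕ} {d e r l : ℕ}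

/-- The whole top-level list `VL` is scanned at constant cost per entry; the `O(k)` for printing is
paid only for the vertices of the instance `V`. -/
theorem runs_listVertices (h : AtBranch Γ ρ VL EL k 1 r V Es s) :
    Runs P (loop .x 0 (.var .nv) [
      when (.eq (rd .vlev (rd .vs (.var .x))) (.var .d)) [printPart (.sub (.var .k) 1),
        .out (rd .vs (.var .x))]]) s (10 + VL.length * 40 + V.length * (20 + k * 20))
      (Listed Γ (k - 1) ((V.map fun w => [w]).flatMap (prefixOf s.mem (k - 1) ++ ·)) s) := by
  have h3 := h.two_le
  refine runs_forList VL (fun w => s.mem .vlev w 0 = s.reg .d) (fun D s' =>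
    Printed [.x, .j] ((D.map fun w => [w]).flatMap (prefixOf s.mem (k - 1) ++ ·)) s s') 30
    (fun _ => 20 + k * 20)
    (by decide) ((Printed.refl _ s).setReg (by simp)) ?_ ?_ ?_
    fun s' hs' => by rw [h.vertices]; exact hs'.listed h.used h.maxDepth
  · intro D s' h₁
    simp [h₁.reg .nv (by decide), h.regnv]
  · rintro i w L₁ L₂ s' hL₁ hi' h₁ hx
    have hlst : s'.mem .vs i 0 = w := by
      rw [h₁.mem, h.vs i (by rw [hL₁, hi']; simp), hL₁, hi']
      simp
    have hd : s'.reg .d = s.reg .d := h₁.reg _ (by decide)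
    have hk : s'.reg .k = k := (h₁.reg _ (by decide)).trans h.regk
    constructor
    · intro hp
      refine .when_true (t₁ := 20 + k * 20) (t₂ := 1) (by simp [hx, hlst, h₁.mem, hp, hd]) ?_
        (by simp [Test.cost, Expr.cost, rd])
      refine .then (runs_printPart (h := k - 1) (by decide) fun s'' hr _ => ?_) (t₂ := 12)
        (fun s'' h₂ => ?_) (by omega)
      · simp [Expr.eval, hr .k (by decide), hk]
      · have hx' : s''.reg .x = i := (h₂.reg _ (by decide)).trans hx
        refine .straight rfl (by decide) (.out w (by simp [hx', h₂.mem, hlst])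
          (.nil (.nil ⟨by simp [hx'], ?_⟩ (by omega))))
        have := (h₁.trans (h₂.mono (rs' := [.x, .j]) (by simp))).print (c := w)
        rw [h₁.mem, List.append_assoc] at this
        simpa using this.setReg (by simp)
    · intro hp
      exact .when_false (t₂ := 1) (by simpa [hx, hlst, h₁.mem, hd] using hp)
        (.nil ⟨hx, h₁.setReg (by simp)⟩ (by omega)) (by decide)
  · simp only [List.map_const', List.sum_replicate, smul_eq_mul, ← h.vertices]
    omega

theorem runs_listEdges (h : AtBranch Γ ρ VL EL k 2 r V Es s) :
    Runs P (loop .x 0 (.var .ne) [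
      .set .f (rd .es (.var .x)),
      when (.eq (rd .elev (.var .f)) (.var .d)) [printPart (.sub (.var .k) 2),
        .out (rd .src (.var .f)), .out (rd .dst (.var .f))]]) s
      (10 + EL.length * 40 + Es.length * (20 + k * 20))
      (Listed Γ (k - 2) ((Es.map fun f => [Γ.a f, Γ.b f]).flatMap (prefixOf s.mem (k - 2) ++ ·))
        s) := by
  have h3 := h.two_le
  refine runs_forList EL (fun f => s.mem .elev f 0 = s.reg .d) (fun D s' =>
    Printed [.x, .f, .j] ((D.map fun f => [Γ.a f, Γ.b f]).flatMap (prefixOf s.mem (k - 2) ++ ·))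
      s s') 30 (fun _ => 20 + k * 20)
    (by decide) ((Printed.refl _ s).setReg (by simp)) ?_ ?_ ?_
    fun s' hs' => by rw [h.edges le_rfl]; exact hs'.listed h.used h.maxDepth
  · intro D s' h₁
    simp [h₁.reg .ne (by decide), h.regne]
  · rintro i f L₁ L₂ s' hL₁ hi' h₁ hx
    have hlst : s'.mem .es i 0 = f := by
      rw [h₁.mem, h.es i (by rw [hL₁, hi']; simp), hL₁, hi']
      simp
    have hf := h.leE f (by simp [hL₁])
    have hd : s'.reg .d = s.reg .d := h₁.reg _ (by decide)
    have hk : s'.reg .k = k := (h₁.reg _ (by decide)).trans h.regk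
    constructor
    · intro hp
      refine .take 1 (t₁ := 42 + k * 20) (.set f (by simp [hx, hlst]) (.nil ?_)) rfl
        (Nat.le_trans (Nat.add_le_add_right (show _ ≤ 5 by decide) _) (by omega))
      refine .when_true (t₁ := 20 + k * 20) (t₂ := 1) (by simp [h₁.mem, hp, hd]) ?_
        (by simp [Test.cost, Expr.cost, rd]; omega)
      refine .then (runs_printPart (h := k - 2) (by decide) fun s'' hr _ => ?_) (t₂ := 12)
        (fun s'' h₂ => ?_) (by omega)
      · simp [Expr.eval, hr .k (by decide), hk]
      · have hx' : s''.reg .x = i := (h₂.reg _ (by decide)).trans (by simpa using hx)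
        have hf' : s''.reg .f = f := (h₂.reg _ (by decide)).trans (by simp)
        refine .straight rfl (by decide) (.out (Γ.a f)
          (by simp [hf', h₂.mem, h₁.mem, h.graph.src f hf.1 hf.2]) (.out (Γ.b f)
          (by simp [hf', h₂.mem, h₁.mem, h.graph.dst f hf.1 hf.2])
          (.nil (.nil ⟨by simp [hx'], ?_⟩ (by omega)))))
        have := (((h₁.setReg (z := .f) (c := f) (by simp)).trans
          (h₂.mono (rs' := [.x, .f, .j]) (by simp))).print (c := Γ.a f)).print (c := Γ.b f)
        rw [setReg_mem, h₁.mem, List.append_assoc, List.append_assoc] at this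
        simpa using this.setReg (by simp)
    · intro hp
      refine .take 1 (t₁ := 20) (.set f (by simp [hx, hlst]) (.nil ?_)) rfl (by decide)
      exact .when_false (t₂ := 1) (by simpa [h₁.mem, hd] using hp)
        (.nil ⟨by simp [hx], (h₁.setReg (by simp)).setReg (by simp)⟩ (by omega)) (by decide)
  · simp only [List.map_const', List.sum_replicate, smul_eq_mul, ← h.edges le_rfl]
    omega

end EBBkCT

/-! ### The recursive procedure is correct -/

namespace EBBkCT

open RAM

variable {Γ : NumGraph} {k : ℕ} {P : Cmd Reg Tab} {s s' : State Reg Tab} {T : ℕ}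
  {Φ : State Reg Tab → Prop} {ρ o : ℕ → ℕ} {VL EL V Es : List ℕ} {d e r l h : ℕ} {out out' : List ℕ}

theorem Listed.refl (hu : s.used ⊆ Γ.cells) (hd : s.maxDepth ≤ Γ.n + 1) : Listed Γ h [] s s :=
  ⟨fun _ _ => rfl, fun _ _ => rfl, hu, by simp, rfl, hd⟩

theorem Listed.setReg (hl : Listed Γ h out s s') (z : Reg) (c : ℕ) :
    Listed Γ h out s (s'.setReg z c) :=
  ⟨hl.mem, hl.clique, hl.used, hl.output, hl.depth, hl.maxDepth⟩

theorem Listed.setClique (hl : Listed Γ h out s s') {j c : ℕ} (hj : h ≤ j) (hn : j < Γ.n) :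
    Listed Γ h out s (s'.setMem .clique j 0 c) := by
  refine ⟨fun t ht => by rw [setMem_mem_ne _ _ _ _ _ ht, hl.mem t ht], fun j' hj' => ?_, ?_,
    hl.output, hl.depth, hl.maxDepth⟩
  · rw [setMem_mem_self, if_neg (by omega), hl.clique j' hj']
  · rw [setMem_used, Finset.insert_subset_iff]
    exact ⟨Γ.mem_cells (by decide) (by omega), hl.used⟩

theorem Listed.trans {s'' : State Reg Tab} (h₁ : Listed Γ h out s s')
    (h₂ : Listed Γ h out' s' s'') : Listed Γ h (out ++ out') s s'' :=
  ⟨fun t ht => (h₂.mem t ht).trans (h₁.mem t ht), fun j hj => (h₂.clique j hj).trans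
    (h₁.clique j hj), h₂.used, by rw [h₂.output, h₁.output, List.append_assoc],
    h₂.depth.trans h₁.depth, h₂.maxDepth⟩

theorem AtBranch.of_listed (hb : AtBranch Γ ρ VL EL k l r V Es s) (hl : Listed Γ h out s s')
    (hr : ∀ z ∈ [Reg.k, .l, .d, .nv, .ne], s'.reg z = s.reg z) :
    AtBranch Γ ρ VL EL k l r V Es s' := by
  simp only [List.mem_cons, List.not_mem_nil, or_false, forall_eq_or_imp, forall_eq] at hr
  obtain ⟨hk, hl', hd, hnv, hne⟩ := hr
  have hm := fun t (ht : t ≠ .clique) => hl.mem t ht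
  refine ⟨hb.graph.congr fun t ht => hm t (by rintro rfl; simp at ht), ?_, ?_, ?_, hb.nodupV,
    hb.nodupE, hb.ltV, hb.leE, ?_, ?_, ?_, ?_, hb.inst, hk.trans hb.regk, hl'.trans hb.regl,
    hnv.trans hb.regnv, hne.trans hb.regne, hb.two_le, hl.used, ?_, hl.maxDepth, hb.clique⟩
  · rw [hm _ (by decide)]; exact hb.rank
  · rw [hm _ (by decide)]; exact hb.vs
  · rw [hm _ (by decide)]; exact hb.es
  · rw [hm _ (by decide), hd]; exact hb.vlev
  · rw [hm _ (by decide), hd]; exact hb.elev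
  · rw [hm _ (by decide), hd]; exact hb.vertices
  · rw [hm _ (by decide), hd]; exact hb.edges
  · rw [hl.depth]; exact hb.depth

/-- No level exceeded `d` before the marking, so the entries equal to `d + 1` are exactly the marked
ones, and all of these had level `d`. -/
theorem relabel_undo {L D : List ℕ} {v v' : ℕ → ℕ → ℕ} {p : ℕ → Prop} [DecidablePred p]
    (hD : D = L.filter fun w => decide (v w 0 = d ∧ p w)) (hv : ∀ w ∈ L, v w 0 ≤ d)
    (hv' : v' = relabel D (d + 1) v) :
    relabel (L.filter fun w => decide (v' w 0 = d + 1)) d v' = v := by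
  rw [hv', filter_relabel ⟨_, hD⟩ hv, relabel_relabel]
  intro w hw
  rw [hD] at hw
  simp only [List.mem_filter, decide_eq_true_eq] at hw
  exact hw.2.1

theorem AtBranch.vlev_cells (hb : AtBranch Γ ρ VL EL k l r V Es s) :
    ∀ w ∈ VL, (Tab.vlev, w, 0) ∈ Γ.cells := fun w hw =>
  Γ.mem_cells (by decide) (by have := hb.ltV w hw; omega)

theorem AtBranch.elev_cells (hb : AtBranch Γ ρ VL EL k l r V Es s) :
    ∀ w ∈ EL, (Tab.elev, w, 0) ∈ Γ.cells := fun w hw =>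
  Γ.mem_cells (by decide) (by have := hb.leE w hw; omega)

/-- The instance of a branch, after it has been marked. -/
theorem AtBranch.child {s₁ s₂ : State Reg Tab} (hO : Γ.IsOrdering o ρ)
    (hb : AtBranch Γ ρ VL EL k (l + 3) r V Es s) (he : e ∈ Es) {E' V' : List ℕ}
    (hV' : V' = VL.filter fun w => decide (s.mem .vlev w 0 = s.reg .d ∧
          ρ e < ρ (Γ.E (Γ.a e) w) ∧ ρ e < ρ (Γ.E (Γ.b e) w)))
    (h₁ : Relabelled Γ [.y, .w, .c] .vlev s s₁)
    (hv : s₁.mem .vlev = relabel V' (s.reg .d + 1) (s.mem .vlev))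
    (hE' : l ≠ 0 → E' = EL.filter fun f => decide (s₁.mem .elev f 0 = s.reg .d ∧ ρ e < ρ f ∧
        s₁.mem .vlev (Γ.a f) 0 = s.reg .d + 1 ∧ s₁.mem .vlev (Γ.b f) 0 = s.reg .d + 1))
    (h₂ : Relabelled Γ [.y, .f] .elev s₁ s₂)
    (hev : s₂.mem .elev = relabel E' (s.reg .d + 1) (s₁.mem .elev)) :
    V' = Γ.childV ρ V e ∧ AtBranch Γ ρ VL EL k (l + 1) (ρ e) (Γ.childV ρ V e)
      (Γ.childE ρ (Γ.childV ρ V e) Es e)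
      (s₂.enter [(.k, .var .k), (.l, .sub (.var .l) 2), (.d, .add (.var .d) 1), (.c, .var .c),
        (.nv, .var .nv), (.ne, .var .ne)]) := by
  have hVV : V' = Γ.childV ρ V e := by
    rw [hV', NumGraph.childV, hb.vertices, List.filter_filter]
    refine List.filter_congr fun w _ => ?_
    by_cases h : s.mem .vlev w 0 = s.reg .d <;> simp [h]
  refine ⟨hVV, ?_⟩
  rw [← hVV]
  have hreg : ∀ z, z ≠ .y → z ≠ .w → z ≠ .c → z ≠ .f → s₂.reg z = s.reg z := fun z h h' h'' h''' =>
    (h₂.reg z (by simp [h, h'''])).trans (h₁.reg z (by simp [h, h', h'']))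
  have hmem : ∀ t, t ≠ .vlev → t ≠ .elev → s₂.mem t = s.mem t := fun t h h' =>
    (h₂.mem t h').trans (h₁.mem t h)
  have hve : s₂.mem .vlev = s₁.mem .vlev := h₂.mem _ (by decide)
  have hel : s₁.mem .elev = s.mem .elev := h₁.mem _ (by decide)
  have hmemV : ∀ w ∈ VL, s₁.mem .vlev w 0 = s.reg .d + 1 ↔ w ∈ V' := by
    intro w hw
    have := hb.vlev w hw
    rw [hv]
    by_cases h : w ∈ V' <;> simp [relabel, h]
    omega
  have hinst := (hb.inst.child he)
  -- The two ends of `e` leave the instance. These two vertices pay for one more activation on the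
  -- stack and for two more entries of `clique`.
  have hlen : V'.length + 2 ≤ V.length := by
    have ha := (hb.inst.mem_edges e).1 he
    have hn := hO.ends_notMem_childV (e := e) (V := V)
    have hne := Γ.a_ne_b e ha.1.1 ha.1.2
    have : (Γ.a e :: Γ.b e :: V').Nodup := by
      rw [hVV]
      simp only [List.nodup_cons, List.mem_cons, not_or]
      exact ⟨⟨hne, hn.1⟩, hn.2, hinst.nodup_vertices⟩
    have h := (this.subperm (l₂ := V) (by
      intro x hx
      simp only [List.mem_cons] at hx
      rcases hx with rfl | rfl | hx
      · exact ha.2.2.1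
      · exact ha.2.2.2
      · rw [hVV] at hx; exact (NumGraph.mem_childV.1 hx).1)).length_le
    exact h
  have hd := hreg .d (by decide) (by decide) (by decide) (by decide)
  have hb4 := hb.two_le
  have hb5 := hb.clique
  have hb6 := hb.depth
  have hd₂ : s₂.depth = s.depth := h₂.depth.trans h₁.depth
  have hm₂ : s₂.maxDepth = s.maxDepth := h₂.maxDepth.trans h₁.maxDepth
  have hb7 := hb.maxDepth
  have hl₂ : s₂.reg .l = l + 3 :=
    (hreg .l (by decide) (by decide) (by decide) (by decide)).trans hb.regl
  refine ⟨hb.graph.congr fun t ht => hmem t (by rintro rfl; simp at ht) (by rintro rfl; simp at ht),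
    ?_, ?_, ?_, hb.nodupV, hb.nodupE, hb.ltV, hb.leE, ?_, ?_, ?_, ?_, ?_, ?_, ?_, ?_, ?_, ?_,
    h₂.used, ?_, ?_, ?_⟩
  · exact fun f => by rw [← hb.rank f, ← hmem .rank (by decide) (by decide)]; rfl
  · exact fun x hx => by rw [← hb.vs x hx, ← hmem .vs (by decide) (by decide)]; rfl
  · exact fun x hx => by rw [← hb.es x hx, ← hmem .es (by decide) (by decide)]; rfl
  · intro w hw
    have := hb.vlev w hw
    simp [State.enter, frame, hd, hve, hv, relabel]
    split_ifs <;> omega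
  · intro w hw
    have := hb.elev w hw
    simp [State.enter, frame, hd, hev, relabel, hel]
    split_ifs <;> omega
  · simp only [State.enter, frame]
    simp [hd, hve, hv]
    exact (filter_relabel ⟨_, hV'⟩ hb.vlev).symm
  · intro hl
    have hE := hE' (by omega)
    simp only [State.enter, frame]
    simp [hd, hev]
    rw [filter_relabel ⟨_, hE⟩ (by rw [hel]; exact hb.elev), hE, NumGraph.childE,
      hb.edges (by omega), List.filter_filter]
    refine List.filter_congr fun f hf => ?_
    rw [hel]
    by_cases h : s.mem .elev f 0 = s.reg .d
    · have hfE : f ∈ Es := by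
        rw [hb.edges (by omega), List.mem_filter]; exact ⟨hf, by simpa using h⟩
      have hfi := (hb.inst.mem_edges f).1 hfE
      have hV : ∀ w ∈ V, w ∈ VL := by
        intro w hw; rw [hb.vertices] at hw; exact List.mem_of_mem_filter hw
      simp [h, hmemV _ (hV _ hfi.2.2.1), hmemV _ (hV _ hfi.2.2.2)]
    · simp [h]
  · rw [hVV]; exact hinst
  · simp [State.enter, frame, hreg, hb.regk]
  · simp [State.enter, frame, Expr.eval, hl₂]
  · simp [State.enter, frame, hreg, hb.regnv]
  · simp [State.enter, frame, hreg, hb.regne]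
  · omega
  · simp [State.enter, hd₂]; omega
  · simp [State.enter, hd₂, hm₂]; omega
  · omega

end EBBkCT

/-! ### Marking, recursive call and restoration for one edge -/

namespace EBBkCT

open RAM

variable {Γ : NumGraph} {k : ℕ} {P : Cmd Reg Tab} {s s' : State Reg Tab} {T : ℕ}
  {Φ : State Reg Tab → Prop} {ρ o : ℕ → ℕ} {VL EL V Es : List ℕ} {d e r l h : ℕ} {out out' : List ℕ}

/-- The commands carried out for one edge of an instance. -/
def branchBody : List (Cmd Reg Tab) := [
  .set .u (rd .src (.var .e)), .set .v (rd .dst (.var .e)),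
  wr .clique (.sub (.var .k) (.var .l)) (.var .u),
  wr .clique (.add (.sub (.var .k) (.var .l)) 1) (.var .v),
  .set .c 0,
  loop .y 0 (.var .nv) [
    .set .w (rd .vs (.var .y)),
    when (.and (.eq (rd .vlev (.var .w)) (.var .d))
        (.and (.lt (rd .rank (.var .e)) (rd .rank (.get .edge (.var .u) (.var .w))))
          (.lt (rd .rank (.var .e)) (rd .rank (.get .edge (.var .v) (.var .w)))))) [
      wr .vlev (.var .w) (.add (.var .d) 1), .set .c (.add (.var .c) 1)]],
  when (.lt 3 (.var .l)) [
    loop .y 0 (.var .ne) [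
      .set .f (rd .es (.var .y)),
      when (.and (.and (.eq (rd .elev (.var .f)) (.var .d))
            (.lt (rd .rank (.var .e)) (rd .rank (.var .f))))
          (.and (.eq (rd .vlev (rd .src (.var .f))) (.add (.var .d) 1))
            (.eq (rd .vlev (rd .dst (.var .f))) (.add (.var .d) 1)))) [
        wr .elev (.var .f) (.add (.var .d) 1)]]],
  .call [(.k, .var .k), (.l, .sub (.var .l) 2), (.d, .add (.var .d) 1), (.c, .var .c),
    (.nv, .var .nv), (.ne, .var .ne)],
  loop .y 0 (.var .nv) [
    .set .w (rd .vs (.var .y)),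
    when (.eq (rd .vlev (.var .w)) (.add (.var .d) 1)) [wr .vlev (.var .w) (.var .d)]],
  when (.lt 3 (.var .l)) [
    loop .y 0 (.var .ne) [
      .set .f (rd .es (.var .y)),
      when (.eq (rd .elev (.var .f)) (.add (.var .d) 1)) [wr .elev (.var .f) (.var .d)]]]]

theorem listRec_eq : listRec =
    (.ite (.lt (.var .c) (.var .l)) .skip <|
    .ite (.eq (.var .l) 1)
      (loop .x 0 (.var .nv) [
        when (.eq (rd .vlev (rd .vs (.var .x))) (.var .d)) [printPart (.sub (.var .k) 1),
          .out (rd .vs (.var .x))]]) <|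
    .ite (.eq (.var .l) 2)
      (loop .x 0 (.var .ne) [
        .set .f (rd .es (.var .x)),
        when (.eq (rd .elev (.var .f)) (.var .d)) [printPart (.sub (.var .k) 2),
          .out (rd .src (.var .f)), .out (rd .dst (.var .f))]]) <|
    loop .x 0 (.var .ne) [
      .set .e (rd .es (.var .x)),
      when (.eq (rd .elev (.var .e)) (.var .d)) branchBody]) := rfl

/-- The recursive call enters through `ih`. After the marks are undone, only `clique` from the entry
`k - (l + 3)` on has changed among the tables, so the loop of the caller goes on with its instance
intact. -/
theorem runs_branch (hO : Γ.IsOrdering o ρ) (hb : AtBranch Γ ρ VL EL k (l + 3) r V Es s)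
    (he : e ∈ Es) (hre : s.reg .e = e) {t : ℕ} {q : List (List ℕ)}
    (ih : ∀ s, AtBranch Γ ρ VL EL k (l + 1) (ρ e) (Γ.childV ρ V e)
      (Γ.childE ρ (Γ.childV ρ V e) Es e) s → s.reg .c = (Γ.childV ρ V e).length →
      Runs P P s t (Listed Γ (k - (l + 1)) (q.flatMap (prefixOf s.mem (k - (l + 1)) ++ ·)) s)) :
    Runs P (block branchBody) s (110 + 110 * VL.length + (if l = 0 then 0 else 110 * EL.length) + t)
      fun s' => (∀ z ∉ [Reg.u, .v, .c, .y, .w, .f], s'.reg z = s.reg z) ∧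
      Listed Γ (k - (l + 3)) ((q.map fun q => Γ.a e :: Γ.b e :: q).flatMap
        (prefixOf s.mem (k - (l + 3)) ++ ·)) s s' := by
  have hk := hb.two_le
  have hcl := hb.clique
  have hei := (hb.inst.mem_edges e).1 he
  have hlenV : 2 ≤ V.length := by
    have : [Γ.a e, Γ.b e].Nodup := by simpa using Γ.a_ne_b e hei.1.1 hei.1.2
    simpa using (this.subperm (l₂ := V) (by simp [hei.2.2])).length_le
  -- The set `S` has `h` elements; the ends of `e` are written behind them, so the child prints
  -- prefixes of length `h + 2`.
  obtain ⟨h, hh⟩ : ∃ h, h = k - (l + 3) := ⟨_, rfl⟩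
  have hh' : k - (l + 1) = h + 2 := by omega
  rw [hh'] at ih
  rw [← hh] at hcl ⊢
  have key : ∀ s₁, Listed Γ h [] s s₁ → (∀ z ∉ [Reg.u, .v, .c, .y, .w, .f], s₁.reg z = s.reg z) →
      s₁.mem .clique h 0 = Γ.a e → s₁.mem .clique (h + 1) 0 = Γ.b e → s₁.reg .u = Γ.a e →
      s₁.reg .v = Γ.b e → s₁.reg .c = 0 →
      Runs P (block (branchBody.drop 5)) s₁ (80 + 110 * VL.length +
        (if l = 0 then 0 else 110 * EL.length) + t) fun s' =>
      (∀ z ∉ [Reg.u, .v, .c, .y, .w, .f], s'.reg z = s.reg z) ∧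
      Listed Γ h ((q.map fun q => Γ.a e :: Γ.b e :: q).flatMap (prefixOf s.mem h ++ ·)) s s' := by
    intro s₁ hl₁ hr₁ hca hcb hu hv hc
    have hb₁ : AtBranch Γ ρ VL EL k (l + 3) r V Es s₁ := hb.of_listed hl₁ fun z hz =>
      hr₁ z fun hz' => by simp at hz hz'; rcases hz with rfl | rfl | rfl | rfl | rfl <;> simp at hz'
    refine .then (runs_markVertices hb₁.graph hb₁.rank hb₁.vs hb₁.nodupV hb₁.regnv rfl
      ((hr₁ _ (by decide)).trans hre) hu hv hc hb₁.used hb₁.vlev_cells)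
      (t₂ := 65 + 40 * VL.length + (if l = 0 then 0 else 110 * EL.length) + t) ?_ (by omega)
    rintro s₂ ⟨V', hV', h₂, hc₂, hv₂⟩
    have hd₂ : s₂.reg .d = s₁.reg .d := h₂.reg _ (by decide)
    have hl₂ : s₂.reg .l = l + 3 := (h₂.reg _ (by decide)).trans hb₁.regl
    have hm₂ : ∀ t, t ≠ .vlev → s₂.mem t = s₁.mem t := h₂.mem
    -- For `l = 0` the child has parameter `1` and needs no edges; then nothing is marked and `E'`
    -- is empty.
    refine .then (t₁ := 18 + if l = 0 then 0 else 70 * EL.length)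
      (t₂ := 47 + 40 * VL.length + (if l = 0 then 0 else 40 * EL.length) + t)
      (Ψ := fun s₃ => ∃ E', (l ≠ 0 → E' = EL.filter fun f => decide (s₂.mem .elev f 0 = s₁.reg .d ∧
        ρ e < ρ f ∧ s₂.mem .vlev (Γ.a f) 0 = s₁.reg .d + 1 ∧ s₂.mem .vlev (Γ.b f) 0 = s₁.reg .d + 1))
        ∧ (l = 0 → E' = []) ∧
        Relabelled Γ [.y, .f] .elev s₂ s₃ ∧
        s₃.mem .elev = relabel E' (s₁.reg .d + 1) (s₂.mem .elev)) ?_ ?_ (by split_ifs <;> omega)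
    · by_cases hl : l = 0
      · refine .ite (t₁ := 1) (fun hlt => ?_) (fun _ => .skip ?_ le_rfl)
          (Nat.le_add_right_of_le (by decide))
        · simp [hl₂, hl] at hlt
        · exact ⟨[], fun h => absurd hl h, fun _ => rfl, .refl h₂.used, by
            funext i j; simp [relabel]⟩
      · refine .ite (t₁ := 11 + 70 * EL.length) (fun _ => ?_) (fun hlt => ?_)
          (by simp [hl, Test.cost, Expr.cost]; omega)
        · refine .then (runs_markEdges (hb₁.graph.congr fun t ht => hm₂ t (by rintro rfl; simp at ht))
            (by rw [hm₂ _ (by decide)]; exact hb₁.rank) (by rw [hm₂ _ (by decide)]; exact hb₁.es)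
            hb₁.nodupE ((h₂.reg _ (by decide)).trans hb₁.regne) hd₂ ((h₂.reg _ (by decide)).trans
            ((hr₁ _ (by decide)).trans hre)) h₂.used hb₁.leE hb₁.elev_cells)
            (fun s₃ h₃ => .nil ?_ le_rfl) (by omega)
          obtain ⟨E', hE', h₃⟩ := h₃
          exact ⟨E', fun _ => hE', fun h => absurd h hl, h₃⟩
        · simp [hl₂, hl] at hlt
    rintro s₃ ⟨E', hE', hE₀, h₃, hv₃⟩
    obtain ⟨hVV, hchild⟩ := hb₁.child hO he hV' h₂ hv₂ hE' h₃ hv₃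
    refine .then (Ψ := fun s₄ => s₄.reg = s₃.reg ∧
        Listed Γ (h + 2) (q.flatMap (prefixOf s₃.mem (h + 2) ++ ·)) s₃ s₄)
      (.call (t₁ := t) ((ih _ hchild ?_).mono le_rfl ?_) le_rfl)
      (t₂ := 30 + 40 * VL.length + (if l = 0 then 0 else 40 * EL.length)) ?_ ?_
    · simp [State.enter, frame, h₃.reg .c (by decide), hc₂, hVV]
    · exact fun s₄ h₄ => ⟨rfl, h₄.mem, h₄.clique, h₄.used, h₄.output, rfl, h₄.maxDepth⟩
    · rintro s₄ ⟨hr₄, h₄⟩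
      have hd₄ : s₄.reg .d = s₁.reg .d := by rw [hr₄, h₃.reg _ (by decide), hd₂]
      have hv₄ : s₄.mem .vlev = s₂.mem .vlev := (h₄.mem _ (by decide)).trans (h₃.mem _ (by decide))
      have he₄ : s₄.mem .elev = s₃.mem .elev := h₄.mem _ (by decide)
      have hm₄ : ∀ t, t ≠ .clique → t ≠ .vlev → t ≠ .elev → s₄.mem t = s₁.mem t :=
        fun t h h' h'' => (h₄.mem t h).trans ((h₃.mem t h'').trans (h₂.mem t h'))
      have hr₄' : ∀ z, z ≠ .y → z ≠ .w → z ≠ .c → z ≠ .f → s₄.reg z = s₁.reg z :=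
        fun z h h' h'' h''' => by
          rw [hr₄, h₃.reg z (by simp [h, h''']), h₂.reg z (by simp [h, h', h''])]
      refine .then (runs_restore (lst := .vs) (lev := .vlev) (r := .w) (hi := .nv) (L := VL)
        (by decide) (by decide) hb₁.nodupV (by rw [hr₄' .nv (by decide) (by decide) (by decide)
          (by decide), hb₁.regnv]) hd₄ (by
          rw [hm₄ .vs (by decide) (by decide) (by decide)]; exact hb₁.vs) h₄.used hb₁.vlev_cells)
        (t₂ := 20 + (if l = 0 then 0 else 40 * EL.length)) ?_ (by omega)
      rintro s₅ ⟨h₅, hv₅⟩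
      rw [hv₄, relabel_undo hV' hb₁.vlev hv₂] at hv₅
      refine .then (t₁ := 18 + if l = 0 then 0 else 40 * EL.length) (t₂ := 1)
        (Ψ := fun s₆ => Relabelled Γ [.y, .f] .elev s₅ s₆ ∧ s₆.mem .elev = s₁.mem .elev) ?_ ?_
        (by omega)
      · have he₅ : s₅.mem .elev = s₃.mem .elev := (h₅.mem _ (by decide)).trans he₄
        have he₂ : s₂.mem .elev = s₁.mem .elev := h₂.mem _ (by decide)
        have hl₅ : s₅.reg .l = l + 3 := by
          rw [h₅.reg _ (by decide), hr₄' .l (by decide) (by decide) (by decide)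
          (by decide), hb₁.regl]
        by_cases hl : l = 0
        · refine .ite (t₁ := 1) (fun hlt => ?_) (fun _ => .skip ?_ le_rfl)
            (Nat.le_add_right_of_le (by decide))
          · simp [hl₅, hl] at hlt
          · refine ⟨.refl h₅.used, ?_⟩
            rw [he₅, hv₃, hE₀ hl, he₂]
            funext i j; simp [relabel]
        · refine .ite (t₁ := 11 + 40 * EL.length) (fun _ => ?_) (fun hlt => ?_)
            (by simp [hl, Test.cost, Expr.cost]; omega)
          · refine .then (runs_restore (lst := .es) (lev := .elev) (r := .f) (hi := .ne) (L := EL)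
              (d := s₁.reg .d)
              (by decide) (by decide) hb₁.nodupE (by rw [h₅.reg _ (by decide),
                hr₄' .ne (by decide) (by decide) (by decide) (by decide), hb₁.regne])
              (by rw [h₅.reg _ (by decide), hd₄]) (by
                rw [h₅.mem _ (by decide), hm₄ .es (by decide) (by decide) (by decide)]
                exact hb₁.es) h₅.used hb₁.elev_cells)
              (fun s₆ h₆ => .nil ⟨h₆.1, ?_⟩ le_rfl) (by omega)
            have h₆ := h₆.2
            rwa [he₅, relabel_undo (hE' hl) (by rw [he₂]; exact hb₁.elev) hv₃, he₂] at h₆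
          · simp [hl₅, hl] at hlt
      · rintro s₆ ⟨h₆, hv₆⟩
        refine .nil ⟨fun z hz => ?_, ?_⟩ le_rfl
        · rw [← hr₁ z hz]
          simp only [List.mem_cons, List.not_mem_nil, or_false, not_or] at hz
          rw [h₆.reg z (by simp [hz]), h₅.reg z (by simp [hz]), hr₄' z (by simp [hz])
            (by simp [hz]) (by simp [hz]) (by simp [hz])]
        · have hpre : prefixOf s₃.mem (h + 2) = prefixOf s.mem h ++ [Γ.a e, Γ.b e] := by
            have hc₃ : s₃.mem .clique = s₁.mem .clique :=
              (h₃.mem _ (by decide)).trans (h₂.mem _ (by decide))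
            rw [← hl₁.prefixOf_eq]
            simp [prefixOf, List.range_succ, hc₃, hca, hcb]
          have hl₆ : Listed Γ h (q.flatMap (prefixOf s₃.mem (h + 2) ++ ·)) s₁ s₆ := by
            refine ⟨fun t ht => ?_, fun j hj => ?_, h₆.used, ?_, ?_, ?_⟩
            · by_cases h' : t = .elev
              · rw [h', hv₆]
              by_cases h'' : t = .vlev
              · rw [h'', h₆.mem _ (by decide), hv₅]
              · rw [h₆.mem t h', h₅.mem t h'', hm₄ t ht h'' h']
            · rw [h₆.mem _ (by decide), h₅.mem _ (by decide), h₄.clique j (by omega),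
                h₃.mem _ (by decide), h₂.mem _ (by decide)]
            · rw [h₆.output, h₅.output, h₄.output, h₃.output, h₂.output]
            · rw [h₆.depth, h₅.depth, h₄.depth, h₃.depth, h₂.depth]
            · rw [h₆.maxDepth, h₅.maxDepth]; exact h₄.maxDepth
          have := hl₁.trans hl₆
          rw [hpre] at this
          simpa [List.flatMap_map, Function.comp_def] using this
    · have : argsCost [(Reg.k, Expr.var Reg.k), (.l, .sub (.var .l) 2), (.d, .add (.var .d) 1),
          (.c, .var .c), (.nv, .var .nv), (.ne, (.var .ne : Expr Reg Tab))] + 1 ≤ 17 := by decide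
      omega
  refine .take 5 (.set (Γ.a e) (by simp [hre, hb.graph.src e hei.1.1 hei.1.2])
    (.set (Γ.b e) (by simp [hre, hb.graph.dst e hei.1.1 hei.1.2])
    (.store h 0 (Γ.a e) (by simp [Expr.eval, hb.regk, hb.regl, hh]) rfl (by simp)
    (.store (h + 1) 0 (Γ.b e) (by simp [Expr.eval, hb.regk, hb.regl, hh]) rfl (by simp)
    (.set 0 rfl (.nil (key _ ?_ ?_ ?_ ?_ ?_ ?_ ?_))))))) rfl
    (Nat.le_trans (Nat.add_le_add_right (show _ ≤ 30 by decide) _) (by omega))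
  · exact (((((Listed.refl hb.used hb.maxDepth).setReg _ _).setReg _ _).setClique le_rfl
      (by omega)).setClique (by omega) (by omega)).setReg _ _
  · intro z hz
    simp only [List.mem_cons, List.not_mem_nil, or_false, not_or] at hz
    simp [hz]
  · simp
  · simp
  · simp
  · simp
  · simp

end EBBkCT

/-! ### Induction over the recursive calls -/

namespace EBBkCT

open RAM

variable {Γ : NumGraph} {k : ℕ} {P : Cmd Reg Tab} {s s' : State Reg Tab} {T : ℕ}
  {Φ : State Reg Tab → Prop} {ρ o : ℕ → ℕ} {VL EL V Es : List ℕ} {d e r l h : ℕ} {out out' : List ℕ}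

theorem runs_branches (hO : Γ.IsOrdering o ρ) (hb : AtBranch Γ ρ VL EL k (l + 3) r V Es s)
    {t : ℕ → ℕ} {q : ℕ → List (List ℕ)}
    (ih : ∀ e ∈ Es, ∀ s, AtBranch Γ ρ VL EL k (l + 1) (ρ e) (Γ.childV ρ V e)
      (Γ.childE ρ (Γ.childV ρ V e) Es e) s → s.reg .c = (Γ.childV ρ V e).length →
      Runs P P s (t e)
        (Listed Γ (k - (l + 1)) ((q e).flatMap (prefixOf s.mem (k - (l + 1)) ++ ·)) s)) :
    Runs P (loop .x 0 (.var .ne) [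
      .set .e (rd .es (.var .x)),
      when (.eq (rd .elev (.var .e)) (.var .d)) branchBody]) s
      (10 + EL.length * 30 + (Es.map fun e => 120 + 110 * VL.length +
        (if l = 0 then 0 else 110 * EL.length) + t e).sum)
      (Listed Γ (k - (l + 3)) ((Es.flatMap fun e => (q e).map fun q => Γ.a e :: Γ.b e :: q).flatMap
        (prefixOf s.mem (k - (l + 3)) ++ ·)) s) := by
  have hEs := hb.edges (by omega)
  refine runs_forList EL (fun f => s.mem .elev f 0 = s.reg .d) (fun D s' =>
    (∀ z ∉ [Reg.x, .e, .u, .v, .c, .y, .w, .f], s'.reg z = s.reg z) ∧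
    Listed Γ (k - (l + 3)) ((D.flatMap fun e => (q e).map fun q => Γ.a e :: Γ.b e :: q).flatMap
        (prefixOf s.mem (k - (l + 3)) ++ ·)) s s') 20
    (fun e => 120 + 110 * VL.length + (if l = 0 then 0 else 110 * EL.length) + t e)
    (by decide) ⟨?_, (Listed.refl hb.used hb.maxDepth).setReg _ _⟩ ?_ ?_ ?_
    fun s' hs' => by rw [← hEs] at hs'; exact hs'.2
  · intro z hz
    simp only [List.mem_cons, List.not_mem_nil, or_false, not_or] at hz
    simp [hz]
  · rintro D s' ⟨h₁, -⟩
    simp [h₁ .ne (by decide), hb.regne]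
  · rintro i e L₁ L₂ s' hL₁ hi' ⟨h₁, h₂⟩ hx
    have hlst : s'.mem .es i 0 = e := by
      rw [h₂.mem _ (by decide), hb.es i (by rw [hL₁, hi']; simp), hL₁, hi']
      simp
    have hlev : s'.mem .elev e 0 = s.mem .elev e 0 := by rw [h₂.mem _ (by decide)]
    have hd : s'.reg .d = s.reg .d := h₁ _ (by decide)
    have hr : ∀ z ∉ [Reg.x, .e, .u, .v, .c, .y, .w, .f], (s'.setReg .e e).reg z = s.reg z := by
      intro z hz
      rw [← h₁ z hz]
      simp only [List.mem_cons, List.not_mem_nil, or_false, not_or] at hz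
      simp [hz]
    have hb' : AtBranch Γ ρ VL EL k (l + 3) r V Es (s'.setReg .e e) :=
      hb.of_listed (h₂.setReg _ _) fun z hz => hr z fun hz' => by
        simp at hz hz'; rcases hz with rfl | rfl | rfl | rfl | rfl <;> simp at hz'
    constructor
    · intro hp
      have he : e ∈ Es := by rw [hEs, List.mem_filter]; exact ⟨by simp [hL₁], by simpa using hp⟩
      refine .take 1 (t₁ := 130 + 110 * VL.length + (if l = 0 then 0 else 110 * EL.length) + t e)
        (.set e (by simp [hx, hlst]) (.nil ?_)) rfl
        (Nat.le_trans (Nat.add_le_add_right (show _ ≤ 10 by decide) _) (by omega))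
      refine .when_true (t₂ := 1) (by simp [hlev, hp, hd])
        ((runs_branch hO hb' he (by simp) (ih e he)).mono le_rfl ?_)
        (by simp only [Test.cost, Expr.cost, rd]; omega)
      rintro s'' ⟨h₃, h₄⟩
      refine .nil ⟨by rw [h₃ _ (by decide)]; simpa using hx, ?_, ?_⟩ le_rfl
      · intro z hz
        rw [← hr z hz]
        simp only [List.mem_cons, List.not_mem_nil, or_false, not_or] at hz
        simp [h₃ z, hz]
      · have := (h₂.setReg .e e).trans h₄
        rw [(h₂.setReg .e e).prefixOf_eq, ← List.flatMap_append] at this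
        simpa using this.setReg .x (i + 1)
    · intro hp
      refine .take 1 (t₁ := 10) (.set e (by simp [hx, hlst]) (.nil ?_)) rfl (by decide)
      refine .when_false (t₂ := 1) (by simpa [hlev, hd] using hp) (.nil ⟨by simp [hx], ?_,
        (h₂.setReg _ _).setReg _ _⟩ (by omega)) (by decide)
      intro z hz
      rw [← hr z hz]
      simp only [List.mem_cons, List.not_mem_nil, or_false, not_or] at hz
      simp [hz]
  · rw [← hEs]

/-- The parameter `l` falls by two with each call, so structural recursion on `l` resolves the
recursion of the machine. -/
theorem runs_listRec (hO : Γ.IsOrdering o ρ) : ∀ {l r : ℕ} {V Es : List ℕ} {s : State Reg Tab},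
    1 ≤ l → AtBranch Γ ρ VL EL k l r V Es s → s.reg .c = V.length →
    Runs listRec listRec s (400 * Γ.listCost ρ k VL.length EL.length l V Es)
      (Listed Γ (k - l) ((Γ.cliqueLists ρ l V Es).flatMap (prefixOf s.mem (k - l) ++ ·)) s)
  | 0, _, _, _, _, h, _, _ => by omega
  | l + 1, r, V, Es, s, _, hb, hc => by
    have hl := hb.regl
    have h3 := hb.two_le
    -- Returning at once is right because the specified list is empty as well for an instance with
    -- too few vertices.
    have hskip : V.length < l + 1 → Runs listRec (.skip) s 1 (Listed Γ (k - (l + 1))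
        ((Γ.cliqueLists ρ (l + 1) V Es).flatMap (prefixOf s.mem (k - (l + 1)) ++ ·)) s) := by
      intro hlt
      have : Γ.cliqueLists ρ (l + 1) V Es = [] := by
        match l with
        | 0 => simp [NumGraph.cliqueLists, List.length_eq_zero_iff.1 (by omega : V.length = 0)]
        | 1 => simp [NumGraph.cliqueLists, hlt]
        | l + 2 => simp [NumGraph.cliqueLists, hlt]
      rw [this]
      exact .skip (.refl hb.used hb.maxDepth) le_rfl
    match l with
    | 0 =>
      conv => arg 2; rw [listRec_eq]
      simp only [NumGraph.cliqueLists, NumGraph.listCost, NumGraph.loopCost] at hskip ⊢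
      refine .ite (fun hlt => (hskip ?_).mono (Nat.le_add_left 1 _) fun _ h => h) (fun _ => ?_)
        (t₁ := 50 + VL.length * 40 + V.length * (20 + k * 20) + 1)
        (by simp only [Test.cost, Expr.cost]; norm_num; nlinarith)
      · simpa [hc, hl] using hlt
      · refine .ite (t₁ := 10 + VL.length * 40 + V.length * (20 + k * 20))
          (fun _ => runs_listVertices hb) (fun h => ?_) ?_
        · simp [hl] at h
        · simp only [Test.cost, Expr.cost]; omega
    | 1 =>
      conv => arg 2; rw [listRec_eq]
      refine .ite (fun hlt => (hskip ?_).mono (Nat.le_add_left 1 _) fun _ h => h) (fun hlt => ?_)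
        (t₁ := 50 + EL.length * 40 + Es.length * (20 + k * 20) + 1)
        (by
          simp only [Test.cost, Expr.cost, NumGraph.listCost, NumGraph.loopCost]
          norm_num
          nlinarith)
      · simpa [hc, hl] using hlt
      · have hV : ¬ V.length < 2 := by simpa [hc, hl] using hlt
        refine .ite (fun h => ?_) (fun _ => ?_)
          (t₁ := 40 + EL.length * 40 + Es.length * (20 + k * 20))
          (by simp only [Test.cost, Expr.cost]; omega)
        · simp [hl] at h
        refine .ite (t₁ := 10 + EL.length * 40 + Es.length * (20 + k * 20)) (fun _ => ?_)
          (fun h => ?_) (by simp only [Test.cost, Expr.cost]; omega)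
        · simpa only [NumGraph.cliqueLists, hV, if_false] using runs_listEdges hb
        · simp [hl] at h
    | l + 2 =>
      -- Edge loops are run for a child exactly when its parameter `l + 1` is at least `2`, in
      -- agreement with `loopCost`; the factor `400` absorbs all constants.
      have hcost : 50 + EL.length * 30 + (Es.map fun e => 120 + 110 * VL.length +
          (if l = 0 then 0 else 110 * EL.length) + 400 * Γ.listCost ρ k VL.length EL.length (l + 1)
            (Γ.childV ρ V e) (Γ.childE ρ (Γ.childV ρ V e) Es e)).sum ≤
          400 * Γ.listCost ρ k VL.length EL.length (l + 3) V Es := by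
        simp only [NumGraph.listCost]
        rw [mul_add, ← List.sum_map_mul_left]
        refine add_le_add (by simp only [NumGraph.loopCost]; norm_num; omega) ?_
        refine List.sum_le_sum fun e _ => ?_
        simp only [NumGraph.loopCost]
        split_ifs <;> omega
      conv => arg 2; rw [listRec_eq]
      refine .ite (fun hlt => (hskip ?_).mono (Nat.le_add_left 1 _) fun _ h => h) (fun hlt => ?_)
        (t₁ := 36 + EL.length * 30 + (Es.map fun e => 120 + 110 * VL.length +
          (if l = 0 then 0 else 110 * EL.length) + 400 * Γ.listCost ρ k VL.length EL.length (l + 1)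
            (Γ.childV ρ V e) (Γ.childE ρ (Γ.childV ρ V e) Es e)).sum + 1)
        (by rw [show l + 2 + 1 = l + 3 from rfl]; simp only [Test.cost, Expr.cost]; omega)
      · simpa [hc, hl] using hlt
      · have hV : ¬ V.length < l + 3 := by simp [hc, hl] at hlt; omega
        refine .ite (fun h => ?_) (fun _ => .ite (fun h => ?_) (fun _ => ?_)
          (t₁ := 10 + EL.length * 30 + (Es.map fun e => 120 + 110 * VL.length +
            (if l = 0 then 0 else 110 * EL.length) + 400 * Γ.listCost ρ k VL.length EL.length
            (l + 1) (Γ.childV ρ V e) (Γ.childE ρ (Γ.childV ρ V e) Es e)).sum) le_rfl)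
          (by simp only [Test.cost, Expr.cost]; omega)
        · simp [hl] at h
        · simp [hl] at h
        · simp only [NumGraph.cliqueLists, hV, if_false]
          exact runs_branches hO hb fun e _ s hb' hc' => runs_listRec hO (by omega) hb' hc'

end EBBkCT

/-! ### The instances of the top-level branches -/

namespace EBBkCT

open RAM

variable {Γ : NumGraph} {k : ℕ} {P : Cmd Reg Tab} {s s' : State Reg Tab} {T : ℕ}
  {Φ : State Reg Tab → Prop} {ρ o : ℕ → ℕ} {VL D : List ℕ} {i u v : ℕ} {rs : List Reg}
  {lst lev : Tab} {cnt z : Reg}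

/-- `s'` arises from `s` by storing the list `D` in the table `lst`, setting its elements to `1` in
the table `lev`, and changing the registers in `rs`, of which `cnt` holds the length of `D`. -/
structure Collected (Γ : NumGraph) (rs : List Reg) (lst lev : Tab) (cnt : Reg) (D : List ℕ)
    (s s' : State Reg Tab) : Prop where
  reg : ∀ z ∉ rs, s'.reg z = s.reg z
  mem : ∀ t, t ≠ lst → t ≠ lev → s'.mem t = s.mem t
  used : s'.used ⊆ Γ.cells
  output : s'.output = s.output
  depth : s'.depth = s.depth
  maxDepth : s'.maxDepth = s.maxDepth
  count : s'.reg cnt = D.length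
  list : ∀ x < D.length, s'.mem lst x 0 = D[x]?.getD 0
  level : ∀ w ∈ D, s'.mem lev w 0 = 1

theorem Collected.nil (hu : s.used ⊆ Γ.cells) (h : s.reg cnt = 0) :
    Collected Γ rs lst lev cnt [] s s :=
  ⟨fun _ _ => rfl, fun _ _ _ => rfl, hu, rfl, rfl, rfl, h, by simp, by simp⟩

theorem Collected.setReg (h : Collected Γ rs lst lev cnt D s s') {c : ℕ} (hz : z ∈ rs)
    (hc : cnt ≠ z) : Collected Γ rs lst lev cnt D s (s'.setReg z c) :=
  ⟨fun z' hz' => by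
    rw [setReg_reg, if_neg (by rintro rfl; exact hz' hz)]; exact h.reg z' hz', h.mem, h.used,
    h.output, h.depth, h.maxDepth, by rw [setReg_reg, if_neg hc, h.count], h.list, h.level⟩

theorem Collected.append (h : Collected Γ rs lst lev cnt D s s') (hne : lst ≠ lev) (hz : cnt ∈ rs)
    {w : ℕ} (h₁ : (lst, D.length, 0) ∈ Γ.cells) (h₂ : (lev, w, 0) ∈ Γ.cells) :
    Collected Γ rs lst lev cnt (D ++ [w]) s
      (((s'.setMem lst D.length 0 w).setMem lev w 0 1).setReg cnt (D.length + 1)) := by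
  refine ⟨fun z' hz' => ?_, fun t ht ht' => ?_, ?_, h.output, h.depth, h.maxDepth, by simp,
    fun x hx => ?_, fun w' hw' => ?_⟩
  · rw [setReg_reg, if_neg (by rintro rfl; exact hz' hz)]; exact h.reg z' hz'
  · rw [setReg_mem, setMem_mem_ne _ _ _ _ _ ht', setMem_mem_ne _ _ _ _ _ ht, h.mem t ht ht']
  · simp only [setReg_used, setMem_used, Finset.insert_subset_iff]
    exact ⟨h₂, h₁, h.used⟩
  · rw [setReg_mem, setMem_mem_ne _ _ _ _ _ hne, setMem_mem_self, getD_append_singleton]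
    have := h.list x
    simp only [List.length_append, List.length_singleton] at hx
    by_cases hx' : x = D.length
    · simp [hx']
    · simp [hx', this (by omega)]
  · rw [setReg_mem, setMem_mem_self]
    have := h.level w'
    simp only [List.mem_append, List.mem_singleton] at hw'
    by_cases hx' : w' = w
    · simp [hx']
    · rw [if_neg (by simp [hx']), setMem_mem_ne _ _ _ _ _ hne.symm, this (by tauto)]

theorem runs_collectVertices (hg : HasGraph Γ s.mem) (hρ : ∀ f, s.mem .rank f 0 = ρ f)
    (hu : s.reg .u = u) (hv : s.reg .v = v) (hi : s.reg .i = i)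
    (hnv : s.reg .nv = 0) (hus : s.used ⊆ Γ.cells) :
    Runs P (loop .j 0 (rd .deg (.var .u)) [
        .set .w (.get .adj (.var .u) (.var .j)),
        when (.and (.lt (.var .i) (rd .rank (.get .edge (.var .u) (.var .w))))
            (.lt (.var .i) (rd .rank (.get .edge (.var .v) (.var .w))))) [
          wr .vs (.var .nv) (.var .w), wr .vlev (.var .w) 1,
          .set .nv (.add (.var .nv) 1)]]) s
      (10 + Γ.deg u * 70) (Collected Γ [.j, .w, .nv] .vs .vlev .nv
        ((Γ.nbrs u).filter fun w => decide (i < ρ (Γ.E u w) ∧ i < ρ (Γ.E v w))) s) := by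
  refine runs_forList (Γ.nbrs u) (fun w => i < ρ (Γ.E u w) ∧ i < ρ (Γ.E v w))
    (fun D s' => Collected Γ [.j, .w, .nv] .vs .vlev .nv D s s') 60 (fun _ => 0)
    (by simp [Expr.cost, rd]) ((Collected.nil hus hnv).setReg (by simp) (by decide)) ?_ ?_ ?_
    fun s' h => h
  · intro D s' h
    simp [h.reg .u (by decide), hu, h.mem .deg (by decide) (by decide), hg.deg, NumGraph.deg]
  · rintro j w L₁ L₂ s' hL hj h hx
    have hu' : s'.reg .u = u := by rw [h.reg _ (by decide), hu]
    have hv' : s'.reg .v = v := by rw [h.reg _ (by decide), hv]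
    have hi' : s'.reg .i = i := by rw [h.reg _ (by decide), hi]
    have hrk : ∀ f, s'.mem .rank f 0 = ρ f := by
      rw [h.mem _ (by decide) (by decide)]; exact hρ
    have hed : ∀ x y, s'.mem .edge x y = Γ.E x y := by
      rw [h.mem _ (by decide) (by decide)]; exact hg.edge
    have hadj : s'.mem .adj u j = w := by
      rw [h.mem _ (by decide) (by decide), hg.adj, hL, hj]; simp
    have hw := Γ.mem_nbrs.1 (show w ∈ Γ.nbrs u by simp [hL])
    constructor
    · intro hp
      refine .straight rfl (by decide)
        (.set w (by simp [hx, hadj, hu']) (.when (fun _ => ?_) fun hn => ?_))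
      · refine .store (L₁.filter fun w => decide (i < ρ (Γ.E u w) ∧ i < ρ (Γ.E v w))).length 0 w
          (by simp [h.count]) rfl (by simp) (.store w 0 1 (by simp) rfl rfl
          (.set ((L₁.filter fun w => decide (i < ρ (Γ.E u w) ∧ i < ρ (Γ.E v w))).length + 1)
          (by simp [h.count]) (.nil (.nil ⟨by simp [hx], ?_⟩))))
        refine ((h.setReg (by simp) (by decide)).append (by decide) (by simp)
          (Γ.mem_cells (by decide) ?_) (Γ.mem_cells (by decide) ?_)).setReg (by simp) (by decide)
        · have h₁ := List.length_filter_le (fun w => decide (i < ρ (Γ.E u w) ∧ i < ρ (Γ.E v w))) L₁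
          have h₂ : (Γ.nbrs u).length ≤ Γ.m := Γ.deg_le
          rw [hL, List.length_append] at h₂
          omega
        · have := Γ.lt_of_E_ne_zero hw
          omega
      · simp [Test.eval, hu', hv', hi', hrk, hed] at hn
        exact absurd hp.2 (by have := hn hp.1; omega)
    · intro hp
      refine .straight rfl (by decide)
        (.set w (by simp [hx, hadj, hu']) (.when (fun hn => ?_) fun _ => ?_))
      · simp [Test.eval, hu', hv', hi', hrk, hed] at hn
        exact absurd hn hp
      · exact .nil ⟨by simp [hx], (h.setReg (by simp) (by decide)).setReg (by simp) (by decide)⟩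
  · simp [NumGraph.deg]

variable (Γ ρ) in
/-- `D` lists the edges of rank greater than `i` between the vertices number `p` and `q` of `VL`,
where `p < x`, or `p = x` and `q < y`. -/
def EdgesUpTo (VL : List ℕ) (i x y : ℕ) (D : List ℕ) : Prop :=
  D.Nodup ∧ ∀ f, f ∈ D ↔ i < ρ f ∧ ∃ p q, p < q ∧ q < VL.length ∧ (p < x ∨ p = x ∧ q < y) ∧
    f = Γ.E (VL[p]?.getD 0) (VL[q]?.getD 0)

theorem getD_inj {L : List ℕ} (h : L.Nodup) {p q : ℕ} (hp : p < L.length) (hq : q < L.length)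
    (heq : L[p]?.getD 0 = L[q]?.getD 0) : p = q := by
  simp only [List.getElem?_eq_getElem hp, List.getElem?_eq_getElem hq, Option.getD_some] at heq
  exact (h.getElem_inj_iff).1 heq

theorem getD_mem {L : List ℕ} {p : ℕ} (hp : p < L.length) : L[p]?.getD 0 ∈ L := by
  simp only [List.getElem?_eq_getElem hp, Option.getD_some, List.getElem_mem]

/-- `VL` has no repetitions, so different pairs of positions cannot yield the same edge, and the
appended edge is new. -/
theorem EdgesUpTo.succ {x y : ℕ} (hO : Γ.IsOrdering o ρ) (hn : VL.Nodup)
    (h : EdgesUpTo Γ ρ VL i x y D) (hx : x < y) (hy : y < VL.length) :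
    EdgesUpTo Γ ρ VL i x (y + 1) (if i < ρ (Γ.E (VL[x]?.getD 0) (VL[y]?.getD 0)) then
      D ++ [Γ.E (VL[x]?.getD 0) (VL[y]?.getD 0)] else D) := by
  have hiff : ∀ f, (i < ρ f ∧ ∃ p q, p < q ∧ q < VL.length ∧ (p < x ∨ p = x ∧ q < y + 1) ∧
      f = Γ.E (VL[p]?.getD 0) (VL[q]?.getD 0)) ↔
      f ∈ D ∨ i < ρ f ∧ f = Γ.E (VL[x]?.getD 0) (VL[y]?.getD 0) := by
    intro f
    rw [h.2]
    constructor
    · rintro ⟨h₁, p, q, h₂, h₃, h₄, h₅⟩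
      by_cases h₆ : p = x ∧ q = y
      · rw [h₆.1, h₆.2] at h₅; exact .inr ⟨h₁, h₅⟩
      · exact .inl ⟨h₁, p, q, h₂, h₃, by omega, h₅⟩
    · rintro (⟨h₁, p, q, h₂, h₃, h₄, h₅⟩ | ⟨h₁, h₂⟩)
      · exact ⟨h₁, p, q, h₂, h₃, by omega, h₅⟩
      · exact ⟨h₁, x, y, hx, hy, by omega, h₂⟩
  split_ifs with hlt
  · refine ⟨?_, fun f => ?_⟩
    · rw [List.nodup_append]
      refine ⟨h.1, by simp, ?_⟩
      rintro f hf f' hf' rfl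
      rw [List.mem_singleton] at hf'
      obtain ⟨h₁, p, q, h₂, h₃, h₄, h₅⟩ := (h.2 f).1 hf
      rw [h₅] at hf'
      have h₆ := hO.E_ne_zero (u := VL[x]?.getD 0) (v := VL[y]?.getD 0) (by omega)
      have h₇ := Γ.ends_of_E_ne_zero h₆
      have h₈ := (Γ.E_eq_iff _ _ _ h₆).1 hf'
      have e₁ := fun h => getD_inj hn (p := p) (q := x) (by omega) (by omega) h
      have e₂ := fun h => getD_inj hn (p := q) (q := y) (by omega) (by omega) h
      have e₃ := fun h => getD_inj hn (p := p) (q := y) (by omega) (by omega) h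
      have e₄ := fun h => getD_inj hn (p := q) (q := x) (by omega) (by omega) h
      omega
    · rw [hiff, List.mem_append, List.mem_singleton]
      constructor
      · rintro (h | rfl)
        exacts [.inl h, .inr ⟨hlt, rfl⟩]
      · rintro (h | h)
        exacts [.inl h, .inr h.2]
  · refine ⟨h.1, fun f => ?_⟩
    rw [hiff]
    constructor
    · exact .inl
    · rintro (h | ⟨h, rfl⟩)
      exacts [h, absurd h hlt]

/-- The new row starts at `y = x + 2`, before which it has no pair with `p < q`. -/
theorem EdgesUpTo.next {x : ℕ} (h : EdgesUpTo Γ ρ VL i x VL.length D) :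
    EdgesUpTo Γ ρ VL i (x + 1) (x + 2) D := by
  refine ⟨h.1, fun f => ?_⟩
  rw [h.2]
  refine and_congr_right fun _ => exists_congr fun p => exists_congr fun q => ?_
  constructor <;> rintro ⟨h₁, h₂, h₃, h₄⟩ <;> exact ⟨h₁, h₂, by omega, h₄⟩

theorem EdgesUpTo.isInstance {y : ℕ} (h : EdgesUpTo Γ ρ VL i VL.length y D)
    (hO : Γ.IsOrdering o ρ) (hn : VL.Nodup) : Γ.IsInstance ρ i VL D := by
  refine ⟨hn, h.1, fun f => ?_⟩
  rw [h.2]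
  constructor
  · rintro ⟨h₁, p, q, h₂, h₃, -, rfl⟩
    have h₆ := hO.E_ne_zero (u := VL[p]?.getD 0) (v := VL[q]?.getD 0) (by omega)
    have hp := getD_mem (by omega : p < VL.length)
    have hq := getD_mem h₃
    refine ⟨⟨by omega, Γ.E_le _ _⟩, h₁, ?_⟩
    rcases Γ.ends_of_E_ne_zero h₆ with h | h <;> rw [h.1, h.2]
    exacts [⟨hp, hq⟩, ⟨hq, hp⟩]
  · rintro ⟨⟨h₁, h₂⟩, h₃, h₄, h₅⟩
    obtain ⟨p, hp, hp'⟩ := List.getElem_of_mem h₄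
    obtain ⟨q, hq, hq'⟩ := List.getElem_of_mem h₅
    have hab := Γ.a_ne_b f h₁ h₂
    have hE := Γ.E_ab h₁ h₂
    refine ⟨h₃, ?_⟩
    rcases lt_trichotomy p q with hpq | rfl | hpq
    · refine ⟨p, q, hpq, hq, .inl hp, ?_⟩
      simp [hp, hq, hp', hq', hE]
    · exact absurd (hp'.symm.trans hq') hab
    · refine ⟨q, p, hpq, hp, .inl hq, ?_⟩
      simp [hp, hq, hp', hq', Γ.E_comm (Γ.b f), hE]

/-- Quadratically many pairs are tried, but only distinct edges are stored; this keeps the table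
`es` within `m` cells. -/
theorem EdgesUpTo.length_le {x y : ℕ} (h : EdgesUpTo Γ ρ VL i x y D) (hO : Γ.IsOrdering o ρ) :
    D.length ≤ Γ.m := by
  rw [← List.toFinset_card_of_nodup h.1]
  refine (Finset.card_le_card (t := Finset.Icc 1 Γ.m) fun f hf => ?_).trans (by simp)
  obtain ⟨h₁, p, q, -, -, -, rfl⟩ := (h.2 f).1 (List.mem_toFinset.1 hf)
  have := hO.E_ne_zero (u := VL[p]?.getD 0) (v := VL[q]?.getD 0) (by omega)
  exact Finset.mem_Icc.2 ⟨by omega, Γ.E_le _ _⟩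

theorem runs_collectEdges (hO : Γ.IsOrdering o ρ) (hg : HasGraph Γ s.mem)
    (hρ : ∀ f, s.mem .rank f 0 = ρ f)
    (hvs : ∀ x < VL.length, s.mem .vs x 0 = VL[x]?.getD 0) (hn : VL.Nodup) (hi : s.reg .i = i)
    (hnv : s.reg .nv = VL.length) (hne : s.reg .ne = 0) (hus : s.used ⊆ Γ.cells) :
    Runs P (loop .x 0 (.var .nv) [
        loop .y (.add (.var .x) 1) (.var .nv) [
          .set .f (.get .edge (rd .vs (.var .x)) (rd .vs (.var .y))),
          when (.lt (.var .i) (rd .rank (.var .f))) [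
            wr .es (.var .ne) (.var .f), wr .elev (.var .f) 1,
            .set .ne (.add (.var .ne) 1)]]]) s
      (10 + VL.length * (30 + VL.length * 50)) fun s' => ∃ D, Γ.IsInstance ρ i VL D ∧
        Collected Γ [.x, .y, .f, .ne] .es .elev .ne D s s' := by
  refine .loop_const (lov := 0) (hiv := VL.length) (fun x s' => s'.reg .x = x ∧ ∃ D,
      EdgesUpTo Γ ρ VL i x (x + 1) D ∧ Collected Γ [.x, .y, .f, .ne] .es .elev .ne D s s')
    (20 + VL.length * 50) rfl (by omega) (by decide) ?_ ?_ ?_ ?_ ?_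
  · refine ⟨by simp, [], ⟨by simp, fun f => ?_⟩, (Collected.nil hus hne).setReg (by simp) (by decide)⟩
    simp only [List.not_mem_nil, false_iff]
    rintro ⟨-, p, q, h₁, -, h₂, -⟩
    omega
  · rintro x s' ⟨h₁, D, -, h⟩
    exact ⟨h₁, by simp [h.reg .nv (by decide), hnv]⟩
  · rintro x s' - hx ⟨h₁, D, hD, h⟩
    refine .then (Ψ := fun s' => s'.reg .x = x ∧ ∃ D,
      EdgesUpTo Γ ρ VL i x VL.length D ∧ Collected Γ [.x, .y, .f, .ne] .es .elev .ne D s s')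
      (t₁ := 10 + VL.length * 50) (t₂ := 1) ?_ ?_ (by omega)
    · refine .loop_const (lov := x + 1) (hiv := VL.length) (fun y s' => s'.reg .y = y ∧
          s'.reg .x = x ∧ ∃ D,
          EdgesUpTo Γ ρ VL i x y D ∧ Collected Γ [.x, .y, .f, .ne] .es .elev .ne D s s')
        40 (by simp [h₁]) (by omega) (by decide) ⟨by simp, by simp [h₁], D, hD, h.setReg (by simp)
          (by decide)⟩ ?_ ?_ ?_ fun s' h => h.2
      · rintro y s' ⟨h₁, -, D, -, h⟩
        exact ⟨h₁, by simp [h.reg .nv (by decide), hnv]⟩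
      · rintro y s' hy₁ hy₂ ⟨h₁, h₂, D, hD, h⟩
        have hi' : s'.reg .i = i := by rw [h.reg _ (by decide), hi]
        have hrk : ∀ f, s'.mem .rank f 0 = ρ f := by
          rw [h.mem _ (by decide) (by decide)]; exact hρ
        have hed : ∀ x y, s'.mem .edge x y = Γ.E x y := by
          rw [h.mem _ (by decide) (by decide)]; exact hg.edge
        have hvs' : ∀ x < VL.length, s'.mem .vs x 0 = VL[x]?.getD 0 := by
          rw [h.mem _ (by decide) (by decide)]; exact hvs
        have hD' := hD.succ hO hn (by omega) hy₂
        obtain ⟨f, hf⟩ : ∃ f, f = Γ.E (VL[x]?.getD 0) (VL[y]?.getD 0) := ⟨_, rfl⟩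
        rw [← hf] at hD'
        refine .straight rfl (by decide)
          (.set f (by simp [h₁, h₂, hed, hvs' x hx, hvs' y hy₂, hf]) (.when (fun hp => ?_) fun hp => ?_))
        · simp [hi', hrk] at hp
          rw [if_pos hp] at hD'
          refine .store D.length 0 f (by simp [h.count]) rfl (by simp) (.store f 0 1 (by simp) rfl rfl
            (.set (D.length + 1) (by simp [h.count]) (.nil (.nil ⟨by simp [h₁], by simp, by simp [h₂],
            _, hD', ?_⟩))))
          refine ((h.setReg (by simp) (by decide)).append (by decide) (by simp)
            (Γ.mem_cells (by decide) ?_) (Γ.mem_cells (by decide) ?_)).setReg (by simp) (by decide)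
          · have := hD.length_le hO; omega
          · have := Γ.E_le (VL[x]?.getD 0) (VL[y]?.getD 0); omega
        · simp [hi', hrk] at hp
          rw [if_neg (by omega)] at hD'
          exact .nil ⟨by simp [h₁], by simp, by simp [h₂], _, hD', (h.setReg (by simp)
            (by decide)).setReg (by simp) (by decide)⟩
      · exact Nat.add_le_add_left (Nat.mul_le_mul_right _ (Nat.sub_le _ _)) _
    · rintro s' ⟨h₁, D, hD, h⟩
      exact .nil ⟨h₁, by simp, D, hD.next, h.setReg (by simp) (by decide)⟩ le_rfl
  · rw [Nat.sub_zero]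
    exact Nat.add_le_add_left (Nat.mul_le_mul_left _ (by omega)) _
  · rintro s' ⟨-, D, hD, h⟩
    exact ⟨D, hD.isInstance hO hn, h⟩

end EBBkCT

/-! ### The cliques listed by the top-level branches -/

namespace EBBkCT

open RAM

variable {Γ : NumGraph} {k : ℕ} {P : Cmd Reg Tab} {s s' : State Reg Tab} {T : ℕ}
  {Φ : State Reg Tab → Prop} {ρ o : ℕ → ℕ} {VL EL Es : List ℕ} {i u v l : ℕ} {out : List ℕ}

/-- Seen as an instance of rank bound `0`, the whole graph makes the lemmas on child instances
available for the top-level branches. -/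
theorem NumGraph.IsOrdering.isInstance (hO : Γ.IsOrdering o ρ) :
    Γ.IsInstance ρ 0 (List.range Γ.n) (List.range' 1 Γ.m) := by
  refine ⟨List.nodup_range, List.nodup_range', fun f => ?_⟩
  simp only [List.mem_range'_1, List.mem_range]
  constructor
  · rintro ⟨h₁, h₂⟩
    have := hO.rank_edge f h₁ (by omega)
    exact ⟨⟨h₁, by omega⟩, by omega, Γ.a_lt f h₁ (by omega), Γ.b_lt f h₁ (by omega)⟩
  · rintro ⟨h, -⟩
    omega

variable (Γ ρ) in
/-- `out` lists the `k`-cliques that contain an edge of rank less than `i`. -/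
def Lists (k i : ℕ) (out : List ℕ) : Prop :=
  ∃ Q : List (List ℕ), out = Q.flatten ∧ (∀ q ∈ Q, q.length = k) ∧ (Q.map List.toFinset).Nodup ∧
    ∀ K, K ∈ Q.map List.toFinset ↔ K ∈ Γ.cliques ρ 0 (List.range Γ.n) k ∧
      ∃ x ∈ K, ∃ y ∈ K, x ≠ y ∧ ρ (Γ.E x y) < i

theorem lists_one : Lists Γ ρ k 1 [] := by
  refine ⟨[], rfl, by simp, by simp, fun K => ?_⟩
  simp only [List.map_nil, List.not_mem_nil, false_iff]
  rintro ⟨hK, x, hx, y, hy, hxy, h⟩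
  have := (NumGraph.mem_cliques.1 hK).2.2 x hx y hy hxy
  omega

/-- The branch at position `i` contributes the cliques whose edge of smallest rank is `o i`. Those
listed before contain an edge of rank below `i`, so nothing is repeated. -/
theorem Lists.succ (h : Lists Γ ρ (l + 2) i out) (hO : Γ.IsOrdering o ρ) (hl : 1 ≤ l)
    (hi : 1 ≤ i) (him : i ≤ Γ.m) (hE : Γ.E u v = o i) (hI : Γ.IsInstance ρ i VL Es)
    (hV : ∀ w, w ∈ VL ↔ i < ρ (Γ.E u w) ∧ i < ρ (Γ.E v w)) :
    Lists Γ ρ (l + 2) (i + 1) (out ++ (Γ.cliqueLists ρ l VL Es).flatMap ([u, v] ++ ·)) := by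
  obtain ⟨Q, rfl, hQ₁, hQ₂, hQ₃⟩ := h
  obtain ⟨ho₁, ho₂, hoi⟩ := hO.edge_rank i hi him
  have hends := Γ.ends_of_E_ne_zero (u := u) (v := v) (by omega)
  rw [hE] at hends
  have hA := hO.isInstance
  have hmem : o i ∈ List.range' 1 Γ.m := by simp only [List.mem_range'_1]; omega
  have hcl : ∀ K, K ∈ Γ.cliques ρ (ρ (o i)) (Γ.childV ρ (List.range Γ.n) (o i)) l ↔
      K ∈ Γ.cliques ρ i VL l := by
    intro K
    have : ∀ x, x ∈ Γ.childV ρ (List.range Γ.n) (o i) ↔ x ∈ VL := by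
      intro x
      rw [NumGraph.mem_childV, hV, hoi, List.mem_range]
      have := fun h => (Γ.lt_of_E_ne_zero (hO.E_ne_zero (u := u) (v := x) h)).2
      rcases hends with h | h <;> rw [h.1, h.2] <;> constructor
      · exact fun h => h.2
      · exact fun h => ⟨this (by omega), h⟩
      · exact fun h => ⟨h.2.2, h.2.1⟩
      · exact fun h => ⟨this (by omega), h.2, h.1⟩
    simp only [NumGraph.mem_cliques, this, hoi]
  -- `loadEnds` may have exchanged the ends of the edge, which is immaterial for vertex sets.
  have hins : ∀ K : Finset ℕ, insert (Γ.a (o i)) (insert (Γ.b (o i)) K) =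
      insert u (insert v K) := by
    intro K
    rcases hends with h | h <;> rw [h.1, h.2]
    exact Finset.insert_comm _ _ _
  obtain ⟨hq₁, hq₂, hq₃⟩ := NumGraph.cliqueLists_spec hO hl hI
  have hcomp : (List.toFinset ∘ fun q => [u, v] ++ q) =
      (fun K => insert u (insert v K)) ∘ List.toFinset := by
    funext q; simp
  have hnew : ∀ K, K ∈ ((Γ.cliqueLists ρ l VL Es).map ([u, v] ++ ·)).map List.toFinset ↔
      K ∈ Γ.cliques ρ 0 (List.range Γ.n) (l + 2) ∧ (∀ x ∈ K, ∀ y ∈ K, x ≠ y → i ≤ ρ (Γ.E x y)) ∧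
      ∃ x ∈ K, ∃ y ∈ K, x ≠ y ∧ ρ (Γ.E x y) < i + 1 := by
    intro K
    rw [List.map_map, hcomp, ← List.map_map, List.mem_map]
    constructor
    · rintro ⟨K', hK', rfl⟩
      rw [hq₂, ← hcl] at hK'
      obtain ⟨-, h₁, h₂⟩ := hA.clique_of_child hmem hK' hO
      rw [hins] at h₁ h₂
      rw [hoi] at h₂
      exact ⟨h₁, h₂, u, by simp, v, by simp, Γ.ne_of_E_ne_zero (by omega), by rw [hE]; omega⟩
    · rintro ⟨h₁, h₂, x, hx, y, hy, hxy, h₃⟩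
      obtain ⟨e, he, K', hK', rfl⟩ := hA.child_of_clique h₁ hO
      have h₄ := (hA.clique_of_child he hK' hO).2.2 x hx y hy hxy
      have he' := (hA.mem_edges e).1 he
      have h₅ := h₂ (Γ.a e) (by simp) (Γ.b e) (by simp) (Γ.a_ne_b e he'.1.1 he'.1.2)
      rw [Γ.E_ab he'.1.1 he'.1.2] at h₅
      obtain rfl : e = o i := hO.rank_inj he'.1 ⟨ho₁, ho₂⟩ (by omega)
      exact ⟨K', by rw [hq₂, ← hcl]; exact hK', (hins K').symm⟩
  refine ⟨Q ++ (Γ.cliqueLists ρ l VL Es).map ([u, v] ++ ·), ?_, ?_, ?_, fun K => ?_⟩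
  · rw [List.flatten_append, List.flatMap_def]
  · intro q hq
    rw [List.mem_append, List.mem_map] at hq
    rcases hq with hq | ⟨q, hq, rfl⟩
    · exact hQ₁ q hq
    · simp [hq₁ q hq]
  · rw [List.map_append, List.nodup_append]
    refine ⟨hQ₂, ?_, ?_⟩
    · rw [List.map_map, hcomp, ← List.map_map]
      refine hq₃.map_on fun K₁ h₁ K₂ h₂ heq => ?_
      rw [hq₂, ← hcl] at h₁ h₂
      rw [← hins, ← hins] at heq
      exact (hA.child_unique hO hmem hmem h₁ h₂ heq).2
    · rintro K hK K' hK' rfl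
      obtain ⟨-, x, hx, y, hy, hxy, h₁⟩ := (hQ₃ K).1 hK
      have := ((hnew K).1 hK').2.1 x hx y hy hxy
      omega
  · rw [List.map_append, List.mem_append, hQ₃, hnew]
    constructor
    · rintro (⟨h₁, x, hx, y, hy, hxy, h₂⟩ | ⟨h₁, -, h₂⟩)
      · exact ⟨h₁, x, hx, y, hy, hxy, by omega⟩
      · exact ⟨h₁, h₂⟩
    · rintro ⟨h₁, h₂⟩
      by_cases h : ∃ x ∈ K, ∃ y ∈ K, x ≠ y ∧ ρ (Γ.E x y) < i
      · exact .inl ⟨h₁, h⟩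
      · push Not at h
        exact .inr ⟨h₁, h, h₂⟩

end EBBkCT

/-! ### The loop over the top-level branches -/

namespace EBBkCT

open RAM

variable {Γ : NumGraph} {k : ℕ} {P : Cmd Reg Tab} {s s' : State Reg Tab} {T : ℕ}
  {Φ : State Reg Tab → Prop} {ρ o : ℕ → ℕ} {VL EL Es : List ℕ} {i u v l : ℕ} {out : List ℕ}

/-- The commands carried out for one edge at the top level. -/
def topBody : List (Cmd Reg Tab) := [
  .set .e (rd .ord (.var .i)), loadEnds, .set .nv 0,
  loop .j 0 (rd .deg (.var .u)) [
    .set .w (.get .adj (.var .u) (.var .j)),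
    when (.and (.lt (.var .i) (rd .rank (.get .edge (.var .u) (.var .w))))
        (.lt (.var .i) (rd .rank (.get .edge (.var .v) (.var .w))))) [
      wr .vs (.var .nv) (.var .w), wr .vlev (.var .w) 1, .set .nv (.add (.var .nv) 1)]],
  .set .ne 0,
  when (.lt 3 (.var .k)) [
    loop .x 0 (.var .nv) [
      loop .y (.add (.var .x) 1) (.var .nv) [
        .set .f (.get .edge (rd .vs (.var .x)) (rd .vs (.var .y))),
        when (.lt (.var .i) (rd .rank (.var .f))) [
          wr .es (.var .ne) (.var .f), wr .elev (.var .f) 1,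
          .set .ne (.add (.var .ne) 1)]]]],
  wr .clique 0 (.var .u), wr .clique 1 (.var .v),
  .call [(.k, .var .k), (.l, .sub (.var .k) 2), (.d, 1), (.c, .var .nv), (.nv, .var .nv),
    (.ne, .var .ne)]]

theorem branchTop_eq : branchTop = loop .i 1 (.add (.var .m) 1) topBody := rfl

theorem NumGraph.IsOrdering.length_add_two_le (hO : Γ.IsOrdering o ρ) (hE : Γ.E u v ≠ 0)
    (hn : VL.Nodup) (hV : ∀ w, w ∈ VL ↔ i < ρ (Γ.E u w) ∧ i < ρ (Γ.E v w)) :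
    VL.length + 2 ≤ Γ.n := by
  have hlt := Γ.lt_of_E_ne_zero hE
  have : (u :: v :: VL).Nodup := by
    simp only [List.nodup_cons, List.mem_cons, not_or, hV, Γ.E_self, hO.rank_zero]
    exact ⟨⟨Γ.ne_of_E_ne_zero hE, by omega⟩, by omega, hn⟩
  have h := (this.subperm (l₂ := List.range Γ.n) (by
    intro x hx
    simp only [List.mem_cons, hV] at hx
    rw [List.mem_range]
    rcases hx with rfl | rfl | hx
    · exact hlt.1
    · exact hlt.2
    · exact (Γ.lt_of_E_ne_zero (hO.E_ne_zero (u := u) (v := x) (by omega))).2)).length_le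
  rw [List.length_range] at h
  exact h

/-- The term `loopCost` with `VL.length ^ 2` in `hB` pays for trying all pairs of vertices when the
edges of the instance are collected. -/
theorem runs_topBranch (hO : Γ.IsOrdering o ρ) {B : ℕ} (ht : TopLevel Γ k out s)
    (hg : HasGraph Γ s.mem) (hρ : ∀ f, s.mem .rank f 0 = ρ f) (ho : ∀ p, s.mem .ord p 0 = o p)
    (hk : 3 ≤ k) (hi : s.reg .i = i) (hi₁ : 1 ≤ i) (hi₂ : i ≤ Γ.m) (hl : Lists Γ ρ k i out)
    (hB : ∀ VL Es, Γ.IsInstance ρ i VL Es → VL.length = Γ.supp ρ i (o i) →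
      NumGraph.loopCost VL.length (VL.length ^ 2) (k - 2) +
        Γ.listCost ρ k VL.length Es.length (k - 2) VL Es ≤ B) :
    Runs listRec (block topBody) s (200 + 70 * Γ.minDeg (o i) + 400 * B) fun s' =>
      s'.reg .i = i ∧ (∃ out', TopLevel Γ k out' s' ∧ Lists Γ ρ k (i + 1) out') ∧
      ∀ t ∉ [Tab.vs, .vlev, .es, .elev, .clique], s'.mem t = s.mem t := by
  obtain ⟨l, rfl⟩ : ∃ l, k = l + 3 := ⟨k - 3, by omega⟩
  rw [show l + 3 - 2 = l + 1 by omega] at hB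
  obtain ⟨ho₁, ho₂, hoi⟩ := hO.edge_rank i hi₁ hi₂
  refine .take 3 (t₁ := 160 + 70 * Γ.minDeg (o i) + 400 * B)
    (.set (o i) (by simp [hi, ho]) (.cons (eff_loadEnds (e := o i) (by exact hg) (by simp) ho₁ ho₂
      fun u v hE hdeg => .set 0 rfl (.nil ?_)))) rfl
    (Nat.le_trans (Nat.add_le_add_right (show _ ≤ 40 by decide) _) (by omega))
  rw [← hdeg]
  refine .then (runs_collectVertices (ρ := ρ) (u := u) (v := v) (i := i) (by exact hg) hρ (by simp)
    (by simp) (by simpa using hi) (by simp) (by exact ht.used)) (t₂ := 150 + 400 * B) ?_ (by omega)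
  intro s₂ h₂
  obtain ⟨VL, hVL⟩ : ∃ VL, VL = (Γ.nbrs u).filter
    fun w => decide (i < ρ (Γ.E u w) ∧ i < ρ (Γ.E v w)) := ⟨_, rfl⟩
  rw [← hVL] at h₂
  have hV : ∀ w, w ∈ VL ↔ i < ρ (Γ.E u w) ∧ i < ρ (Γ.E v w) := by
    intro w
    rw [hVL, List.mem_filter, Γ.mem_nbrs, decide_eq_true_eq]
    exact ⟨fun h => h.2, fun h => ⟨hO.E_ne_zero (by omega), h⟩⟩
  have hn : VL.Nodup := by rw [hVL]; exact Γ.nodup_nbrs.filter _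
  -- The program asks for ranks greater than `i`, the support for ranks at least `i`. They agree
  -- because rank `i` belongs to the edge `uv` alone, and neither end is a common neighbour.
  have hsupp : VL.length = Γ.supp ρ i (o i) := by
    rw [Γ.supp_eq_common ρ i (by omega) hE, ← Γ.length_filter_nbrs (by rw [hO.rank_zero]; omega),
      hVL]
    congr 1
    refine List.filter_congr fun w _ => ?_
    have key : ∀ x y, Γ.E x y = o i → i ≤ ρ (Γ.E x w) → i ≤ ρ (Γ.E y w) → i ≠ ρ (Γ.E x w) := by
      intro x y hxy h₁ h₂ h₃
      have h₄ := hO.E_ne_zero (u := x) (v := w) (by omega)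
      have h₅ := hO.rank_inj ⟨ho₁, ho₂⟩ ⟨by omega, Γ.E_le x w⟩ (hoi.trans h₃)
      obtain rfl := Γ.E_inj (by omega) (hxy.trans h₅)
      rw [Γ.E_self, hO.rank_zero] at h₂
      omega
    have h₁ := key u v hE
    have h₂ := key v u ((Γ.E_comm _ _).trans hE)
    simp only [decide_eq_decide]
    omega
  have hlen := hO.length_add_two_le (by omega) hn hV
  have hm₂ : ∀ t, t ≠ .vs → t ≠ .vlev → s₂.mem t = s.mem t := h₂.mem
  have hn₂ : ∀ z ∈ [Reg.n, .m, .k, .i], s₂.reg z = s.reg z := by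
    intro z hz
    simp only [List.mem_cons, List.not_mem_nil, or_false] at hz
    rcases hz with rfl | rfl | rfl | rfl <;> rw [h₂.reg _ (by decide)] <;> simp
  have hk₂ : s₂.reg .k = l + 3 := by rw [hn₂ _ (by simp), ht.k]
  refine .take 1 (t₁ := 140 + 400 * B) (.set 0 rfl (.nil ?_)) rfl
    (Nat.le_trans (Nat.add_le_add_right (show _ ≤ 10 by decide) _) (by omega))
  -- For `k = 3` the program collects no edges; this list then serves as the edge list of the
  -- instance in the specification.
  have hI₀ : Γ.IsInstance ρ i VL ((List.range' 1 Γ.m).filter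
      fun f => decide (i < ρ f ∧ Γ.a f ∈ VL ∧ Γ.b f ∈ VL)) := by
    refine ⟨hn, List.Nodup.filter _ List.nodup_range', fun f => ?_⟩
    simp only [List.mem_filter, List.mem_range'_1, decide_eq_true_eq]
    exact and_congr_left fun _ => by omega
  -- `W` is the share of `B` spent on collecting the edges; `B - W` is left for the call.
  obtain ⟨W, hW⟩ : ∃ W, W = NumGraph.loopCost VL.length (VL.length ^ 2) (l + 1) := ⟨_, rfl⟩
  have hWB := hB VL _ hI₀ hsupp
  replace hB := fun Es h => hB VL Es h hsupp
  simp only [← hW] at hB hWB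
  refine .then (Ψ := fun s₃ => ∃ EL Es, Γ.IsInstance ρ i VL Es ∧ (l ≠ 0 → Es = EL) ∧
      (l = 0 → EL = []) ∧ Collected Γ [.x, .y, .f, .ne] .es .elev .ne EL (s₂.setReg .ne 0) s₃)
    (t₁ := 20 + 80 * W) (t₂ := 80 + 400 * (B - W)) ?_ ?_ (by omega)
  · by_cases hl : l = 0
    · refine .ite (t₁ := 1) (fun hlt => ?_) (fun _ => .skip ?_ le_rfl)
        (Nat.le_add_right_of_le (by decide))
      · simp [hk₂, hl] at hlt
      · exact ⟨[], _, hI₀, fun h => absurd hl h, fun _ => rfl, Collected.nil h₂.used (by simp)⟩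
    · refine .ite (t₁ := 11 + VL.length * (30 + VL.length * 50)) (fun _ => ?_) (fun hlt => ?_) ?_
      · refine .then (runs_collectEdges (VL := VL) (i := i) hO
          (hg.congr fun t ht => hm₂ t (by rintro rfl; simp at ht) (by rintro rfl; simp at ht))
          (fun f => by rw [setReg_mem, hm₂ _ (by decide) (by decide)]; exact hρ f)
          h₂.list hn (by simp [hn₂ .i, hi]) (by simp [h₂.count]) (by simp) h₂.used)
          (fun s₃ h₃ => .nil ?_ le_rfl) (by omega)
        obtain ⟨EL, hI, h₃⟩ := h₃
        exact ⟨EL, EL, hI, fun _ => rfl, fun h => absurd h hl, h₃⟩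
      · simp [hk₂] at hlt; omega
      · rw [hW, NumGraph.loopCost, if_pos (by omega)]
        simp only [Test.cost, Expr.cost]
        nlinarith
  · rintro s₃ ⟨EL, Es, hI, hEs, hEL, h₃⟩
    have hm₃ : ∀ t ∉ [Tab.vs, .vlev, .es, .elev], s₃.mem t = s.mem t := by
      intro t ht
      simp only [List.mem_cons, List.not_mem_nil, or_false, not_or] at ht
      rw [h₃.mem t (by simp [ht]) (by simp [ht]), setReg_mem, hm₂ t (by simp [ht]) (by simp [ht])]
    have hr₃ : ∀ z, z ≠ .x → z ≠ .y → z ≠ .f → z ≠ .ne → s₃.reg z = s₂.reg z := by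
      intro z h h' h'' h'''
      rw [h₃.reg z (by simp [h, h', h'', h''']), setReg_reg, if_neg h''']
    have hu₃ : s₃.reg .u = u := by
      rw [hr₃ _ (by decide) (by decide) (by decide) (by decide), h₂.reg _ (by decide)]; simp
    have hv₃ : s₃.reg .v = v := by
      rw [hr₃ _ (by decide) (by decide) (by decide) (by decide), h₂.reg _ (by decide)]; simp
    have hn₃ : ∀ z ∈ [Reg.n, .m, .k, .i], s₃.reg z = s.reg z := by
      intro z hz
      rw [← hn₂ z hz]
      simp only [List.mem_cons, List.not_mem_nil, or_false] at hz
      rcases hz with rfl | rfl | rfl | rfl <;> simp [hr₃]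
    have hk₃ : s₃.reg .k = l + 3 := by rw [hn₃ _ (by simp), ht.k]
    have hnv₃ : s₃.reg .nv = VL.length := by
      rw [hr₃ _ (by decide) (by decide) (by decide) (by decide), h₂.count]
    have hus₃ := h₃.used
    have hd₃ : s₃.depth = 1 := by rw [h₃.depth, setReg_depth, h₂.depth]; exact ht.depth
    have hmd₃ : s₃.maxDepth ≤ Γ.n + 1 := by
      rw [h₃.maxDepth, setReg_maxDepth, h₂.maxDepth]; exact ht.maxDepth
    have hout₃ : s₃.output = out := by
      rw [h₃.output, setReg_output, h₂.output]; exact ht.output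
    have hcost : 400 * Γ.listCost ρ (l + 3) VL.length EL.length (l + 1) VL Es ≤ 400 * (B - W) := by
      have := hB Es hI
      have h : Γ.listCost ρ (l + 3) VL.length EL.length (l + 1) VL Es =
          Γ.listCost ρ (l + 3) VL.length Es.length (l + 1) VL Es := by
        rcases Nat.eq_zero_or_pos l with rfl | hl
        · simp [NumGraph.listCost, NumGraph.loopCost]
        · rw [hEs (by omega)]
      omega
    refine .take 2 (t₁ := 70 + 400 * (B - W)) (.store 0 0 u rfl rfl (by simp [hu₃])
      (.store 1 0 v rfl rfl (by simp [hv₃]) (.nil ?_))) rfl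
      (Nat.le_trans (Nat.add_le_add_right (show _ ≤ 10 by decide) _) (by omega))
    have hmem : ∀ t ∉ [Tab.vs, .vlev, .es, .elev, .clique],
        ((s₃.setMem .clique 0 0 u).setMem .clique 1 0 v).mem t = s.mem t := by
      intro t ht
      simp only [List.mem_cons, List.not_mem_nil, or_false, not_or] at ht
      simp [ht, hm₃]
    obtain ⟨s₄, hs₄⟩ : ∃ s₄, s₄ = (s₃.setMem .clique 0 0 u).setMem .clique 1 0 v := ⟨_, rfl⟩
    rw [← hs₄] at hmem ⊢
    have hre₄ : s₄.reg = s₃.reg := by rw [hs₄]; rfl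
    have hm₄ : ∀ t, t ≠ .clique → s₄.mem t = s₃.mem t := by
      intro t ht; rw [hs₄, setMem_mem_ne _ _ _ _ _ ht, setMem_mem_ne _ _ _ _ _ ht]
    have hvlev : ∀ w ∈ VL, s₄.mem .vlev w 0 = 1 := by
      rw [hm₄ _ (by decide), h₃.mem _ (by decide) (by decide)]; exact h₂.level
    have helev : ∀ w ∈ EL, s₄.mem .elev w 0 = 1 := by
      rw [hm₄ _ (by decide)]; exact h₃.level
    have hbr : AtBranch Γ ρ VL EL (l + 3) (l + 1) i VL Es (s₄.enter [(.k, .var .k),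
        (.l, .sub (.var .k) 2), (.d, 1), (.c, .var .nv), (.nv, .var .nv), (.ne, .var .ne)]) := by
      refine ⟨hg.congr fun t ht => hmem t (by rintro h; simp at ht h; grind), fun f => ?_, ?_, ?_, hn,
        ?_, fun w hw => ?_, fun f hf => ?_, ?_, ?_, ?_, ?_, hI, ?_, ?_, ?_, ?_, by omega, ?_, ?_,
        ?_, ?_⟩
      · rw [← hρ f, ← hmem .rank (by decide)]; rfl
      · show ∀ x < VL.length, s₄.mem .vs x 0 = VL[x]?.getD 0
        rw [hm₄ _ (by decide), h₃.mem _ (by decide) (by decide)]; exact h₂.list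
      · show ∀ x < EL.length, s₄.mem .es x 0 = EL[x]?.getD 0
        rw [hm₄ _ (by decide)]; exact h₃.list
      · rcases Nat.eq_zero_or_pos l with hl | hl
        · rw [hEL hl]; simp
        · rw [← hEs (by omega)]; exact hI.nodup_edges
      · rw [hV] at hw
        exact (Γ.lt_of_E_ne_zero (hO.E_ne_zero (u := u) (v := w) (by omega))).2
      · rcases Nat.eq_zero_or_pos l with hl | hl
        · rw [hEL hl] at hf; simp at hf
        · rw [← hEs (by omega)] at hf; exact ((hI.mem_edges f).1 hf).1
      · exact fun w hw => (hvlev w hw).le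
      · exact fun w hw => (helev w hw).le
      · exact (List.filter_eq_self.2 fun w hw => by simpa [State.enter, frame] using hvlev w hw).symm
      · intro hl
        rw [hEs (by omega)]
        exact (List.filter_eq_self.2 fun w hw => by simpa [State.enter, frame] using helev w hw).symm
      · simp [State.enter, frame, hre₄, hk₃]
      · simp [State.enter, frame, hre₄, hk₃, Expr.eval]
      · simp [State.enter, frame, hre₄, hnv₃]
      · simp [State.enter, frame, hre₄, h₃.count]
      · rw [hs₄]
        simp only [State.enter, setMem_used, Finset.insert_subset_iff]
        exact ⟨Γ.mem_cells (by decide) (by omega), Γ.mem_cells (by decide) (by omega), hus₃⟩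
      · simp [State.enter, hs₄, hd₃]; omega
      · simp [State.enter, hs₄, hd₃, hmd₃]; omega
      · omega
    refine .then (Ψ := fun s₅ => s₅.reg = s₃.reg ∧ s₅.depth = 1 ∧ Listed Γ 2
        ((Γ.cliqueLists ρ (l + 1) VL Es).flatMap ([u, v] ++ ·)) s₄ s₅)
      (.call ((runs_listRec hO (by omega) hbr ?_).mono le_rfl ?_) (t := 20 + 400 * (B - W)) ?_)
      (t₂ := 1) ?_ (by omega)
    · simp [State.enter, frame, hre₄, hnv₃]
    · intro s₅ h₅
      rw [show l + 3 - (l + 1) = 2 by omega] at h₅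
      have hpre : prefixOf s₄.mem 2 = [u, v] := by simp [prefixOf, List.range_succ, hs₄]
      refine ⟨hre₄, by rw [← hd₃]; exact hs₄ ▸ rfl, h₅.mem, h₅.clique, h₅.used, ?_, rfl, h₅.maxDepth⟩
      rw [← hpre]
      exact h₅.output
    · have : argsCost [(Reg.k, Expr.var Reg.k), (.l, .sub (.var .k) 2), (.d, 1),
          (.c, .var .nv), (.nv, .var .nv), (.ne, (.var .ne : Expr Reg Tab))] + 1 ≤ 20 := by decide
      omega
    · rintro s₅ ⟨hr₅, hd₅, h₅⟩
      refine .nil ⟨by rw [hr₅, hn₃ _ (by simp), hi], ⟨_, ht.congr ?_ ?_ ?_ h₅.used h₅.output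
        (hd₅.trans ht.depth.symm) h₅.maxDepth, ?_⟩, fun t ht => ?_⟩ le_rfl
      · rw [hr₅, hn₃ _ (by simp)]
      · rw [hr₅, hn₃ _ (by simp)]
      · rw [hr₅, hn₃ _ (by simp)]
      · have := hl.succ hO (by omega) hi₁ hi₂ hE hI hV
        rw [show s₄.output = out by rw [hs₄]; exact hout₃]
        exact this
      · rw [h₅.mem t (by rintro rfl; simp at ht), hmem t ht]

theorem runs_branchTop (hO : Γ.IsOrdering o ρ) {B : ℕ} (ht : TopLevel Γ k [] s)
    (hg : HasGraph Γ s.mem) (hρ : ∀ f, s.mem .rank f 0 = ρ f) (ho : ∀ p, s.mem .ord p 0 = o p)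
    (hk : 3 ≤ k)
    (hB : ∀ i VL Es, 1 ≤ i → i ≤ Γ.m → Γ.IsInstance ρ i VL Es → VL.length = Γ.supp ρ i (o i) →
      NumGraph.loopCost VL.length (VL.length ^ 2) (k - 2) +
        Γ.listCost ρ k VL.length Es.length (k - 2) VL Es ≤ B) :
    Runs listRec branchTop s
      (10 + Γ.m * (210 + 400 * B) + 70 * ∑ e ∈ Finset.Icc 1 Γ.m, Γ.minDeg e) fun s' =>
      (∃ out', TopLevel Γ k out' s' ∧ Lists Γ ρ k (Γ.m + 1) out') ∧
      ∀ t ∉ [Tab.vs, .vlev, .es, .elev, .clique], s'.mem t = s.mem t := by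
  conv => arg 2; rw [branchTop_eq]
  refine .loop (lov := 1) (hiv := Γ.m + 1) (fun i s' => s'.reg .i = i ∧
      (∃ out', TopLevel Γ k out' s' ∧ Lists Γ ρ k i out') ∧
      ∀ t ∉ [Tab.vs, .vlev, .es, .elev, .clique], s'.mem t = s.mem t)
    (fun i => 200 + 70 * Γ.minDeg (o i) + 400 * B) rfl (by omega) (by decide)
    ⟨by simp, ⟨[], ht.congr rfl rfl rfl ht.used ht.output rfl ht.maxDepth, lists_one⟩,
      fun _ _ => rfl⟩
    ?_ ?_ ?_ fun s' h => h.2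
  · rintro i s' ⟨h₁, ⟨out', h₂, -⟩, -⟩
    exact ⟨h₁, by simp [h₂.m]⟩
  · rintro i s' hi₁ hi₂ ⟨h₁, ⟨out', h₂, h₃⟩, h₄⟩
    refine (runs_topBranch hO h₂ (hg.congr fun t ht => h₄ t (by rintro h; simp at ht h; grind))
      (fun f => by rw [h₄ _ (by decide), hρ]) (fun p => by rw [h₄ _ (by decide), ho]) hk h₁ hi₁
      (by omega) h₃ fun VL Es => hB i VL Es hi₁ (by omega)).mono le_rfl ?_
    rintro s'' ⟨h₅, ⟨out'', h₆, h₇⟩, h₈⟩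
    exact ⟨h₅, by simp, ⟨out'', h₆.congr rfl rfl rfl h₆.used h₆.output rfl h₆.maxDepth, h₇⟩,
      fun t ht => (h₈ t ht).trans (h₄ t ht)⟩
  · rw [← hO.sum_comp]
    simp only [Finset.sum_add_distrib, ← Finset.mul_sum, Finset.sum_const, Nat.card_Ico, smul_eq_mul]
    simp
    nlinarith

end EBBkCT

/-! ### Truss-based edge orderings and the degeneracy -/

section truss

variable {V : Type*} {l l₁ p p' : List (Sym2 V)} {e f : Sym2 V} {x y w : V}

theorem support_mk : support l s(x, y) = {w | (s(w, x) ∈ l ∧ w ≠ x) ∧ s(w, y) ∈ l ∧ w ≠ y}.ncard := by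
  rw [support]
  congr 1
  ext w
  simp [commonNbrs, SimpleGraph.fromEdgeSet_adj]

theorem support_mono [Finite V] (h : ∀ f ∈ l, f ∈ l₁) : support l e ≤ support l₁ e := by
  induction e using Sym2.ind with
  | _ x y =>
    rw [support_mk, support_mk]
    exact Set.ncard_le_ncard (fun w hw => ⟨⟨h _ hw.1.1, hw.1.2⟩, h _ hw.2.1, hw.2.2⟩)
      (Set.toFinite _)

theorem isGreedy_iff : IsGreedy p ↔ ∀ l₁ e l, p = l₁ ++ e :: l →
    ∀ f ∈ e :: l, support (e :: l) e ≤ support (e :: l) f := by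
  induction p with
  | nil => simp [IsGreedy]
  | cons e p ih =>
    rw [IsGreedy, ih]
    constructor
    · rintro ⟨h₁, h₂⟩ (_ | ⟨e', l₁⟩) e'' l heq
      · simp only [List.nil_append, List.cons.injEq] at heq
        obtain ⟨rfl, rfl⟩ := heq
        exact h₁
      · simp only [List.cons_append, List.cons.injEq] at heq
        exact h₂ l₁ e'' l heq.2
    · exact fun h => ⟨h [] e p rfl, fun l₁ e' l heq => h (e :: l₁) e' l (by rw [heq]; rfl)⟩

theorem support_le_tau (h : p = l₁ ++ e :: l) : support (e :: l) e ≤ tau p := by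
  subst h
  induction l₁ with
  | nil => exact le_max_left _ _
  | cons f l₁ ih => exact ih.trans (le_max_right _ _)

theorem exists_tau_eq (h : p ≠ []) : ∃ l₁ e l, p = l₁ ++ e :: l ∧ tau p = support (e :: l) e := by
  induction p with
  | nil => exact absurd rfl h
  | cons e p ih =>
    rcases le_total (tau p) (support (e :: p) e) with hle | hle
    · exact ⟨[], e, p, rfl, max_eq_left hle⟩
    · rcases eq_or_ne p [] with rfl | hp
      · exact ⟨[], e, [], rfl, by simp [tau]⟩
      · obtain ⟨l₁, e', l, h₁, h₂⟩ := ih hp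
        exact ⟨e :: l₁, e', l, by rw [h₁]; rfl, by rw [← h₂]; exact max_eq_right hle⟩

/-- When the first edge of `l` in the order `p` is removed, all of `l` is still present, so its
support at that moment is at least its support within `l`. -/
theorem le_tau_of_support [Finite V] {t : ℕ} (hl : l ≠ []) (hlp : ∀ f ∈ l, f ∈ p)
    (h : ∀ f ∈ l, t ≤ support l f) : t ≤ tau p := by
  induction p with
  | nil => exact absurd (List.eq_nil_iff_forall_not_mem.2 fun f hf => by simpa using hlp f hf) hl
  | cons e p ih =>
    by_cases he : e ∈ l
    · exact (h e he).trans ((support_mono hlp).trans (le_max_left _ _))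
    · refine (ih fun f hf => ?_).trans (le_max_right _ _)
      rcases List.mem_cons.1 (hlp f hf) with rfl | h'
      exacts [absurd hf he, h']

/-- Some of the last edges of the ordering form a graph in which all supports are at least `τ`. -/
theorem IsGreedy.exists_support (hg : IsGreedy p) (h : p ≠ []) : ∃ l ≠ [], (∀ f ∈ l, f ∈ p) ∧
    ∀ f ∈ l, tau p ≤ support l f := by
  obtain ⟨l₁, e, l, h₁, h₂⟩ := exists_tau_eq h
  refine ⟨e :: l, by simp, fun f hf => ?_, fun f hf => ?_⟩
  · rw [h₁]; exact List.mem_append_right _ hf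
  · rw [h₂]; exact isGreedy_iff.1 hg l₁ e l h₁ f hf

variable {G : SimpleGraph V}

/-- A subgraph with all supports at least `tau p` forces every ordering of the same edges to reach
this value. By symmetry `tau` does not depend on how ties are broken. -/
theorem IsTrussOrdering.tau_le [Finite V] (h : IsTrussOrdering G p) (h' : IsTrussOrdering G p') :
    tau p ≤ tau p' := by
  rcases eq_or_ne p [] with rfl | hp
  · exact Nat.zero_le _
  · obtain ⟨l, h₁, h₂, h₃⟩ := h.2.2.exists_support hp
    exact le_tau_of_support h₁ (fun f hf => (h'.2.1 f).2 ((h.2.1 f).1 (h₂ f hf))) h₃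

theorem le_degeneracy [Finite V] {d : ℕ} {s : Finset V} (hs : s.Nonempty)
    (h : ∀ v ∈ s, d ≤ {w | w ∈ s ∧ G.Adj v w}.ncard) : d ≤ degeneracy G := by
  refine le_csSup ⟨Nat.card V, ?_⟩ ⟨s, hs, h⟩
  rintro d ⟨s, ⟨v, hv⟩, h⟩
  refine (h v hv).trans ((Set.ncard_le_ncard (Set.subset_univ _) (Set.toFinite _)).trans ?_)
  rw [Set.ncard_univ]

theorem IsTrussOrdering.tau_lt_degeneracy [Finite V] (h : IsTrussOrdering G p)
    (hG : G.edgeSet.Nonempty) : tau p < degeneracy G := by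
  have hp : p ≠ [] := by
    rintro rfl
    obtain ⟨e, he⟩ := hG
    simpa using (h.2.1 e).2 he
  obtain ⟨l, h₁, h₂, h₃⟩ := h.2.2.exists_support hp
  have hadj : ∀ x y, s(x, y) ∈ l → G.Adj x y := fun x y hxy => (h.2.1 _).1 (h₂ _ hxy)
  have hfin : {v | ∃ w, s(v, w) ∈ l}.Finite := Set.toFinite _
  refine le_degeneracy (s := hfin.toFinset) ?_ fun v hv => ?_
  · obtain ⟨e, he⟩ := List.exists_mem_of_ne_nil l h₁
    induction e using Sym2.ind with
    | _ x y => exact ⟨x, by simpa using ⟨y, he⟩⟩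
  · simp only [Set.Finite.mem_toFinset, Set.mem_ofPred_eq] at hv ⊢
    obtain ⟨x, hx⟩ := hv
    have h₄ := h₃ _ hx
    rw [support_mk] at h₄
    refine (Nat.succ_le_succ h₄).trans ?_
    -- The neighbour `x` itself comes on top of the common neighbours of `v` and `x`, which makes
    -- the inequality strict.
    rw [Nat.succ_eq_add_one, ← Set.ncard_insert_of_notMem (a := x)
      (by rintro ⟨-, -, h⟩; exact h rfl) (Set.toFinite _)]
    refine Set.ncard_le_ncard (fun w hw => ?_) (Set.toFinite _)
    rcases hw with rfl | ⟨⟨h₅, -⟩, h₆, -⟩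
    · exact ⟨⟨v, by rwa [Sym2.eq_swap]⟩, hadj _ _ hx⟩
    · exact ⟨⟨v, h₅⟩, (hadj _ _ h₅).symm⟩

/-- Otherwise `s` would witness degeneracy at least one larger. This supplies the vertex split off
in `NumGraph.sum_minDeg_le`. -/
theorem exists_ncard_le_degeneracy [Finite V] {s : Finset V} (hs : s.Nonempty) :
    ∃ v ∈ s, {w | w ∈ s ∧ G.Adj v w}.ncard ≤ degeneracy G := by
  by_contra! h
  exact (le_degeneracy (d := degeneracy G + 1) hs h).not_gt (Nat.lt_succ_self _)

end truss

/-! ### The graph given by a list of edges -/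

namespace EBBkCT

open RAM

section edgeList

variable {n : ℕ} {G : SimpleGraph (Fin n)} {L : List (Fin n × Fin n)} {e f : ℕ} {x y : Fin n}

open Classical in
/-- The number of the edge between `u` and `v`. -/
noncomputable def edgeNumber (L : List (Fin n × Fin n)) (u v : ℕ) : ℕ :=
  if h : ∃ e, 1 ≤ e ∧ e ≤ L.length ∧
    ((L.map fun p => (p.1 : ℕ)).getD (e - 1) 0 = u ∧ (L.map fun p => (p.2 : ℕ)).getD (e - 1) 0 = v ∨
      (L.map fun p => (p.1 : ℕ)).getD (e - 1) 0 = v ∧ (L.map fun p => (p.2 : ℕ)).getD (e - 1) 0 = u)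
  then h.choose else 0

theorem getD_edgeList (he : 1 ≤ e) (he' : e ≤ L.length) :
    (L.map fun p => (p.1 : ℕ)).getD (e - 1) 0 = (L[e - 1]'(by omega)).1 ∧
    (L.map fun p => (p.2 : ℕ)).getD (e - 1) 0 = (L[e - 1]'(by omega)).2 := by
  have : e - 1 < L.length := by omega
  simp [List.getD_eq_getElem?_getD, List.getElem?_map, List.getElem?_eq_getElem this]

theorem IsEdgeList.adj (hL : IsEdgeList G L) (he : e < L.length) : G.Adj L[e].1 L[e].2 := by
  rw [← SimpleGraph.mem_edgeSet, ← hL.2]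
  exact List.mem_map_of_mem (List.getElem_mem he)

theorem IsEdgeList.index_unique (hL : IsEdgeList G L) (he : e < L.length) (hf : f < L.length)
    (h : s(L[e].1, L[e].2) = s(L[f].1, L[f].2)) : e = f := by
  have := (hL.1.getElem_inj_iff (i := e) (hi := by simpa using he) (j := f)
    (hj := by simpa using hf)).1
  simp only [List.getElem_map] at this
  exact this h

/-- The graph with the edges in the list `L`. -/
noncomputable def IsEdgeList.numGraph (hL : IsEdgeList G L) : NumGraph where
  n := n
  m := L.length
  a e := (L.map fun p => (p.1 : ℕ)).getD (e - 1) 0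
  b e := (L.map fun p => (p.2 : ℕ)).getD (e - 1) 0
  E := edgeNumber L
  a_lt e h₁ h₂ := by rw [(getD_edgeList h₁ h₂).1]; exact Fin.is_lt _
  b_lt e h₁ h₂ := by rw [(getD_edgeList h₁ h₂).2]; exact Fin.is_lt _
  a_ne_b e h₁ h₂ := by
    rw [(getD_edgeList h₁ h₂).1, (getD_edgeList h₁ h₂).2]
    exact Fin.val_injective.ne (hL.adj _).ne
  E_eq_iff u v e he := by
    -- The edge list has no repetition in either orientation, so the number chosen in `edgeNumber`
    -- is the only possible one.
    have huniq : ∀ {e f : ℕ}, 1 ≤ e → e ≤ L.length → 1 ≤ f → f ≤ L.length →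
        ((L.map fun p => (p.1 : ℕ)).getD (e - 1) 0 = u ∧
          (L.map fun p => (p.2 : ℕ)).getD (e - 1) 0 = v ∨
        (L.map fun p => (p.1 : ℕ)).getD (e - 1) 0 = v ∧
          (L.map fun p => (p.2 : ℕ)).getD (e - 1) 0 = u) →
        ((L.map fun p => (p.1 : ℕ)).getD (f - 1) 0 = u ∧
          (L.map fun p => (p.2 : ℕ)).getD (f - 1) 0 = v ∨
        (L.map fun p => (p.1 : ℕ)).getD (f - 1) 0 = v ∧
          (L.map fun p => (p.2 : ℕ)).getD (f - 1) 0 = u) → e = f := by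
      intro e f h₁ h₂ h₃ h₄ h h'
      rw [(getD_edgeList h₁ h₂).1, (getD_edgeList h₁ h₂).2] at h
      rw [(getD_edgeList h₃ h₄).1, (getD_edgeList h₃ h₄).2] at h'
      have := hL.index_unique (e := e - 1) (f := f - 1) (by omega) (by omega) (by
        rw [Sym2.eq_iff, Fin.ext_iff, Fin.ext_iff, Fin.ext_iff, Fin.ext_iff]
        omega)
      omega
    rw [edgeNumber]
    split_ifs with h
    · obtain ⟨h₁, h₂, h₃⟩ := h.choose_spec
      constructor
      · rintro rfl
        exact ⟨h₂, h₃⟩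
      · exact fun h' => huniq h₁ h₂ (by omega) h'.1 h₃ h'.2
    · refine ⟨fun h' => absurd h'.symm he, fun h' => absurd ⟨e, by omega, h'⟩ h⟩

variable (hL : IsEdgeList G L)

theorem numGraph_a (he : e < L.length) : hL.numGraph.a (e + 1) = L[e].1 :=
  (getD_edgeList (by omega) (by omega)).1

theorem numGraph_b (he : e < L.length) : hL.numGraph.b (e + 1) = L[e].2 :=
  (getD_edgeList (by omega) (by omega)).2

theorem IsEdgeList.adj_iff : G.Adj x y ↔ hL.numGraph.E x y ≠ 0 := by
  rw [← SimpleGraph.mem_edgeSet, ← hL.2, List.mem_iff_getElem]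
  constructor
  · rintro ⟨i, hi, h⟩
    rw [List.length_map] at hi
    have : hL.numGraph.E x y = i + 1 := by
      rw [hL.numGraph.E_eq_iff _ _ _ (by omega), numGraph_a hL hi, numGraph_b hL hi]
      rw [List.getElem_map, Sym2.eq_iff] at h
      exact ⟨hi, by simpa only [Fin.val_inj] using h⟩
    omega
  · intro h
    obtain ⟨e, he⟩ : ∃ e, hL.numGraph.E x y = e + 1 := ⟨_, (Nat.succ_pred h).symm⟩
    obtain ⟨h₁, h₂⟩ := (hL.numGraph.E_eq_iff _ _ _ (by omega)).1 he
    replace h₁ : e < L.length := h₁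
    rw [numGraph_a hL h₁, numGraph_b hL h₁] at h₂
    refine ⟨e, by simpa using h₁, ?_⟩
    rw [List.getElem_map, Sym2.eq_iff]
    simpa only [Fin.val_inj] using h₂

/-- The edges number `o 1, …, o m`. -/
def edgeSeq (L : List (Fin n × Fin n)) (d : Sym2 (Fin n)) (o : ℕ → ℕ) : List (Sym2 (Fin n)) :=
  (List.range L.length).map fun i => (L.map fun p => s(p.1, p.2)).getD (o (i + 1) - 1) d

variable {d : Sym2 (Fin n)} {o ρ : ℕ → ℕ} {i : ℕ}

theorem getD_eq_iff (he : 1 ≤ e) (he' : e ≤ L.length) :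
    (L.map fun p => s(p.1, p.2)).getD (e - 1) d = s(x, y) ↔ hL.numGraph.E x y = e := by
  obtain ⟨e, rfl⟩ : ∃ e', e = e' + 1 := ⟨e - 1, by omega⟩
  rw [hL.numGraph.E_eq_iff _ _ _ (by omega), numGraph_a hL he', numGraph_b hL he']
  have : e < L.length := by omega
  rw [List.getD_eq_getElem?_getD, Nat.add_sub_cancel, List.getElem?_map,
    List.getElem?_eq_getElem this, Option.map_some, Option.getD_some, Sym2.eq_iff]
  simp only [Fin.val_inj]
  exact (and_iff_right he').symm

variable {hL}

/-- List indices start at `0` and ranks at `1`: the suffix from index `i` on is the remaining graph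
at threshold `i + 1`. All facts about suffixes of the ordering are translated through this. -/
theorem mem_drop_edgeSeq (hO : hL.numGraph.IsOrdering o ρ) :
    s(x, y) ∈ (edgeSeq L d o).drop i ↔ i + 1 ≤ ρ (hL.numGraph.E x y) := by
  rw [edgeSeq, ← List.map_drop, List.mem_map]
  simp only [List.mem_iff_getElem, List.getElem_drop, List.getElem_range, List.length_drop,
    List.length_range]
  constructor
  · rintro ⟨_, ⟨j, hj, rfl⟩, h⟩
    obtain ⟨h₁, h₂, h₃⟩ := hO.edge_rank (i + j + 1) (by omega) (by
      have : hL.numGraph.m = L.length := rfl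
      omega)
    rw [getD_eq_iff hL h₁ h₂] at h
    rw [h, h₃]
    omega
  · intro h
    have h₀ := hO.E_ne_zero (u := x) (v := y) (by omega)
    obtain ⟨h₁, h₂, h₃⟩ := hO.rank_edge _ (Nat.pos_of_ne_zero h₀) (hL.numGraph.E_le x y)
    replace h₂ : ρ (hL.numGraph.E x y) ≤ L.length := h₂
    refine ⟨ρ (hL.numGraph.E x y) - 1, ⟨ρ (hL.numGraph.E x y) - 1 - i, by omega, by omega⟩, ?_⟩
    rw [Nat.sub_add_cancel h₁, h₃]
    exact (getD_eq_iff hL (Nat.pos_of_ne_zero h₀) (hL.numGraph.E_le x y)).2 rfl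

theorem mem_edgeSeq (hO : hL.numGraph.IsOrdering o ρ) (e : Sym2 (Fin n)) :
    e ∈ edgeSeq L d o ↔ e ∈ G.edgeSet := by
  induction e using Sym2.ind with
  | _ x y =>
    rw [← List.drop_zero (l := edgeSeq L d o), mem_drop_edgeSeq hO, SimpleGraph.mem_edgeSet,
      hL.adj_iff]
    refine ⟨fun h => hO.E_ne_zero (by omega), fun h => ?_⟩
    have := hO.rank_edge _ (Nat.pos_of_ne_zero h) (hL.numGraph.E_le x y)
    omega

theorem support_drop_edgeSeq (hO : hL.numGraph.IsOrdering o ρ)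
    (h : hL.numGraph.E x y ≠ 0) :
    support ((edgeSeq L d o).drop i) s(x, y) = hL.numGraph.supp ρ (i + 1) (hL.numGraph.E x y) := by
  classical
  rw [support_mk, hL.numGraph.supp_eq_common _ _ h rfl, NumGraph.common]
  have : {w | (s(w, x) ∈ (edgeSeq L d o).drop i ∧ w ≠ x) ∧ s(w, y) ∈ (edgeSeq L d o).drop i ∧
      w ≠ y} = (((Finset.univ : Finset (Fin n)).filter fun w : Fin n =>
        i + 1 ≤ ρ (hL.numGraph.E x w) ∧ i + 1 ≤ ρ (hL.numGraph.E y w) :) : Set (Fin n)) := by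
    ext w
    simp only [Set.mem_ofPred_eq, mem_drop_edgeSeq hO, Finset.coe_filter, Finset.mem_univ, true_and]
    rw [hL.numGraph.E_comm w x, hL.numGraph.E_comm w y]
    constructor
    · exact fun h => ⟨h.1.1, h.2.1⟩
    · rintro ⟨h₁, h₂⟩
      refine ⟨⟨h₁, ?_⟩, h₂, ?_⟩
      · rintro rfl; rw [hL.numGraph.E_self, hO.rank_zero] at h₁; omega
      · rintro rfl; rw [hL.numGraph.E_self, hO.rank_zero] at h₂; omega
  rw [this, Set.ncard_coe_finset, ← Finset.card_map Fin.valEmbedding]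
  congr 1
  ext w
  simp only [Finset.mem_map, Finset.mem_filter, Finset.mem_univ, true_and, Fin.valEmbedding_apply,
    Finset.mem_range]
  constructor
  · rintro ⟨w, h, rfl⟩
    exact ⟨w.2, h⟩
  · rintro ⟨h, h'⟩
    exact ⟨⟨w, h⟩, h', rfl⟩

/-- Brings a split of the list, as in `isGreedy_iff` and `support_le_tau`, into the form of a suffix
whose head is the edge at a known position. -/
theorem edgeSeq_split (hO : hL.numGraph.IsOrdering o ρ)
    {l₁ l : List (Sym2 (Fin n))} {e : Sym2 (Fin n)}
    (h : edgeSeq L d o = l₁ ++ e :: l) : ∃ x y, e = s(x, y) ∧ l₁.length < L.length ∧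
      e :: l = (edgeSeq L d o).drop l₁.length ∧ hL.numGraph.E x y = o (l₁.length + 1) := by
  have hlen : l₁.length < L.length := by
    have := congrArg List.length h
    simp [edgeSeq] at this
    omega
  obtain ⟨h₁, h₂, -⟩ := hO.edge_rank (l₁.length + 1) (by omega) hlen
  have he : e = (L.map fun p => s(p.1, p.2)).getD (o (l₁.length + 1) - 1) d := by
    have h₃ : (edgeSeq L d o)[l₁.length]? = some e := by rw [h]; simp
    rw [edgeSeq, List.getElem?_map, List.getElem?_range hlen, Option.map_some, Option.some_inj] at h₃
    exact h₃.symm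
  refine ⟨e.out.1, e.out.2, (Quot.out_eq e).symm, hlen, by rw [h]; simp, ?_⟩
  rw [← getD_eq_iff hL h₁ h₂ (d := d), ← he]
  exact (Quot.out_eq e).symm

theorem supp_le_tau (hO : hL.numGraph.IsOrdering o ρ)
    (hi : 1 ≤ i) (hi' : i ≤ L.length) :
    hL.numGraph.supp ρ i (o i) ≤ tau (edgeSeq L d o) := by
  have hlen : (edgeSeq L d o).length = L.length := by simp [edgeSeq]
  obtain ⟨j, rfl⟩ : ∃ j, i = j + 1 := ⟨i - 1, by omega⟩
  have h := (List.take_append_drop j (edgeSeq L d o)).symm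
  rw [List.drop_eq_getElem_cons (by omega)] at h
  obtain ⟨x, y, h₁, h₂, h₃, h₄⟩ := edgeSeq_split hO h
  have hj : ((edgeSeq L d o).take j).length = j := by simp; omega
  rw [hj] at h₂ h₃ h₄
  have h₅ := support_le_tau h
  rw [h₃, h₁, support_drop_edgeSeq hO, h₄] at h₅
  · exact h₅
  · have := hO.edge_rank (j + 1) (by omega) hi'
    omega

theorem isTrussOrdering_edgeSeq (hO : hL.numGraph.IsOrdering o ρ)
    (hg : hL.numGraph.Greedy o ρ L.length) :
    IsTrussOrdering G (edgeSeq L d o) := by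
  refine ⟨?_, mem_edgeSeq hO, isGreedy_iff.2 fun l₁ e l h f hf => ?_⟩
  · refine List.Nodup.map_on (fun i hi j hj hij => ?_) List.nodup_range
    rw [List.mem_range] at hi hj
    obtain ⟨h₁, h₂, h₃⟩ := hO.edge_rank (i + 1) (by omega) hi
    obtain ⟨h₄, h₅, h₆⟩ := hO.edge_rank (j + 1) (by omega) hj
    obtain ⟨x, y, hxy⟩ : ∃ x y, (L.map fun p => s(p.1, p.2)).getD (o (i + 1) - 1) d = s(x, y) :=
      ⟨_, _, (Quot.out_eq _).symm⟩
    rw [hxy, eq_comm, getD_eq_iff hL h₄ h₅] at hij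
    rw [getD_eq_iff hL h₁ h₂, hij] at hxy
    rw [hxy] at h₆
    omega
  · obtain ⟨x, y, rfl, h₂, h₃, h₄⟩ := edgeSeq_split hO h
    rw [h₃] at hf ⊢
    induction f using Sym2.ind with
    | _ x' y' =>
      rw [mem_drop_edgeSeq hO] at hf
      have h₅ := hO.E_ne_zero (u := x') (v := y') (by omega)
      have h₆ := hO.edge_rank (l₁.length + 1) (by omega) h₂
      rw [support_drop_edgeSeq hO (by omega), support_drop_edgeSeq hO h₅, h₄]
      exact hg _ (by omega) h₂ _ (Nat.pos_of_ne_zero h₅) (hL.numGraph.E_le _ _) hf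

end edgeList

end EBBkCT

/-! ### The whole algorithm -/

namespace EBBkCT

open RAM

variable {Γ : NumGraph} {k t : ℕ} {s : State Reg Tab}

/-- A bound on the time taken by a top-level branch whose instance has at most `t` vertices, up to
a constant factor. -/
noncomputable def branchCost (k t : ℕ) : ℕ := ⌊20 + 40 * (k : ℝ) * ((t : ℝ) / 2) ^ (k - 2)⌋₊

/-- The ordering that the program will compute is not known beforehand, so `hτ` bounds the instance
sizes for every greedy ordering. -/
theorem runs_program (ht : TopLevel Γ k [] s) (hg : HasGraphUpTo Γ 0 s.mem)
    (h0 : ∀ a, a ≠ .src → a ≠ .dst → ∀ i, s.mem a i 0 = 0) (hk : 3 ≤ k)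
    (hτ : ∀ o ρ, Γ.IsOrdering o ρ → Γ.Greedy o ρ Γ.m →
      ∀ i, 1 ≤ i → i ≤ Γ.m → Γ.supp ρ i (o i) ≤ t) :
    Runs listRec program s
      (91 + Γ.m * (550 + 400 * branchCost k t) + 310 * ∑ e ∈ Finset.Icc 1 Γ.m, Γ.minDeg e)
      fun s' => HasGraph Γ s'.mem ∧ ∃ out, TopLevel Γ k out s' ∧ ∃ ρ,
        Γ.IsOrdering (s'.mem .ord · 0) ρ ∧ Γ.Greedy (s'.mem .ord · 0) ρ Γ.m ∧
        Lists Γ ρ k (Γ.m + 1) out := by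
  refine .then (runs_buildGraph ht hg) (t₂ := 81 + Γ.m * (480 + 400 * branchCost k t) +
    310 * ∑ e ∈ Finset.Icc 1 Γ.m, Γ.minDeg e) ?_ (by
      rw [mul_add, mul_add]; omega)
  rintro s₁ ⟨ht₁, hg₁, hm₁⟩
  refine .then (runs_sortBySupport ht₁ hg₁ fun a ha c => ?_)
    (t₂ := 21 + Γ.m * (280 + 400 * branchCost k t) +
    270 * ∑ e ∈ Finset.Icc 1 Γ.m, Γ.minDeg e) ?_ (by
      rw [mul_add, mul_add]; omega)
  · rcases ha with rfl | rfl | rfl <;>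
      rw [hm₁ _ (by decide) (by decide) (by decide), h0 _ (by decide) (by decide)]
  rintro s₂ ⟨ht₂, hg₂, hm₂, hsup₂, hB₂⟩
  refine .then (runs_peel ht₂ hg₂ hB₂ (fun e => ?_) hsup₂)
    (t₂ := 11 + Γ.m * (210 + 400 * branchCost k t) +
    70 * ∑ e ∈ Finset.Icc 1 Γ.m, Γ.minDeg e) ?_ (by
      rw [mul_add, mul_add]; omega)
  · rw [hm₂ _ (by decide) (by decide) (by decide) (by decide) (by decide),
      hm₁ _ (by decide) (by decide) (by decide), h0 _ (by decide) (by decide)]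
  rintro s₃ ⟨ht₃, hg₃, hO, hgr⟩
  refine .then (runs_branchTop hO ht₃ hg₃ (fun _ => rfl) (fun _ => rfl) hk (B := branchCost k t)
    fun i VL Es hi hi' hI hlen => Nat.le_floor ?_) (t₂ := 1) ?_ (by omega)
  · refine (hI.listCost_le hO (by omega) (by omega)).trans ?_
    rw [hlen]
    have := hτ _ _ hO hgr i hi hi'
    gcongr
  · rintro s₄ ⟨⟨out, ht₄, hl⟩, hm₄⟩
    refine .nil ⟨hg₃.congr fun a ha => hm₄ a (by rintro h; simp at ha h; grind), out, ht₄, _, ?_, ?_,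
      hl⟩ le_rfl
    · simpa only [hm₄ .ord (by decide)] using hO
    · simpa only [hm₄ .ord (by decide)] using hgr

variable {n : ℕ} {G : SimpleGraph (Fin n)} {L : List (Fin n × Fin n)}

theorem topLevel_input (hL : IsEdgeList G L) : TopLevel hL.numGraph k [] (input k L) := by
  refine ⟨rfl, rfl, rfl, ?_, rfl, rfl, Nat.le_add_left 1 _⟩
  rintro ⟨a, i, j⟩ h
  simp only [input, Finset.mem_product, Finset.mem_insert, Finset.mem_singleton,
    Finset.mem_Icc] at h
  obtain ⟨h₁, ⟨h₂, h₃⟩, rfl⟩ := h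
  have : hL.numGraph.m = L.length := rfl
  rcases h₁ with rfl | rfl <;> exact hL.numGraph.mem_cells (by decide) (by omega)

theorem input_mem {a : Tab} (h₁ : a ≠ .src) (h₂ : a ≠ .dst) (i j : ℕ) :
    (input k L).mem a i j = 0 := by
  cases a <;> first | rfl | contradiction

theorem hasGraphUpTo_input (hL : IsEdgeList G L) :
    HasGraphUpTo hL.numGraph 0 (input k L).mem := by
  refine ⟨fun e h₁ h₂ => ?_, fun e h₁ h₂ => ?_, fun u v => ?_, fun u => ?_, fun u j => ?_⟩
  · obtain ⟨e, rfl⟩ : ∃ e', e = e' + 1 := ⟨e - 1, by omega⟩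
    rfl
  · obtain ⟨e, rfl⟩ : ∃ e', e = e' + 1 := ⟨e - 1, by omega⟩
    rfl
  · rw [input_mem (by decide) (by decide)]
    split_ifs with h <;> omega
  · rw [input_mem (by decide) (by decide)]; rfl
  · rw [input_mem (by decide) (by decide)]; rfl

theorem ncard_edgeSet (hL : IsEdgeList G L) : G.edgeSet.ncard = L.length := by
  classical
  have : G.edgeSet = ((L.map fun p => s(p.1, p.2)).toFinset : Set (Sym2 (Fin n))) := by
    ext e; rw [← hL.2]; simp
  rw [this, Set.ncard_coe_finset, List.toFinset_card_of_nodup hL.1, List.length_map]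

theorem sum_minDeg_le_degeneracy (hL : IsEdgeList G L) :
    ∑ e ∈ Finset.Icc 1 L.length, hL.numGraph.minDeg e ≤ 2 * degeneracy G * L.length := by
  classical
  refine hL.numGraph.sum_minDeg_le fun s hs hne => ?_
  obtain ⟨w, hw⟩ := hne
  have hlt : ∀ w ∈ s, w < n := fun w hw => Finset.mem_range.1 (hs hw)
  obtain ⟨v, hv, hle⟩ := exists_ncard_le_degeneracy (G := G)
    (s := Finset.univ.filter fun w : Fin n => (w : ℕ) ∈ s) ⟨⟨w, hlt w hw⟩, by simpa using hw⟩
  simp only [Finset.mem_filter, Finset.mem_univ, true_and] at hv hle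
  refine ⟨v, hv, le_trans (le_of_eq ?_) hle⟩
  have : {w : Fin n | (w : ℕ) ∈ s ∧ G.Adj v w} = ((Finset.univ.filter fun w : Fin n =>
      (w : ℕ) ∈ s ∧ hL.numGraph.E v w ≠ 0 :) : Set (Fin n)) := by
    ext w
    simp [hL.adj_iff]
  rw [this, Set.ncard_coe_finset, ← Finset.card_map Fin.valEmbedding]
  congr 1
  ext w
  simp only [Finset.mem_map, Finset.mem_filter, Finset.mem_univ, true_and, Fin.valEmbedding_apply]
  constructor
  · rintro ⟨h, h'⟩
    exact ⟨⟨w, hlt w h⟩, ⟨h, h'⟩, rfl⟩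
  · rintro ⟨w, h, rfl⟩
    exact h

/-- All printed numbers are below `n`, so the output can be read in `Fin n`; `x₀` is only the value
of the inverse outside this range. -/
theorem listsCliques_of_lists (hL : IsEdgeList G L) {o ρ : ℕ → ℕ} {out : List ℕ}
    (hO : hL.numGraph.IsOrdering o ρ) (hk : 3 ≤ k) (x₀ : Fin n)
    (h : Lists hL.numGraph ρ k (L.length + 1) out) : ListsCliques G k out := by
  classical
  obtain ⟨Q, rfl, hQ₁, hQ₂, hQ₃⟩ := h
  obtain ⟨g, hg⟩ : ∃ g : ℕ → Fin n, ∀ x, x < n → (g x : ℕ) = x :=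
    ⟨fun x => if h : x < n then ⟨x, h⟩ else x₀, fun x hx => by simp [hx]⟩
  have hlt : ∀ q ∈ Q, ∀ x ∈ q, x < n := fun q hq x hx => by
    have := (NumGraph.mem_cliques.1 ((hQ₃ q.toFinset).1 (List.mem_map_of_mem hq)).1).1 x (by simpa)
    exact List.mem_range.1 this
  have hval : ∀ q ∈ Q, (q.map g).map (fun v : Fin n => (v : ℕ)) = q := fun q hq => by
    rw [List.map_map]
    exact (List.map_congr_left fun x hx => hg x (hlt q hq x hx)).trans (List.map_id _)
  have himg : ∀ q ∈ Q, (q.map g).toFinset.image (fun v : Fin n => (v : ℕ)) = q.toFinset := by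
    intro q hq
    conv_rhs => rw [← hval q hq]
    ext; simp
  refine ⟨Q.map (List.map g), ?_, ?_, ?_, fun s => ?_⟩
  · have hco : ∀ l : List (Fin n), (l.flatMap fun a : Fin n => [(a : ℕ)]) =
        l.map fun v : Fin n => (v : ℕ) :=
      fun l => List.map_eq_flatMap.symm
    rw [List.map_id', List.bind_eq_flatMap]
    refine Eq.trans ?_ (hco _).symm
    rw [List.map_flatten, List.map_map]
    congr 1
    exact ((List.map_congr_left hval).trans (List.map_id _)).symm
  · simp only [List.mem_map]
    rintro _ ⟨q, hq, rfl⟩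
    rw [List.length_map, hQ₁ q hq]
  · rw [List.map_map]
    refine (List.nodup_map_iff_inj_on (hQ₂.of_map _)).2 fun q hq q' hq' heq => ?_
    refine List.inj_on_of_nodup_map hQ₂ hq hq' ?_
    rw [← himg q hq, ← himg q' hq']
    exact congrArg _ heq
  · have h₁ : s ∈ (Q.map (List.map g)).map List.toFinset ↔
        s.image (fun v : Fin n => (v : ℕ)) ∈ Q.map List.toFinset := by
      simp only [List.map_map, List.mem_map, Function.comp_apply]
      refine exists_congr fun q => and_congr_right fun hq => ?_
      rw [← himg q hq, (Finset.image_injective Fin.val_injective).eq_iff]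
    rw [h₁, hQ₃, NumGraph.mem_cliques, SimpleGraph.isNClique_iff, SimpleGraph.isClique_iff,
      Finset.card_image_of_injective _ Fin.val_injective]
    have hpos : ∀ x y : Fin n, 0 < ρ (hL.numGraph.E x y) ↔ G.Adj x y := by
      intro x y
      rw [hL.adj_iff]
      exact ⟨fun h => hO.E_ne_zero h, fun h =>
        (hO.rank_edge _ (Nat.pos_of_ne_zero h) (hL.numGraph.E_le _ _)).1⟩
    constructor
    · rintro ⟨⟨-, h₂, h₃⟩, -⟩
      refine ⟨fun x hx y hy hxy => (hpos x y).1 (h₃ x ?_ y ?_ (Fin.val_injective.ne hxy)), h₂⟩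
      exacts [Finset.mem_image_of_mem _ hx, Finset.mem_image_of_mem _ hy]
    · rintro ⟨h₂, h₃⟩
      refine ⟨⟨?_, h₃, ?_⟩, ?_⟩
      · simp only [Finset.mem_image]
        rintro _ ⟨x, -, rfl⟩
        exact List.mem_range.2 x.2
      · simp only [Finset.mem_image]
        rintro _ ⟨x, hx, rfl⟩ _ ⟨y, hy, rfl⟩ hxy
        exact (hpos x y).2 (h₂ hx hy fun h => hxy (by rw [h]))
      -- A clique with `k ≥ 3` vertices has an edge, and all ranks are at most `m`; so the
      -- restriction in `Lists` is void after the last round.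
      · obtain ⟨x, hx, y, hy, hxy⟩ := Finset.one_lt_card.1 (by omega : 1 < s.card)
        refine ⟨x, Finset.mem_image_of_mem _ hx, y, Finset.mem_image_of_mem _ hy,
          Fin.val_injective.ne hxy, ?_⟩
        have h₄ := hL.adj_iff.1 (h₂ hx hy hxy)
        exact Nat.lt_succ_of_le
          (hO.rank_edge _ (Nat.pos_of_ne_zero h₄) (hL.numGraph.E_le _ _)).2.1

theorem map_edgeSeq (hL : IsEdgeList G L) {ρ : ℕ → ℕ} (hg : HasGraph hL.numGraph s.mem)
    (hO : hL.numGraph.IsOrdering (s.mem .ord · 0) ρ) (d : Sym2 (Fin n)) :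
    (edgeSeq L d (s.mem .ord · 0)).map (Sym2.map (fun v : Fin n => (v : ℕ))) =
      finalOrdering s L.length := by
  rw [edgeSeq, finalOrdering, List.map_map]
  refine List.map_congr_left fun i hi => ?_
  obtain ⟨h₁, h₂, -⟩ := hO.edge_rank (i + 1) (by omega) (List.mem_range.1 hi)
  rw [hg.src _ h₁ h₂, hg.dst _ h₁ h₂]
  obtain ⟨e, he⟩ : ∃ e, s.mem .ord (i + 1) 0 = e + 1 := ⟨_, (Nat.succ_pred (by omega)).symm⟩
  replace h₂ : e < L.length := by rw [he] at h₂; exact h₂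
  rw [he, numGraph_a hL h₂, numGraph_b hL h₂]
  simp [List.getElem?_eq_getElem h₂, he]

end EBBkCT

/-! ### The theorem -/

theorem mainTheorem1 :
    ∃ C : ℝ, 0 < C ∧
      ∀ (n k : ℕ) (G : SimpleGraph (Fin n)) (L : List (Fin n × Fin n)),
        3 ≤ k → G.edgeSet.Nonempty → EBBkCT.IsEdgeList G L →
        ∃ s : RAM.State EBBkCT.Reg EBBkCT.Tab,
          EBBkCT.RunsTo k L s ∧
          EBBkCT.ListsCliques G k s.output ∧
          (s.space : ℝ) ≤ C * ((G.edgeSet.ncard : ℝ) + n) ∧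
          (∃ p, IsTrussOrdering G p ∧
            p.map (Sym2.map (fun v : Fin n => (v : ℕ))) =
              EBBkCT.finalOrdering s G.edgeSet.ncard) ∧
          ∀ p, IsTrussOrdering G p →
            tau p < degeneracy G ∧
            (s.time : ℝ) ≤ C * ((degeneracy G : ℝ) * G.edgeSet.ncard +
              k * G.edgeSet.ncard * ((tau p : ℝ) / 2) ^ (k - 2)) := by
  refine ⟨20000, by norm_num, fun n k G L hk hG hL => ?_⟩
  obtain ⟨d, hd⟩ := hG
  have hm : 1 ≤ L.length := by
    have := (hL.2 d).2 hd
    rw [← List.length_map fun p : Fin n × Fin n => s(p.1, p.2)]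
    exact List.length_pos_of_mem this
  -- With `t` the least `tau`, the bound holds for every ordering `p` by monotonicity; that the
  -- computed ordering stays within `t` is `tau_le`.
  obtain ⟨t, ht⟩ : ∃ t, t = sInf {t | ∃ p, IsTrussOrdering G p ∧ tau p = t} := ⟨_, rfl⟩
  have hτ : ∀ o ρ, hL.numGraph.IsOrdering o ρ → hL.numGraph.Greedy o ρ hL.numGraph.m →
      ∀ i, 1 ≤ i → i ≤ hL.numGraph.m → hL.numGraph.supp ρ i (o i) ≤ t := by
    intro o ρ hO hg i hi hi'
    have h₁ := EBBkCT.isTrussOrdering_edgeSeq (d := d) hO hg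
    obtain ⟨p, hp, h₂⟩ := Nat.sInf_mem (s := {t | ∃ p, IsTrussOrdering G p ∧ tau p = t})
      ⟨_, _, h₁, rfl⟩
    rw [ht, ← h₂]
    exact (EBBkCT.supp_le_tau hO hi hi').trans (h₁.tau_le hp)
  obtain ⟨s, T, h₁, h₂, h₃, out, h₄, ρ, hO, hg, hl⟩ := EBBkCT.runs_program
    (EBBkCT.topLevel_input (k := k) hL) (EBBkCT.hasGraphUpTo_input hL)
    (fun a h h' i => EBBkCT.input_mem h h' i 0) hk hτ 0
  have hsum := EBBkCT.sum_minDeg_le_degeneracy hL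
  replace h₂ : T ≤ 91 + L.length * (550 + 400 * EBBkCT.branchCost k t) +
    310 * ∑ e ∈ Finset.Icc 1 L.length, hL.numGraph.minDeg e := by
      rw [zero_add] at h₂; exact h₂
  rw [EBBkCT.ncard_edgeSet hL]
  refine ⟨s.withTime T, h₁, ?_, ?_, ⟨_, EBBkCT.isTrussOrdering_edgeSeq (d := d) hO hg,
    EBBkCT.map_edgeSeq hL h₃ hO d⟩, fun p hp => ⟨hp.tau_lt_degeneracy ⟨d, hd⟩, ?_⟩⟩
  · rw [show (s.withTime T).output = out from h₄.output]
    exact EBBkCT.listsCliques_of_lists hL hO hk d.out.1 hl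
  · have hused : s.used.card ≤ 18 * L.length + 14 * n + 28 :=
      (Finset.card_le_card h₄.used).trans hL.numGraph.card_cells_le
    have hdepth : s.maxDepth ≤ n + 1 := h₄.maxDepth
    -- Cells and stack give `18m + 14n + 28 + 21(n + 1) = 18m + 35n + 49`, and `m ≥ 1` absorbs the
    -- constant.
    have : (s.withTime T).space ≤ 70 * (L.length + n) := by
      have hspace : (s.withTime T).space = s.used.card + s.maxDepth * (20 + 1) := rfl
      omega
    have h : ((s.withTime T).space : ℝ) ≤ 70 * ((L.length : ℝ) + n) := by exact_mod_cast this
    refine h.trans (mul_le_mul_of_nonneg_right (by norm_num) (by positivity))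
  · have hδ : (1 : ℝ) ≤ degeneracy G := by
      exact_mod_cast Nat.one_le_of_lt (hp.tau_lt_degeneracy ⟨d, hd⟩)
    have hm' : (1 : ℝ) ≤ L.length := by exact_mod_cast hm
    have hcost : (EBBkCT.branchCost k t : ℝ) ≤ 20 + 40 * k * ((tau p : ℝ) / 2) ^ (k - 2) := by
      refine (Nat.floor_le (by positivity)).trans ?_
      have : t ≤ tau p := by rw [ht]; exact Nat.sInf_le ⟨p, hp, rfl⟩
      gcongr
    have hT : (T : ℝ) ≤ 91 + L.length * (550 + 400 * EBBkCT.branchCost k t) +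
        310 * (2 * degeneracy G * L.length) := by
      exact_mod_cast h₂.trans (by gcongr)
    show (T : ℝ) ≤ _
    have h₅ := mul_le_mul_of_nonneg_left hcost (zero_le_one.trans hm')
    have h₆ : (L.length : ℝ) ≤ degeneracy G * L.length := le_mul_of_one_le_left (by positivity) hδ
    have h₇ : 0 ≤ (k : ℝ) * L.length * ((tau p : ℝ) / 2) ^ (k - 2) := by positivity
    -- All terms linear in `m` go into `δm` because `δ ≥ 1`. The coefficients are at most `91 + 550
    -- + 400 · 20 + 620` for `δm` and `400 · 40` for the other term, both below `20000`.
    nlinarith
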